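/- **Model.** Let $p$ be a probability distribution on $\mathbb Z$ with finite support, $v=\sum_x x\,p(x)$ and $\sigma_1^2=\sum_x (x-v)^2p(x)$. Let $\{X^{x,k}_\cdot : x\in\mathbb Z,\ k\ge 1\}$ be independent discrete-time random walks on $\mathbb Z$ with $X^{x,k}_0=x$ and i.i.d. steps of law $p$. Let the initial occupation numbers $\{\eta_x(0):x\in\mathbb Z\}$ be i.i.d. $\mathbb Z_+$-valued, independent of the walks, with finite mean $\mu=E[\eta_x(0)]$ and finite variance $\sigma_0^2=\operatorname{Var}[\eta_x(0)]$, $\sigma_0\ge 0$. For $n\in\mathbb N$, $t\ge 0$, $r\in\mathbb R$ put $$Y_n(t,r)=\sum_{x\le 0}\sum_{k=1}^{\eta_x(0)}\mathbf 1\{X^{x,k}_{\lfloor nt\rfloor}>\lfloor ntv\rfloor+r\sqrt n\}-\sum_{x>0}\sum_{k=1}^{\eta_x(0)}\mathbf 1\{X^{x,k}_{\lfloor nt\rfloor}\le\lfloor ntv\rfloor+r\sqrt n\},$$ $$\overline Y_n(t,r)=n^{-1/4}\bigl(Y_n(t,r)-EY_n(t,r)\bigr).$$ **Limit process.** Let $\varphi_{w}$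 and $\Phi_{w}$ be the density and distribution function of the centered Gaussian law with variance $w$ (for $w=0$ this law is the point mass at $0$). Put $\Psi_{w}(x)=w\varphi_{w}(x)-x(1-\Phi_{w}(x))$, so that $\Psi_0(x)=\max(-x,0)$, and $$\Gamma_1\bigl((s,q),(t,r)\bigr)=\Psi_{\sigma_1^2(t+s)}(r-q)-\Psi_{\sigma_1^2|t-s|}(r-q),$$ $$\Gamma_2\bigl((s,q),(t,r)\bigr)=\Psi_{\sigma_1^2s}(-q)+\Psi_{\sigma_1^2t}(r)-\Psi_{\sigma_1^2(t+s)}(r-q).$$ Let $W$ be a two-parameter Brownian motion on $\mathbb R_+\times\mathbb R$ and $B$ an independent two-sided Brownian motion on $\mathbb R$. For $(t,r)\in\mathbb R_+\times\mathbb R$ let $$Z(t,r)=\sigma_1\sqrt\mu\iint_{[0,t]\times\mathbb R}\varphi_{\sigma_1^2(t-s)}(r-x)\,dW(s,x)+\sigma_0\int_{\mathbb R}\varphi_{\sigma_1^2t}(r-x)B(x)\,dx,$$ where the first integral is the $L^2$ white-noise integral (so $Z(t,r)$ is defined up to null sets), the last integral is read as $B(r)$ if $\sigma_1^2t=0$,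 and the first term is $0$ if $\sigma_1=0$. **Theorem 2.1.** For all $n,t,r$, the sums defining $Y_n(t,r)$ converge almost surely and $Y_n(t,r)$ is integrable. The process $Z$ is well defined and has a jointly measurable version. It is a mean-zero Gaussian process with covariance $$E[Z(s,q)Z(t,r)]=\mu\,\Gamma_1\bigl((s,q),(t,r)\bigr)+\sigma_0^2\,\Gamma_2\bigl((s,q),(t,r)\bigr).$$ Every jointly measurable version of $Z$ is a weak solution of the linear stochastic heat equation $$Z_t=\tfrac{\sigma_1^2}{2}Z_{rr}+\sigma_1\sqrt\mu\,\dot W,\qquad Z(0,r)=\sigma_0B(r),$$ that is, $Z(0,r)=\sigma_0 B(r)$ a.s. for every $r$, and for all $\phi\in C_c^\infty(\mathbb R)$ and $t\ge 0$, almost surely all integrals below exist and $$\int\phi(r)Z(t,r)\,dr-\sigma_0\int\phi(r)B(r)\,dr=\tfrac{\sigma_1^2}{2}\iint_{[0,t]\times\mathbb R}\phi''(r)Z(s,r)\,dr\,ds+\sigma_1\sqrt\mu\iint_{[0,t]\times\mathbb R}\phi(r)\,dW(s,r).$$ Finally, as $n\to\infty$, the finite-dimensional distributions of $\overline Y_n$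 converge weakly to those of $Z$: for all $k$ and all $(t_1,r_1),\dots,(t_k,r_k)\in\mathbb R_+\times\mathbb R$, $$\bigl(\overline Y_n(t_1,r_1),\dots,\overline Y_n(t_k,r_k)\bigr)\Longrightarrow\bigl(Z(t_1,r_1),\dots,Z(t_k,r_k)\bigr).$$ -/

import Mathlib

open MeasureTheory ProbabilityTheory Filter Topology
open scoped NNReal ENNReal

noncomputable section

/-! ### The particle system -/

/-- Mean speed `v = ∑ x p(x)` of a step distribution on `ℤ`. -/
def stepMean (p : PMF ℤ) : ℝ := ∑' x : ℤ, (x : ℝ) * (p x).toReal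

/-- Step variance `σ₁² = ∑ (x - v)² p(x)`, as a nonnegative real. -/
def stepVar (p : PMF ℤ) : ℝ≥0 :=
  ⟨∑' x : ℤ, ((x : ℝ) - stepMean p) ^ 2 * (p x).toReal,
    tsum_nonneg fun _ => mul_nonneg (sq_nonneg _) ENNReal.toReal_nonneg⟩

/-- `S` is a discrete-time random walk on `ℤ` started at `x` with step distribution `p`:
its steps are i.i.d. with law `p`. -/
structure IsRandomWalk {Ω : Type*} [MeasurableSpace Ω] (P : Measure Ω) (p : PMF ℤ) (x : ℤ)
    (S : ℕ → Ω → ℤ) : Prop where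
  measurable : ∀ s, Measurable (S s)
  start : ∀ᵐ ω ∂P, S 0 ω = x
  indep_steps : iIndepFun (fun s ω => S (s + 1) ω - S s ω) P
  law_steps : ∀ s, HasLaw (fun ω => S (s + 1) ω - S s ω) p.toMeasure P

/-- Independent random walks `X x k` (the walk of the `(k+1)`-st particle that starts at `x`), and
an independent family of i.i.d. initial occupation numbers `η x` with mean `m` and variance
`σ₀ ^ 2`. -/
structure IsWalkSystem {Ω : Type*} [MeasurableSpace Ω] (P : Measure Ω) (p : PMF ℤ) (m σ₀ : ℝ)
    (η : ℤ → Ω → ℕ) (X : ℤ → ℕ → ℕ → Ω → ℤ) : Prop where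
  walk : ∀ x k, IsRandomWalk P p x (X x k)
  indep_walks : iIndepFun (fun (i : ℤ × ℕ) ω (s : ℕ) => X i.1 i.2 s ω) P
  measurable_occ : ∀ x, Measurable (η x)
  indep_occ : iIndepFun η P
  ident_occ : ∀ x, IdentDistrib (η x) (η 0) P P
  memLp_occ : MemLp (fun ω => (η 0 ω : ℝ)) 2 P
  mean_occ : ∫ ω, (η 0 ω : ℝ) ∂P = m
  var_occ : variance (fun ω => (η 0 ω : ℝ)) P = σ₀ ^ 2
  indep_occ_walks : IndepFun (fun ω x => η x ω) (fun ω (i : ℤ × ℕ) (s : ℕ) => X i.1 i.2 s ω) P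

/-- The position `⌊n t v⌋ + r √n` of the observer. -/
def observer (v : ℝ) (n : ℕ) (t : ℝ≥0) (r : ℝ) : ℝ :=
  (⌊(n : ℝ) * t * v⌋ : ℝ) + r * √(n : ℝ)

/-- Number of particles that start at `x` and are strictly to the right of the observer at time
`⌊n t⌋`. -/
def numRight {Ω : Type*} (v : ℝ) (η : ℤ → Ω → ℕ) (X : ℤ → ℕ → ℕ → Ω → ℤ) (n : ℕ) (t : ℝ≥0) (r : ℝ)
    (ω : Ω) (x : ℤ) : ℝ :=
  ∑ k ∈ Finset.range (η x ω),
    if observer v n t r < (X x k ⌊(n : ℝ≥0) * t⌋₊ ω : ℝ) then 1 else 0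

/-- Number of particles that start at `x` and are not to the right of the observer at time
`⌊n t⌋`. -/
def numLeft {Ω : Type*} (v : ℝ) (η : ℤ → Ω → ℕ) (X : ℤ → ℕ → ℕ → Ω → ℤ) (n : ℕ) (t : ℝ≥0) (r : ℝ)
    (ω : Ω) (x : ℤ) : ℝ :=
  ∑ k ∈ Finset.range (η x ω),
    if (X x k ⌊(n : ℝ≥0) * t⌋₊ ω : ℝ) ≤ observer v n t r then 1 else 0

/-- The current `Y_n(t,r)`. -/
def current {Ω : Type*} (v : ℝ) (η : ℤ → Ω → ℕ) (X : ℤ → ℕ → ℕ → Ω → ℤ) (n : ℕ) (t : ℝ≥0) (r : ℝ)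
    (ω : Ω) : ℝ :=
  (∑' x : Set.Iic (0 : ℤ), numRight v η X n t r ω x)
    - ∑' x : Set.Ioi (0 : ℤ), numLeft v η X n t r ω x

/-- The centered and scaled current `n^{-1/4} (Y_n(t,r) - E Y_n(t,r))`. -/
def scaledCurrent {Ω : Type*} [MeasurableSpace Ω] (P : Measure Ω) (v : ℝ) (η : ℤ → Ω → ℕ)
    (X : ℤ → ℕ → ℕ → Ω → ℤ) (n : ℕ) (t : ℝ≥0) (r : ℝ) (ω : Ω) : ℝ :=
  (n : ℝ) ^ (-(1 / 4) : ℝ) * (current v η X n t r ω - ∫ ω', current v η X n t r ω' ∂P)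

/-! ### The covariance of the limit -/

/-- `Ψ_w(x) = w φ_w(x) - x (1 - Φ_w(x))`, where `φ_w`, `Φ_w` are the density and the distribution
function of the centered Gaussian law with variance `w` (the point mass at `0` if `w = 0`, so that
`Ψ_0(x) = max (-x) 0`). -/
def gaussPsi (w : ℝ≥0) (x : ℝ) : ℝ :=
  w * gaussianPDFReal 0 w x - x * (1 - cdf (gaussianReal 0 w) x)

/-- `Γ₁((s,q),(t,r))`; the first argument `w` is `σ₁²`. -/
def covDyn (w : ℝ≥0) (a b : ℝ≥0 × ℝ) : ℝ :=
  gaussPsi (w * (b.1 + a.1)) (b.2 - a.2) - gaussPsi (w * nndist b.1 a.1) (b.2 - a.2)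

/-- `Γ₂((s,q),(t,r))`; the first argument `w` is `σ₁²`. -/
def covInit (w : ℝ≥0) (a b : ℝ≥0 × ℝ) : ℝ :=
  gaussPsi (w * a.1) (-a.2) + gaussPsi (w * b.1) b.2 - gaussPsi (w * (b.1 + a.1)) (b.2 - a.2)

/-! ### Brownian motions and the white-noise integral -/

/-- Two-sided standard Brownian motion on `ℝ`: the processes `x ↦ B x` and `x ↦ B (-x)`, `x ≥ 0`,
are independent standard Brownian motions. -/
structure IsTwoSidedBrownian {Ω : Type*} [MeasurableSpace Ω] (P : Measure Ω) (B : ℝ → Ω → ℝ) :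
    Prop where
  measurable : ∀ x, Measurable (B x)
  right : IsBrownianReal (fun x : ℝ≥0 => B x) P
  left : IsBrownianReal (fun x : ℝ≥0 => B (-(x : ℝ))) P
  indep : IndepFun (fun ω (x : ℝ≥0) => B x ω) (fun ω (x : ℝ≥0) => B (-(x : ℝ)) ω) P

/-- Two-parameter Brownian motion (Brownian sheet) on `ℝ₊ × ℝ`: a centered Gaussian process with
almost surely continuous paths and covariance
`E[W(s,x) W(t,y)] = min(s,t) · (|x| + |y| - |x - y|) / 2`.  The second factor is `min(|x|,|y|)` if
`x`, `y` are on the same side of `0`, and `0` otherwise. -/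
structure IsBrownianSheet {Ω : Type*} [MeasurableSpace Ω] (P : Measure Ω) (W : ℝ≥0 × ℝ → Ω → ℝ) :
    Prop where
  measurable : ∀ z, Measurable (W z)
  gaussian : IsGaussianProcess W P
  mean : ∀ z, ∫ ω, W z ω ∂P = 0
  cov : ∀ z z', ∫ ω, W z ω * W z' ω ∂P
    = (min z.1 z'.1 : ℝ≥0) * ((|z.2| + |z'.2| - |z.2 - z'.2|) / 2)
  cont : ∀ᵐ ω ∂P, Continuous fun z => W z ω

/-- Lebesgue measure on `ℝ₊ × ℝ`. -/
def timeSpaceVolume : Measure (ℝ≥0 × ℝ) :=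
  (((volume : Measure ℝ).restrict (Set.Ici 0)).map Real.toNNReal).prod volume

/-- A rectangle `(s, t] × (x, y]` in `ℝ₊ × ℝ`. -/
structure TimeSpaceRect where
  (s t : ℝ≥0)
  (x y : ℝ)
  hst : s ≤ t
  hxy : x ≤ y

/-- The increment of `W` over a rectangle. -/
def TimeSpaceRect.increment {Ω : Type*} (R : TimeSpaceRect) (W : ℝ≥0 × ℝ → Ω → ℝ) (ω : Ω) : ℝ :=
  W (R.t, R.y) ω - W (R.s, R.y) ω - W (R.t, R.x) ω + W (R.s, R.x) ω

/-- The step function `∑ c_R 1_R`. -/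
def stepFun (g : TimeSpaceRect →₀ ℝ) (z : ℝ≥0 × ℝ) : ℝ :=
  g.sum fun R c => c * (Set.Ioc R.s R.t ×ˢ Set.Ioc R.x R.y).indicator 1 z

/-- The integral `∑ c_R W(R)` of the step function `∑ c_R 1_R`. -/
def stepIntegral {Ω : Type*} (W : ℝ≥0 × ℝ → Ω → ℝ) (g : TimeSpaceRect →₀ ℝ) (ω : Ω) : ℝ :=
  g.sum fun R c => c * R.increment W ω

/-- `I` is (a version of) the white-noise integral `∬ f dW` of `f ∈ L²(ℝ₊ × ℝ)`: the `L²(P)` limit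
of the integrals of step functions that converge to `f` in `L²(ℝ₊ × ℝ)`. -/
def IsWhiteNoiseIntegral {Ω : Type*} [MeasurableSpace Ω] (P : Measure Ω) (W : ℝ≥0 × ℝ → Ω → ℝ)
    (f : ℝ≥0 × ℝ → ℝ) (I : Ω → ℝ) : Prop :=
  MemLp f 2 timeSpaceVolume ∧ MemLp I 2 P ∧ ∃ g : ℕ → TimeSpaceRect →₀ ℝ,
    Tendsto (fun j => eLpNorm (fun z => stepFun (g j) z - f z) 2 timeSpaceVolume) atTop (𝓝 0) ∧
    Tendsto (fun j => eLpNorm (fun ω => stepIntegral W (g j) ω - I ω) 2 P) atTop (𝓝 0)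

/-! ### The limit process -/

/-- The integrand `(s,x) ↦ 1{s ≤ t} φ_{w (t - s)}(r - x)`. -/
def heatKernel (w t : ℝ≥0) (r : ℝ) (z : ℝ≥0 × ℝ) : ℝ :=
  if z.1 ≤ t then gaussianPDFReal 0 (w * (t - z.1)) (r - z.2) else 0

/-- `Z` is (a version of) the process
`Z(t,r) = a ∬_{[0,t]×ℝ} φ_{w(t-s)}(r-x) dW(s,x) + σ₀ ∫ φ_{wt}(r-x) B(x) dx`.
The last integral is written as the integral of `B` against the Gaussian law with mean `r` and
variance `w t`; it is `B(r)` if `w t = 0`. -/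
def IsLimitProcess {Ω : Type*} [MeasurableSpace Ω] (P : Measure Ω) (w : ℝ≥0) (a σ₀ : ℝ)
    (W : ℝ≥0 × ℝ → Ω → ℝ) (B : ℝ → Ω → ℝ) (Z : ℝ≥0 × ℝ → Ω → ℝ) : Prop :=
  ∀ (t : ℝ≥0) (r : ℝ), ∃ I : Ω → ℝ, IsWhiteNoiseIntegral P W (heatKernel w t r) I ∧
    ∀ᵐ ω ∂P, Integrable (fun x => B x ω) (gaussianReal r (w * t)) ∧
      Z (t, r) ω = a * I ω + σ₀ * ∫ x, B x ω ∂(gaussianReal r (w * t))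

/-- `Z` is a weak solution of the linear stochastic heat equation
`Z_t = (w/2) Z_rr + a Ẇ`, `Z(0,r) = σ₀ B(r)`, on `ℝ₊ × ℝ`. -/
structure IsWeakSolutionSHE {Ω : Type*} [MeasurableSpace Ω] (P : Measure Ω) (w : ℝ≥0) (a σ₀ : ℝ)
    (W : ℝ≥0 × ℝ → Ω → ℝ) (B : ℝ → Ω → ℝ) (Z : ℝ≥0 × ℝ → Ω → ℝ) : Prop where
  measurable : Measurable fun q : (ℝ≥0 × ℝ) × Ω => Z q.1 q.2
  initial : ∀ r, ∀ᵐ ω ∂P, Z (0, r) ω = σ₀ * B r ω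
  weak : ∀ φ : ℝ → ℝ, ContDiff ℝ (⊤ : ℕ∞) φ → HasCompactSupport φ → ∀ t : ℝ≥0, ∃ I : Ω → ℝ,
    IsWhiteNoiseIntegral P W (fun z => if z.1 ≤ t then φ z.2 else 0) I ∧
    ∀ᵐ ω ∂P,
      Integrable (fun r => φ r * Z (t, r) ω) ∧
      Integrable (fun r => φ r * B r ω) ∧
      IntegrableOn (fun z : ℝ≥0 × ℝ => iteratedDeriv 2 φ z.2 * Z z ω)
        (Set.Iic t ×ˢ Set.univ) timeSpaceVolume ∧
      (∫ r, φ r * Z (t, r) ω) - σ₀ * ∫ r, φ r * B r ω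
        = (w : ℝ) / 2 * (∫ z in Set.Iic t ×ˢ Set.univ,
            iteratedDeriv 2 φ z.2 * Z z ω ∂timeSpaceVolume) + a * I ω

end

/-! Everything is expressed through g(x,v) = E|x + N_v| (`gaussAbs`), where N_v is centred Gaussian
with variance v. Since Ψ_v(x) = (g(x,v) - x)/2 (`gaussPsi_eq`), with w = σ₁² the covariances become
Γ₁ = (g(r-q, w(t+s)) - g(r-q, w|t-s|))/2 and Γ₂ = (g(q, ws) + g(r, wt) - g(r-q, w(t+s)))/2. Both the
limit process and the particle system produce these expressions.

The limit process. The white-noise integral is the isometry that extends the integral of step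
functions (`IsBrownianSheet.wienerLp`), so Z becomes a map `limitLp` into L²(P) and claims about Z
become claims about inner products. As |x| has second derivative 2δ₀, ∂g/∂v = φ_v
(`hasDerivAt_gaussAbs_var`); with the convolution identity for Gaussian densities this shows that w
times the inner product of two heat kernels is Γ₁. Gaussian averages of B have covariance Γ₂ because
E[B_x B_y] = (|x| + |y| - |x-y|)/2. All these elements lie in the closed span of Gaussian variables,
and being centred Gaussian is a closed condition in L² (`isClosed_isCenteredGaussianLp`). Continuity
of the covariance gives a jointly measurable version. For the weak equation, both sides are
integrated over an arbitrary event; Fubini leaves a deterministic identity, the heat equation for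
the kernel in dual form (`heatKernel_duality`).

The convergence. A particle with start x and step sequence ξ contributes 1{α < x} - 1{0 < x} to the
current, where α is the observer's integer position minus the displacement (`crossing`,
`backPosition`). Summed over x, the product of two such terms is (|α| + |β| - |α-β|)/2
(`sum_crossing_mul`), again the covariance of two-sided Brownian motion. So the sums over x of E[h
h'] and of E[h] E[h'] are mean absolute values of back positions and of their differences, for one
walk and for two independent walks. Divided by √n they converge, by the central limit theorem and
bounded second moments, to Γ₁ + Γ₂ and to Γ₂. A site contributes the variance μ Var h + σ₀² (E h)²,
and the total is μ Γ₁ + σ₀² Γ₂.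

The characteristic function of a linear combination of currents is a product over sites of G(ψ_x),
with G the generating function of an occupation number and ψ_x the characteristic function of the
scaled weight h_x. A second-order expansion of G at 1, which needs only two moments, replaces each
factor by a Gaussian one with error ε n^{-1/2} E|h_x| (`exists_norm_sub_exp_le`). Since the sum of
E|h_x| is O(√n) (`sum_integral_abs_crossWeight_le`), the total error is O(ε), and Lévy's theorem
with the Cramér–Wold device concludes. -/

/-! ### Absolute moments of Gaussian laws and the function Ψ. -/

/-- The absolute first moment of a Gaussian law. -/
noncomputable def gaussAbs (μ : ℝ) (v : ℝ≥0) : ℝ := ∫ x, |x| ∂gaussianReal μ v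

lemma gaussianReal_eq_map_std_add (μ : ℝ) (v : ℝ≥0) :
    gaussianReal μ v = (gaussianReal 0 1).map (fun n => μ + √(v : ℝ) * n) := by
  have h1 := gaussianReal_map_const_mul (μ := 0) (v := 1) (√(v : ℝ))
  have h2 := gaussianReal_map_const_add (μ := √(v : ℝ) * 0) (v := .mk (√(v : ℝ) ^ 2) (sq_nonneg _) * 1) μ
  rw [← h1, Measure.map_map (by fun_prop) (by fun_prop)] at h2
  rw [show (fun n : ℝ => μ + √(v : ℝ) * n) = (fun x => μ + x) ∘ (fun x => √(v : ℝ) * x) from rfl, h2]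
  congr 1
  · simp
  · ext; simp

lemma integral_gaussianReal_eq_std {μ : ℝ} {v : ℝ≥0} {f : ℝ → ℝ} (hf : Measurable f) :
    ∫ x, f x ∂gaussianReal μ v = ∫ n, f (μ + √(v : ℝ) * n) ∂gaussianReal 0 1 := by
  rw [gaussianReal_eq_map_std_add μ v, integral_map (by fun_prop) hf.aestronglyMeasurable]

lemma integrable_id_gaussianReal (μ : ℝ) (v : ℝ≥0) :
    Integrable (fun x : ℝ => x) (gaussianReal μ v) :=
  memLp_one_iff_integrable.1 (memLp_id_gaussianReal' 1 (by simp))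

lemma integrable_abs_gaussianReal (μ : ℝ) (v : ℝ≥0) :
    Integrable (fun x : ℝ => |x|) (gaussianReal μ v) := (integrable_id_gaussianReal μ v).abs

lemma gaussAbs_eq_std (μ : ℝ) (v : ℝ≥0) :
    gaussAbs μ v = ∫ n, |μ + √(v : ℝ) * n| ∂gaussianReal 0 1 :=
  integral_gaussianReal_eq_std (by fun_prop)

lemma gaussAbs_zero (μ : ℝ) : gaussAbs μ 0 = |μ| := by
  simp [gaussAbs, gaussianReal_zero_var]

lemma gaussAbs_neg (μ : ℝ) (v : ℝ≥0) : gaussAbs (-μ) v = gaussAbs μ v := by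
  unfold gaussAbs
  rw [← gaussianReal_map_neg, integral_map (by fun_prop) (by fun_prop)]
  simp

/-- Both laws are coupled as affine images of one standard Gaussian. Variance 0 is included, so
continuity holds up to the degenerate case. -/
lemma abs_gaussAbs_sub_le (μ μ' : ℝ) (v v' : ℝ≥0) :
    |gaussAbs μ v - gaussAbs μ' v'| ≤ |μ - μ'| + |√(v : ℝ) - √(v' : ℝ)| * gaussAbs 0 1 := by
  have hi : ∀ (μ c : ℝ), Integrable (fun n : ℝ => |μ + c * n|) (gaussianReal 0 1) := fun μ c =>
    ((integrable_const μ).add ((integrable_id_gaussianReal 0 1).const_mul c)).abs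
  rw [gaussAbs_eq_std, gaussAbs_eq_std μ', ← integral_sub (hi _ _) (hi _ _), ← Real.norm_eq_abs]
  have : |μ - μ'| + |√(v : ℝ) - √(v' : ℝ)| * gaussAbs 0 1
      = ∫ n, (|μ - μ'| + |√(v : ℝ) - √(v' : ℝ)| * |n|) ∂gaussianReal 0 1 := by
    rw [integral_add (integrable_const _) ((integrable_abs_gaussianReal 0 1).const_mul _),
      integral_const_mul]
    simp [gaussAbs]
  rw [this]
  refine norm_integral_le_of_norm_le
    ((integrable_const _).add ((integrable_abs_gaussianReal 0 1).const_mul _)) (ae_of_all _ fun n => ?_)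
  rw [Real.norm_eq_abs, ← abs_mul]
  refine (abs_abs_sub_abs_le_abs_sub _ _).trans ?_
  rw [show μ + √(v : ℝ) * n - (μ' + √(v' : ℝ) * n) = (μ - μ') + (√(v : ℝ) - √(v' : ℝ)) * n by ring]
  exact abs_add_le _ _

lemma continuous_gaussAbs : Continuous fun z : ℝ × ℝ≥0 => gaussAbs z.1 z.2 := by
  rw [continuous_iff_continuousAt]
  intro z
  rw [ContinuousAt, tendsto_iff_dist_tendsto_zero]
  have h : Tendsto (fun y : ℝ × ℝ≥0 => |y.1 - z.1| + |√(y.2 : ℝ) - √(z.2 : ℝ)| * gaussAbs 0 1)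
      (𝓝 z) (𝓝 0) := by
    have : Continuous (fun y : ℝ × ℝ≥0 => |y.1 - z.1| + |√(y.2 : ℝ) - √(z.2 : ℝ)| * gaussAbs 0 1) := by
      fun_prop
    simpa using this.tendsto z
  exact squeeze_zero (fun _ => dist_nonneg) (fun y => abs_gaussAbs_sub_le _ _ _ _) h

lemma gaussianPDFReal_zero_mean (v : ℝ≥0) (x : ℝ) :
    gaussianPDFReal 0 v x = (√(2 * Real.pi * v))⁻¹ * Real.exp (-x ^ 2 / (2 * v)) := by
  simp [gaussianPDFReal]

lemma hasDerivAt_gaussianPDFReal_zero_mean {v : ℝ≥0} (hv : v ≠ 0) (x : ℝ) :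
    HasDerivAt (gaussianPDFReal 0 v) (-(x / v) * gaussianPDFReal 0 v x) x := by
  have hv' : (v : ℝ) ≠ 0 := by simpa using hv
  rw [funext (gaussianPDFReal_zero_mean v)]
  have h := (((hasDerivAt_pow 2 x).neg.div_const (2 * (v : ℝ))).exp.const_mul
    (√(2 * Real.pi * v))⁻¹)
  convert! h using 1
  simp only [Pi.neg_apply]
  push_cast
  field_simp

lemma tendsto_gaussianPDFReal_atBot {v : ℝ≥0} (hv : v ≠ 0) :
    Tendsto (gaussianPDFReal 0 v) atBot (𝓝 0) := by
  have hv' : (0 : ℝ) < v := by positivity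
  rw [funext (gaussianPDFReal_zero_mean v)]
  rw [← mul_zero (√(2 * Real.pi * v))⁻¹]
  refine Tendsto.const_mul _ (Real.tendsto_exp_atBot.comp ?_)
  have h2 : Tendsto (fun x : ℝ => x ^ 2) atBot atTop := by
    have := (tendsto_pow_atTop (α := ℝ) (n := 2) (by norm_num)).comp tendsto_neg_atBot_atTop
    simpa [Function.comp_def] using this
  have := (tendsto_neg_atTop_atBot.comp h2).atBot_div_const (r := 2 * (v : ℝ)) (by positivity)
  simpa [Function.comp_def] using this

lemma setIntegral_neg_mul_gaussianPDFReal {v : ℝ≥0} (hv : v ≠ 0) (x : ℝ) :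
    ∫ n in Set.Iic x, -n ∂gaussianReal 0 v = v * gaussianPDFReal 0 v x := by
  have hv' : (v : ℝ) ≠ 0 := by simpa using hv
  have hint : Integrable (fun n : ℝ => gaussianPDFReal 0 v n • n) := by
    have := integrable_id_gaussianReal 0 v
    rw [gaussianReal_of_var_ne_zero _ hv] at this
    rw [integrable_withDensity_iff_integrable_smul' (measurable_gaussianPDF 0 v)
      (ae_of_all _ fun _ => gaussianPDF_lt_top)] at this
    simpa [toReal_gaussianPDF] using this
  rw [gaussianReal_of_var_ne_zero _ hv, setIntegral_withDensity_eq_setIntegral_toReal_smul₀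
    (measurable_gaussianPDF 0 v).aemeasurable (ae_of_all _ fun _ => gaussianPDF_lt_top) _
    measurableSet_Iic]
  simp only [toReal_gaussianPDF]
  have := integral_Iic_of_hasDerivAt_of_tendsto' (a := x) (f := fun n => v * gaussianPDFReal 0 v n)
    (f' := fun n => gaussianPDFReal 0 v n • -n) (m := 0) ?_ ?_ ?_
  · rw [this]; simp
  · intro n _
    convert! (hasDerivAt_gaussianPDFReal_zero_mean hv n).const_mul (v : ℝ) using 1
    simp; field_simp
  · simpa using hint.neg.integrableOn
  · simpa using (tendsto_gaussianPDFReal_atBot hv).const_mul (v : ℝ)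

/-- Write |x - n| = (n - x) + 2 (x - n)⁺; the truncated first moment is explicit because v φ_v is a
primitive of -n φ_v(n). -/
lemma gaussAbs_eq_cdf {v : ℝ≥0} (hv : v ≠ 0) (x : ℝ) :
    gaussAbs x v = x * (2 * cdf (gaussianReal 0 v) x - 1) + 2 * v * gaussianPDFReal 0 v x := by
  have h1 : gaussAbs x v = ∫ n, |x - n| ∂gaussianReal 0 v := by
    unfold gaussAbs
    have := gaussianReal_map_const_sub (μ := 0) (v := v) x
    rw [sub_zero] at this
    rw [← this, integral_map (by fun_prop) (by fun_prop)]
  have hI : Integrable (fun n : ℝ => n - x) (gaussianReal 0 v) :=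
    (integrable_id_gaussianReal 0 v).sub (integrable_const x)
  have hI2 : Integrable (fun n : ℝ => -n + x) (gaussianReal 0 v) :=
    (integrable_id_gaussianReal 0 v).neg.add (integrable_const x)
  have h2 : ∀ n : ℝ, |x - n| = (n - x) + 2 * (Set.Iic x).indicator (fun n => -n + x) n := by
    intro n
    by_cases hn : n ≤ x
    · rw [Set.indicator_of_mem (by simpa using hn), abs_of_nonneg (by linarith)]; ring
    · rw [Set.indicator_of_notMem (by simpa using hn), abs_of_neg (by linarith)]; ring
  rw [h1]
  simp_rw [h2]
  rw [integral_add hI ((hI2.indicator measurableSet_Iic).const_mul 2), integral_const_mul,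
    integral_indicator measurableSet_Iic, integral_add, integral_sub, integral_id_gaussianReal,
    setIntegral_neg_mul_gaussianPDFReal hv]
  · simp [cdf_eq_real]
    ring
  · exact integrable_id_gaussianReal 0 v
  · exact integrable_const x
  · exact (integrable_id_gaussianReal 0 v).neg.integrableOn
  · exact (integrable_const x).integrableOn

/-- The bridge from the stated covariances to mean absolute values; the linear terms cancel in Γ₁
and in Γ₂. -/
lemma gaussPsi_eq (w : ℝ≥0) (x : ℝ) : gaussPsi w x = (gaussAbs x w - x) / 2 := by
  by_cases hw : w = 0
  · subst hw
    rw [gaussAbs_zero]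
    simp only [gaussPsi, gaussianReal_zero_var, cdf_eq_real]
    by_cases hx : 0 ≤ x
    · simp [measureReal_def, hx, abs_of_nonneg hx]
    · simp [measureReal_def, hx, abs_of_neg (not_le.1 hx)]
      ring
  · rw [gaussAbs_eq_cdf hw, gaussPsi]; ring

lemma hasDerivAt_cdf_std (x : ℝ) :
    HasDerivAt (fun x => cdf (gaussianReal 0 1) x) (gaussianPDFReal 0 1 x) x := by
  have hc : Continuous (gaussianPDFReal 0 1) := by
    unfold gaussianPDFReal; fun_prop
  have hi := integrable_gaussianPDFReal 0 1
  have h : (fun x => cdf (gaussianReal 0 1) x)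
      = fun x => (∫ y in Set.Iic (0:ℝ), gaussianPDFReal 0 1 y) + ∫ y in (0:ℝ)..x, gaussianPDFReal 0 1 y := by
    ext x
    rw [cdf_eq_real, measureReal_def, gaussianReal_apply_eq_integral 0 one_ne_zero,
      ENNReal.toReal_ofReal (integral_nonneg fun _ => gaussianPDFReal_nonneg _ _ _),
      intervalIntegral.integral_Iic_sub_Iic hi.integrableOn hi.integrableOn |>.symm]
    ring
  rw [h]
  exact (intervalIntegral.integral_hasDerivAt_right (hi.intervalIntegrable)
    (hc.stronglyMeasurableAtFilter _ _) hc.continuousAt).const_add _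

lemma gaussAbs_scale {v : ℝ≥0} (hv : v ≠ 0) (x : ℝ) :
    gaussAbs x v = √(v : ℝ) * gaussAbs (x / √(v : ℝ)) 1 := by
  have hs : 0 < √(v : ℝ) := Real.sqrt_pos.2 (by positivity)
  rw [gaussAbs_eq_std, gaussAbs_eq_std, ← integral_const_mul]
  congr 1
  ext n
  rw [← abs_of_pos hs, ← abs_mul, abs_of_pos hs]
  congr 1
  field_simp
  simp

lemma hasDerivAt_gaussAbs_std (z : ℝ) :
    HasDerivAt (fun z => gaussAbs z 1) (2 * cdf (gaussianReal 0 1) z - 1) z := by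
  rw [funext (gaussAbs_eq_cdf one_ne_zero)]
  have h := ((hasDerivAt_id z).mul (((hasDerivAt_cdf_std z).const_mul 2).sub_const 1)).add
    ((hasDerivAt_gaussianPDFReal_zero_mean one_ne_zero z).const_mul 2)
  convert! h using 1
  · ext; simp
  · simp; ring

lemma gaussianPDFReal_scale {v : ℝ} (hv : 0 < v) (x : ℝ) :
    gaussianPDFReal 0 v.toNNReal x = (√v)⁻¹ * gaussianPDFReal 0 1 (x / √v) := by
  have hs : 0 < √v := Real.sqrt_pos.2 hv
  rw [gaussianPDFReal_zero_mean, gaussianPDFReal_zero_mean, Real.coe_toNNReal _ hv.le]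
  rw [Real.sqrt_mul (by positivity), div_pow, Real.sq_sqrt hv.le]
  simp only [NNReal.coe_one, mul_one]
  rw [mul_inv]
  have : -x ^ 2 / (2 * v) = -(x ^ 2 / v) / 2 := by field_simp
  rw [this]; ring

/-- The heat equation for |x|, whose half second derivative is the point mass at 0. The proof scales
to unit variance, where the terms with the distribution function cancel. -/
lemma hasDerivAt_gaussAbs_var {v : ℝ} (hv : 0 < v) (x : ℝ) :
    HasDerivAt (fun v : ℝ => gaussAbs x v.toNNReal) (gaussianPDFReal 0 v.toNNReal x) v := by
  have hs : 0 < √v := Real.sqrt_pos.2 hv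
  have h1 : HasDerivAt (fun v : ℝ => √v) (1 / (2 * √v)) v := Real.hasDerivAt_sqrt hv.ne'
  have h2 : HasDerivAt (fun v : ℝ => x / √v) (-(x * (1 / (2 * √v))) / √v ^ 2) v := by
    convert! (hasDerivAt_const v x).div h1 hs.ne' using 1
    simp
  have h3 := h1.mul ((hasDerivAt_gaussAbs_std (x / √v)).comp v h2)
  have h4 : (fun v : ℝ => gaussAbs x v.toNNReal) =ᶠ[𝓝 v]
      ((fun v : ℝ => √v) * ((fun z => gaussAbs z 1) ∘ fun v => x / √v)) := by
    filter_upwards [lt_mem_nhds hv] with u hu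
    rw [gaussAbs_scale (by simpa using hu)]
    simp [Real.coe_toNNReal _ hu.le]
  refine (h3.congr_of_eventuallyEq h4).congr_deriv ?_
  rw [gaussianPDFReal_scale hv]
  simp only [Function.comp]
  rw [gaussAbs_eq_cdf one_ne_zero]
  simp only [NNReal.coe_one]
  field_simp
  ring

/-- At x = 0 the density blows up as v tends to 0. No bound is needed: it is the nonnegative
derivative of a function that is continuous up to the endpoint. -/
lemma integrable_gaussianPDFReal_var (x a b : ℝ) (ha : 0 ≤ a) (hab : a ≤ b) :
    IntervalIntegrable (fun v : ℝ => gaussianPDFReal 0 v.toNNReal x) volume a b := by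
  rw [intervalIntegrable_iff_integrableOn_Ioc_of_le hab]
  refine intervalIntegral.integrableOn_deriv_of_nonneg (g := fun v : ℝ => gaussAbs x v.toNNReal) ?_ ?_ ?_
  · exact (continuous_gaussAbs.comp (f := fun v : ℝ => (x, v.toNNReal)) (by fun_prop)).continuousOn
  · exact fun v hv => hasDerivAt_gaussAbs_var (ha.trans_lt hv.1) x
  · exact fun v _ => gaussianPDFReal_nonneg _ _ _

lemma integral_gaussianPDFReal_var (x a b : ℝ) (ha : 0 ≤ a) (hab : a ≤ b) :
    ∫ v in a..b, gaussianPDFReal 0 v.toNNReal x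
      = gaussAbs x b.toNNReal - gaussAbs x a.toNNReal :=
  intervalIntegral.integral_eq_sub_of_hasDeriv_right_of_le hab
    (continuous_gaussAbs.comp (f := fun v : ℝ => (x, v.toNNReal)) (by fun_prop)).continuousOn
    (fun v hv => (hasDerivAt_gaussAbs_var (ha.trans_lt hv.1) x).hasDerivWithinAt)
    (integrable_gaussianPDFReal_var x a b ha hab)

/-- Completing the square: the product is a constant times the Gaussian density with variance
ab/(a+b) and mean (bq + ar)/(a+b). -/
lemma integral_gaussianPDFReal_mul {a b : ℝ≥0} (ha : a ≠ 0) (hb : b ≠ 0) (q r : ℝ) :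
    Integrable (fun x => gaussianPDFReal 0 a (q - x) * gaussianPDFReal 0 b (r - x)) ∧
    ∫ x, gaussianPDFReal 0 a (q - x) * gaussianPDFReal 0 b (r - x)
      = gaussianPDFReal 0 (a + b) (r - q) := by
  have ha' : (0 : ℝ) < a := by positivity
  have hb' : (0 : ℝ) < b := by positivity
  set c : ℝ≥0 := a * b / (a + b) with hc
  have hc0 : c ≠ 0 := by positivity
  set μ : ℝ := (b * q + a * r) / (a + b) with hμ
  have key : ∀ x, gaussianPDFReal 0 a (q - x) * gaussianPDFReal 0 b (r - x)
      = gaussianPDFReal 0 (a + b) (r - q) * gaussianPDFReal μ c x := by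
    intro x
    simp only [gaussianPDFReal, sub_zero]
    rw [mul_mul_mul_comm (√(2 * Real.pi * a))⁻¹, mul_mul_mul_comm (√(2 * Real.pi * (a + b : ℝ≥0)))⁻¹,
      ← Real.exp_add, ← Real.exp_add, ← mul_inv,
      ← mul_inv, ← Real.sqrt_mul (by positivity), ← Real.sqrt_mul (by positivity)]
    congr 2
    · congr 1
      rw [hc]; push_cast; field_simp
    · rw [hμ, hc]; push_cast; field_simp; ring
  simp_rw [key]
  refine ⟨(integrable_gaussianPDFReal μ c).const_mul _, ?_⟩
  rw [integral_const_mul, integral_gaussianPDFReal_eq_one μ hc0, mul_one]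

lemma integrable_gaussianPDFReal_smul_iff {v : ℝ≥0} (hv : v ≠ 0) (μ : ℝ) (f : ℝ → ℝ) :
    Integrable (fun x => gaussianPDFReal μ v x * f x) ↔ Integrable f (gaussianReal μ v) := by
  rw [gaussianReal_of_var_ne_zero _ hv]
  rw [integrable_withDensity_iff_integrable_smul' (measurable_gaussianPDF μ v)
      (ae_of_all _ fun _ => gaussianPDF_lt_top)]
  simp [toReal_gaussianPDF]

/-! ### The heat semigroup on smooth functions. -/

/-- Gaussian integration by parts for bounded functions with bounded derivative. -/
lemma integral_mul_gaussianReal_std {f f' : ℝ → ℝ} (hf : ∀ x, HasDerivAt f (f' x) x)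
    (hf' : Continuous f') {C C' : ℝ} (hC : ∀ x, |f x| ≤ C) (hC' : ∀ x, |f' x| ≤ C') :
    ∫ n, n * f n ∂gaussianReal 0 1 = ∫ n, f' n ∂gaussianReal 0 1 := by
  have hfc : Continuous f := continuous_iff_continuousAt.2 fun x => (hf x).continuousAt
  have i1 : Integrable f (gaussianReal 0 1) :=
    .of_bound hfc.aestronglyMeasurable C (ae_of_all _ hC)
  have i2 : Integrable f' (gaussianReal 0 1) :=
    .of_bound hf'.aestronglyMeasurable C' (ae_of_all _ hC')
  have i3 : Integrable (fun n => n * f n) (gaussianReal 0 1) := by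
    refine ((integrable_id_gaussianReal 0 1).abs.const_mul C).mono'
      (by fun_prop) (ae_of_all _ fun x => ?_)
    rw [Real.norm_eq_abs, abs_mul, mul_comm]
    exact mul_le_mul_of_nonneg_right (hC x) (abs_nonneg _)
  have h := integral_mul_deriv_eq_deriv_mul_of_integrable (u := f) (u' := f')
    (v := gaussianPDFReal 0 1) (v' := fun x => -(x / (1 : ℝ≥0)) * gaussianPDFReal 0 1 x)
    (fun x _ => hf x) (fun x _ => hasDerivAt_gaussianPDFReal_zero_mean one_ne_zero x) ?_ ?_ ?_
  · rw [integral_gaussianReal_eq_integral_smul one_ne_zero,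
      integral_gaussianReal_eq_integral_smul one_ne_zero]
    have e1 : ∫ x, f x * (-(x / ((1 : ℝ≥0) : ℝ)) * gaussianPDFReal 0 1 x)
        = -∫ x, gaussianPDFReal 0 1 x • (x * f x) := by
      rw [← integral_neg]; congr 1; ext x; simp; ring
    rw [e1] at h
    have := neg_inj.1 h
    rw [this]
    congr 1; ext x; simp [mul_comm]
  · have := ((integrable_gaussianPDFReal_smul_iff one_ne_zero 0 _).2 i3).neg
    convert! this using 1
    ext x; simp; ring
  · have := ((integrable_gaussianPDFReal_smul_iff one_ne_zero 0 _).2 i2)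
    convert! this using 1
    ext x; simp; ring
  · have := ((integrable_gaussianPDFReal_smul_iff one_ne_zero 0 _).2 i1)
    convert! this using 1
    ext x; simp; ring

/-- Differentiation under the integral gives E[n φ'(x + √v n)]/(2√v), and Gaussian integration by
parts turns the factor n into √v φ''. The domination is uniform only on u > v/2. -/
lemma hasDerivAt_gaussian_smooth {φ φ' φ'' : ℝ → ℝ} (h1 : ∀ x, HasDerivAt φ (φ' x) x)
    (h2 : ∀ x, HasDerivAt φ' (φ'' x) x) (hc : Continuous φ'') {C C' C'' : ℝ}
    (hC : ∀ x, |φ x| ≤ C) (hC' : ∀ x, |φ' x| ≤ C') (hC'' : ∀ x, |φ'' x| ≤ C'') (x : ℝ) {v : ℝ}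
    (hv : 0 < v) :
    HasDerivAt (fun v : ℝ => ∫ n, φ (x + √v * n) ∂gaussianReal 0 1)
      (1 / 2 * ∫ n, φ'' (x + √v * n) ∂gaussianReal 0 1) v := by
  have hφ : Continuous φ := continuous_iff_continuousAt.2 fun x => (h1 x).continuousAt
  have hφ' : Continuous φ' := continuous_iff_continuousAt.2 fun x => (h2 x).continuousAt
  have hs : 0 < √v := Real.sqrt_pos.2 hv
  have hd := (hasDerivAt_integral_of_dominated_loc_of_deriv_le (μ := gaussianReal 0 1)
    (F := fun v n => φ (x + √v * n)) (F' := fun v n => φ' (x + √v * n) * (1 / (2 * √v) * n))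
    (x₀ := v) (s := Set.Ioi (v / 2)) (bound := fun n => C' * (1 / (2 * √(v / 2)) * |n|))
    (Ioi_mem_nhds (by linarith)) (Eventually.of_forall fun _ => by fun_prop)
    (.of_bound (by fun_prop) C (ae_of_all _ fun n => hC _)) (by fun_prop)
    (ae_of_all _ fun n u hu => ?_) ?_ (ae_of_all _ fun n u hu => ?_)).2
  · convert! hd using 1
    have hst := integral_mul_gaussianReal_std (f := fun n => φ' (x + √v * n))
      (f' := fun n => √v * φ'' (x + √v * n)) (fun n => ?_) (by fun_prop) (C := C') (C' := √v * C'')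
      (fun _ => hC' _) (fun n => ?_)
    · have e : ∀ n, φ' (x + √v * n) * (1 / (2 * √v) * n)
          = 1 / (2 * √v) * (n * φ' (x + √v * n)) := fun n => by ring
      simp_rw [e]
      rw [integral_const_mul, hst, integral_const_mul]
      field_simp
    · have := (h2 (x + √v * n)).comp n (((hasDerivAt_id n).const_mul √v).const_add x)
      convert! this using 1
      simp [mul_comm]
    · rw [abs_mul, abs_of_pos hs]
      exact mul_le_mul_of_nonneg_left (hC'' _) hs.le
  · have hu0 : v / 2 < u := hu
    rw [Real.norm_eq_abs, abs_mul, abs_mul, abs_of_nonneg (by positivity : 0 ≤ 1 / (2 * √u))]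
    refine mul_le_mul (hC' _) ?_ (by positivity) ((abs_nonneg _).trans (hC' 0))
    gcongr
  · exact ((integrable_abs_gaussianReal 0 1).const_mul _).const_mul _
  · have hu0 : 0 < u := lt_trans (by linarith) (show v / 2 < u from hu)
    exact (h1 _).comp u (((Real.hasDerivAt_sqrt hu0.ne').mul_const n).const_add x)

lemma continuous_gaussian_smooth {φ : ℝ → ℝ} (h : Continuous φ) {C : ℝ} (hC : ∀ x, |φ x| ≤ C)
    (x : ℝ) : Continuous fun v : ℝ => ∫ n, φ (x + √v * n) ∂gaussianReal 0 1 :=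
  continuous_of_dominated (bound := fun _ => C) (fun _ => by fun_prop)
    (fun _ => ae_of_all _ fun _ => hC _) (integrable_const C) (ae_of_all _ fun n => by fun_prop)

/-- The heat equation for the Gaussian semigroup, in integrated form. -/
lemma gaussian_smooth_sub {φ φ' φ'' : ℝ → ℝ} (h1 : ∀ x, HasDerivAt φ (φ' x) x)
    (h2 : ∀ x, HasDerivAt φ' (φ'' x) x) (hc : Continuous φ'') {C C' C'' : ℝ}
    (hC : ∀ x, |φ x| ≤ C) (hC' : ∀ x, |φ' x| ≤ C') (hC'' : ∀ x, |φ'' x| ≤ C'') (x : ℝ) {v : ℝ}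
    (hv : 0 ≤ v) :
    (∫ n, φ (x + √v * n) ∂gaussianReal 0 1) - φ x
      = 1 / 2 * ∫ u in (0 : ℝ)..v, ∫ n, φ'' (x + √u * n) ∂gaussianReal 0 1 := by
  have hφ : Continuous φ := continuous_iff_continuousAt.2 fun x => (h1 x).continuousAt
  rw [← intervalIntegral.integral_const_mul,
    intervalIntegral.integral_eq_sub_of_hasDeriv_right_of_le hv
      (continuous_gaussian_smooth hφ hC x).continuousOn
      (fun u hu => (hasDerivAt_gaussian_smooth h1 h2 hc hC hC' hC'' x hu.1).hasDerivWithinAt)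
      (((continuous_gaussian_smooth hc hC'' x).const_mul _).intervalIntegrable _ _)]
  simp

/-! ### Lebesgue measure on the half-line and on time-space rectangles. -/

/-- Lebesgue measure on `ℝ₊`. -/
noncomputable def halfLineVolume : Measure ℝ≥0 :=
  ((volume : Measure ℝ).restrict (Set.Ici 0)).map Real.toNNReal

instance : SFinite halfLineVolume := inferInstanceAs (SFinite (Measure.map _ _))

lemma timeSpaceVolume_eq : timeSpaceVolume = halfLineVolume.prod volume := rfl

instance : SFinite timeSpaceVolume := inferInstanceAs (SFinite (Measure.prod halfLineVolume volume))

lemma preimage_toNNReal_Ioc_inter (s t : ℝ≥0) :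
    Real.toNNReal ⁻¹' Set.Ioc s t ∩ Set.Ici 0 = Set.Ioc (s : ℝ) t := by
  ext x
  simp only [Set.mem_inter_iff, Set.mem_preimage, Set.mem_Ioc, Set.mem_Ici]
  constructor
  · rintro ⟨h, h3⟩
    lift x to ℝ≥0 using h3
    simpa using h
  · rintro h
    have h3 : 0 ≤ x := s.2.trans h.1.le
    lift x to ℝ≥0 using h3
    simpa using h

lemma halfLineVolume_Ioc (s t : ℝ≥0) :
    halfLineVolume (Set.Ioc s t) = ENNReal.ofReal (t - s) := by
  rw [halfLineVolume, Measure.map_apply measurable_real_toNNReal measurableSet_Ioc,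
    Measure.restrict_apply (measurable_real_toNNReal measurableSet_Ioc),
    preimage_toNNReal_Ioc_inter, Real.volume_Ioc]

lemma halfLineVolume_singleton (s : ℝ≥0) : halfLineVolume {s} = 0 := by
  rw [halfLineVolume, Measure.map_apply measurable_real_toNNReal (measurableSet_singleton s),
    Measure.restrict_apply (measurable_real_toNNReal (measurableSet_singleton s))]
  refine measure_mono_null (t := {(s : ℝ)}) ?_ (by simp)
  rintro x ⟨h1, h2⟩
  simp only [Set.mem_preimage, Set.mem_singleton_iff] at h1 ⊢
  rw [← h1, Real.coe_toNNReal _ h2]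

lemma ae_halfLineVolume_ne (s : ℝ≥0) : ∀ᵐ u ∂halfLineVolume, u ≠ s := by
  rw [ae_iff]; simpa using halfLineVolume_singleton s

lemma halfLineVolume_Iic (t : ℝ≥0) : halfLineVolume (Set.Iic t) = ENNReal.ofReal t := by
  have h : Set.Iic t = {0} ∪ Set.Ioc 0 t := by
    ext x; simp only [Set.mem_Iic, Set.mem_union, Set.mem_singleton_iff, Set.mem_Ioc]
    constructor
    · intro h; rcases eq_or_ne x 0 with h0 | h0
      · exact Or.inl h0
      · exact Or.inr ⟨pos_iff_ne_zero.2 h0, h⟩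
    · rintro (h | h)
      · simp [h]
      · exact h.2
  rw [h]
  refine le_antisymm ((measure_union_le _ _).trans ?_) ?_
  · rw [halfLineVolume_singleton, halfLineVolume_Ioc]; simp
  · refine le_trans ?_ (measure_mono Set.subset_union_right)
    rw [halfLineVolume_Ioc]; simp

lemma halfLineVolume_restrict_Ioc (s t : ℝ≥0) :
    halfLineVolume.restrict (Set.Ioc s t)
      = ((volume : Measure ℝ).restrict (Set.Ioc (s : ℝ) t)).map Real.toNNReal := by
  have hm := measurable_real_toNNReal (measurableSet_Ioc (a := s) (b := t))
  rw [halfLineVolume, Measure.restrict_map measurable_real_toNNReal measurableSet_Ioc,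
    Measure.restrict_restrict hm, preimage_toNNReal_Ioc_inter]

lemma setIntegral_halfLineVolume_Ioc {f : ℝ≥0 → ℝ} (hf : Measurable f) {s t : ℝ≥0} (hst : s ≤ t) :
    ∫ u in Set.Ioc s t, f u ∂halfLineVolume = ∫ u in (s : ℝ)..t, f u.toNNReal := by
  rw [halfLineVolume_restrict_Ioc, integral_map (by fun_prop) hf.aestronglyMeasurable,
    intervalIntegral.integral_of_le (by exact_mod_cast hst)]

lemma integrableOn_halfLineVolume_Ioc {f : ℝ≥0 → ℝ} (hf : Measurable f) {s t : ℝ≥0} (hst : s ≤ t) :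
    IntegrableOn f (Set.Ioc s t) halfLineVolume
      ↔ IntervalIntegrable (fun u : ℝ => f u.toNNReal) volume s t := by
  rw [IntegrableOn, halfLineVolume_restrict_Ioc,
    intervalIntegrable_iff_integrableOn_Ioc_of_le (by exact_mod_cast hst),
    integrable_map_measure hf.aestronglyMeasurable (by fun_prop)]
  rfl

namespace TimeSpaceRect

/-- The rectangle as a set. -/
def toSet (R : TimeSpaceRect) : Set (ℝ≥0 × ℝ) := Set.Ioc R.s R.t ×ˢ Set.Ioc R.x R.y

lemma measurableSet_toSet (R : TimeSpaceRect) : MeasurableSet R.toSet :=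
  measurableSet_Ioc.prod measurableSet_Ioc

lemma volume_Ioc_prod (s t : ℝ≥0) (x y : ℝ) :
    timeSpaceVolume (Set.Ioc s t ×ˢ Set.Ioc x y) = ENNReal.ofReal (t - s) * ENNReal.ofReal (y - x) := by
  rw [timeSpaceVolume_eq, Measure.prod_prod, halfLineVolume_Ioc, Real.volume_Ioc]

lemma volume_toSet_ne_top (R : TimeSpaceRect) : timeSpaceVolume R.toSet ≠ ∞ := by
  rw [toSet, volume_Ioc_prod]
  exact ENNReal.mul_ne_top ENNReal.ofReal_ne_top ENNReal.ofReal_ne_top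

lemma volume_inter (R R' : TimeSpaceRect) :
    timeSpaceVolume.real (R.toSet ∩ R'.toSet)
      = max 0 (min (R.t : ℝ) R'.t - max (R.s : ℝ) R'.s) * max 0 (min R.y R'.y - max R.x R'.x) := by
  rw [toSet, toSet, Set.prod_inter_prod, Set.Ioc_inter_Ioc, Set.Ioc_inter_Ioc, measureReal_def,
    volume_Ioc_prod, ENNReal.toReal_mul, ENNReal.toReal_ofReal', ENNReal.toReal_ofReal']
  simp [max_comm]

/-- The indicator of a rectangle as an element of `L²`. -/
noncomputable def indicatorLp (R : TimeSpaceRect) : Lp ℝ 2 timeSpaceVolume :=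
  indicatorConstLp 2 R.measurableSet_toSet R.volume_toSet_ne_top 1

lemma inner_indicatorLp (R R' : TimeSpaceRect) :
    inner ℝ R.indicatorLp R'.indicatorLp = timeSpaceVolume.real (R.toSet ∩ R'.toSet) :=
  L2.real_inner_indicatorConstLp_one_indicatorConstLp_one R.measurableSet_toSet
    R'.measurableSet_toSet R.volume_toSet_ne_top R'.volume_toSet_ne_top

end TimeSpaceRect

/-! ### Density of step functions in L². -/

/-- The `L²` class of a step function. -/
noncomputable def stepLp : (TimeSpaceRect →₀ ℝ) →ₗ[ℝ] Lp ℝ 2 timeSpaceVolume :=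
  Finsupp.linearCombination ℝ TimeSpaceRect.indicatorLp

lemma Finsupp.coeFn_linearCombination_Lp {α ι : Type*} [MeasurableSpace α] {μ : Measure α}
    (u : ι → Lp ℝ 2 μ) (U : ι → α → ℝ) (h : ∀ i, u i =ᵐ[μ] U i) (g : ι →₀ ℝ) :
    Finsupp.linearCombination ℝ u g =ᵐ[μ] fun ω => g.sum fun i c => c * U i ω := by
  classical
  induction g using Finsupp.induction_linear with
  | zero =>
    filter_upwards [Lp.coeFn_zero ℝ 2 μ] with ω h0
    simp only [map_zero, h0, Finsupp.sum_zero_index, Pi.zero_apply]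
  | add f g hf hg =>
    rw [map_add]
    filter_upwards [Lp.coeFn_add (Finsupp.linearCombination ℝ u f)
      (Finsupp.linearCombination ℝ u g), hf, hg] with ω h1 h2 h3
    rw [h1, Pi.add_apply, h2, h3, Finsupp.sum_add_index' (by simp) (by intros; ring)]
  | single i c =>
    rw [Finsupp.linearCombination_single]
    filter_upwards [Lp.coeFn_smul c (u i), h i] with ω h1 h2
    rw [h1, Pi.smul_apply, h2, Finsupp.sum_single_index (by simp), smul_eq_mul]

lemma TimeSpaceRect.coeFn_indicatorLp (R : TimeSpaceRect) :
    R.indicatorLp =ᵐ[timeSpaceVolume] (Set.Ioc R.s R.t ×ˢ Set.Ioc R.x R.y).indicator 1 :=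
  indicatorConstLp_coeFn

lemma coeFn_stepLp (g : TimeSpaceRect →₀ ℝ) : stepLp g =ᵐ[timeSpaceVolume] stepFun g :=
  Finsupp.coeFn_linearCombination_Lp _ _ TimeSpaceRect.coeFn_indicatorLp g

lemma isPiSystem_Iic_prod_Iic :
    IsPiSystem (Set.image2 (· ×ˢ ·) (Set.range (Set.Iic : ℝ≥0 → Set ℝ≥0))
      (Set.range (Set.Iic : ℝ → Set ℝ))) := by
  rintro _ ⟨_, ⟨a, rfl⟩, _, ⟨b, rfl⟩, rfl⟩ _ ⟨_, ⟨c, rfl⟩, _, ⟨d, rfl⟩, rfl⟩ -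
  refine ⟨_, ⟨min a c, rfl⟩, _, ⟨min b d, rfl⟩, ?_⟩
  simp [Set.Iic_inter_Iic]

lemma measurableSpace_eq_generateFrom_Iic_prod_Iic :
    (inferInstance : MeasurableSpace (ℝ≥0 × ℝ)) = MeasurableSpace.generateFrom
      (Set.image2 (· ×ˢ ·) (Set.range (Set.Iic : ℝ≥0 → Set ℝ≥0))
      (Set.range (Set.Iic : ℝ → Set ℝ))) := by
  rw [← generateFrom_prod_eq (C := Set.range (Set.Iic : ℝ≥0 → Set ℝ≥0))
    (D := Set.range (Set.Iic : ℝ → Set ℝ))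
    ⟨fun n => Set.Iic (n : ℝ≥0), fun n => ⟨_, rfl⟩, ?_⟩
    ⟨fun n => Set.Iic (n : ℝ), fun n => ⟨_, rfl⟩, ?_⟩]
  · rw [← borel_eq_generateFrom_Iic, ← borel_eq_generateFrom_Iic,
      ← BorelSpace.measurable_eq, ← BorelSpace.measurable_eq]
  · refine Set.iUnion_eq_univ_iff.2 fun x => ?_
    obtain ⟨n, hn⟩ := exists_nat_ge x
    exact ⟨n, hn⟩
  · refine Set.iUnion_eq_univ_iff.2 fun x => ?_
    obtain ⟨n, hn⟩ := exists_nat_ge x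
    exact ⟨n, hn⟩

/-- A square integrable function whose integrals over all rectangles vanish is zero. -/
lemma ae_eq_zero_of_forall_rect (h : Lp ℝ 2 timeSpaceVolume)
    (hR : ∀ R : TimeSpaceRect, ∫ z in R.toSet, h z ∂timeSpaceVolume = 0) :
    h =ᵐ[timeSpaceVolume] 0 := by
  -- Boxes that exhaust the space up to a null set. Intersecting a quadrant `Iic ×ˢ Iic` with a box
  -- gives a rectangle or the empty set, which starts the π-λ induction.
  let D : ℕ → TimeSpaceRect := fun n => ⟨0, n, -n, n, by simp, by
    have : (0 : ℝ) ≤ n := n.cast_nonneg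
    linarith⟩
  have hint : ∀ n, IntegrableOn h (D n).toSet timeSpaceVolume := fun n =>
    integrableOn_Lp_of_measure_ne_top h (by norm_num) (D n).volume_toSet_ne_top
  have key : ∀ n, ∀ S : Set (ℝ≥0 × ℝ), MeasurableSet S →
      ∫ z in S ∩ (D n).toSet, h z ∂timeSpaceVolume = 0 := by
    intro n S hS
    induction S, hS using MeasurableSpace.induction_on_inter
      measurableSpace_eq_generateFrom_Iic_prod_Iic isPiSystem_Iic_prod_Iic with
    | empty => simp
    | basic S hS =>
      obtain ⟨_, ⟨a, rfl⟩, _, ⟨b, rfl⟩, rfl⟩ := hS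
      have e : (Set.Iic a ×ˢ Set.Iic b) ∩ (D n).toSet
          = Set.Ioc 0 (min a n) ×ˢ Set.Ioc (-n : ℝ) (min b n) := by
        simp only [TimeSpaceRect.toSet, D, Set.prod_inter_prod]
        congr 1 <;> · ext z; simp only [Set.mem_inter_iff, Set.mem_Iic, Set.mem_Ioc, le_min_iff]; tauto
      show ∫ z in (Set.Iic a ×ˢ Set.Iic b) ∩ (D n).toSet, h z ∂timeSpaceVolume = 0
      rw [e]
      by_cases hb : (-n : ℝ) ≤ min b n
      · exact hR ⟨0, min a n, -n, min b n, by simp, hb⟩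
      · have e0 : Set.Ioc (-n : ℝ) (min b n) = ∅ := Set.Ioc_eq_empty (fun hh => hb hh.le)
        rw [e0]; simp
    | compl S hS ih =>
      have := integral_inter_add_sdiff (s := (D n).toSet) (t := S) hS (hint n)
      rw [hR, Set.inter_comm, ih, zero_add] at this
      rwa [Set.inter_comm, ← Set.sdiff_eq_compl_inter.trans (Set.inter_comm _ _)]
    | iUnion f hd hf ih =>
      rw [Set.iUnion_inter, integral_iUnion (fun i => (hf i).inter (D n).measurableSet_toSet)
        (fun i j hij => (hd hij).mono Set.inter_subset_left Set.inter_subset_left)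
        ((hint n).mono_set (Set.iUnion_subset fun i => Set.inter_subset_right))]
      simp [ih]
  have h2 : ∀ n, h =ᵐ[timeSpaceVolume.restrict (D n).toSet] 0 := fun n =>
    Integrable.ae_eq_zero_of_forall_setIntegral_eq_zero (hint n) fun s hs _ => by
      rw [Measure.restrict_restrict hs]; exact key n s hs
  have h3 : ∀ᵐ z ∂timeSpaceVolume, ∀ n, z ∈ (D n).toSet → h z = 0 :=
    ae_all_iff.2 fun n => (ae_restrict_iff' (D n).measurableSet_toSet).1 (h2 n)
  -- The boxes are open at time 0, so this null slice lies in none of them.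
  have h4 : ∀ᵐ z ∂timeSpaceVolume, z.1 ≠ 0 :=
    Measure.quasiMeasurePreserving_fst.ae (ae_halfLineVolume_ne 0)
  filter_upwards [h3, h4] with z h3 h4
  obtain ⟨n, hn⟩ := exists_nat_ge (max (z.1 : ℝ) (|z.2| + 1))
  have h5 := (le_max_left _ _).trans hn
  have h6 := (le_max_right _ _).trans hn
  refine h3 n ⟨⟨pos_iff_ne_zero.2 h4, by exact_mod_cast h5⟩, ?_, ?_⟩
  · show -(n : ℝ) < z.2
    linarith [neg_abs_le z.2]
  · show z.2 ≤ n
    linarith [le_abs_self z.2]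

/-- The orthogonal complement of the range is zero: its elements have vanishing integral over every
rectangle. -/
lemma denseRange_stepLp : DenseRange stepLp := by
  have h : (LinearMap.range stepLp).topologicalClosure = ⊤ := by
    rw [Submodule.topologicalClosure_eq_top_iff, Submodule.eq_bot_iff]
    intro h hh
    rw [Lp.eq_zero_iff_ae_eq_zero]
    refine ae_eq_zero_of_forall_rect h fun R => ?_
    have := (Submodule.mem_orthogonal _ _).1 hh (stepLp (Finsupp.single R 1)) ⟨_, rfl⟩
    rw [stepLp, Finsupp.linearCombination_single, one_smul] at this
    rw [← this]
    exact (L2.inner_indicatorConstLp_one R.measurableSet_toSet R.volume_toSet_ne_top h).symm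
  have h2 : Dense ((LinearMap.range stepLp : Submodule ℝ _) : Set (Lp ℝ 2 timeSpaceVolume)) :=
    (Submodule.dense_iff_topologicalClosure_eq_top).2 h
  rwa [LinearMap.coe_range] at h2

lemma min_increment {s t s' t' : ℝ} (h : s ≤ t) (h' : s' ≤ t') :
    min t t' - min t s' - min s t' + min s s' = max 0 (min t t' - max s s') := by
  simp only [min_def, max_def]
  split_ifs <;> linarith

/-- With |a - b| = a + b - 2 min(a,b), the terms in one variable cancel in the mixed difference. -/
lemma abs_increment {x y x' y' : ℝ} (h : x ≤ y) (h' : x' ≤ y') :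
    (|y - x'| + |x - y'| - |y - y'| - |x - x'|) / 2 = max 0 (min y y' - max x x') := by
  rw [← min_increment h h']
  have e : ∀ a b : ℝ, |a - b| = a + b - 2 * min a b := by
    intro a b
    rcases le_total a b with hab | hab
    · rw [min_eq_left hab, abs_of_nonpos (by linarith)]; ring
    · rw [min_eq_right hab, abs_of_nonneg (by linarith)]; ring
  rw [e, e, e, e]; ring

/-! ### The white-noise integral as an isometry. -/

section Isometry

variable {Ω : Type*} [MeasurableSpace Ω] {P : Measure Ω} {W : ℝ≥0 × ℝ → Ω → ℝ}

lemma IsBrownianSheet.memLp (hW : IsBrownianSheet P W) (z : ℝ≥0 × ℝ) : MemLp (W z) 2 P :=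
  (hW.gaussian.hasGaussianLaw_eval z).memLp (by simp)

/-- The values of the sheet as elements of `L²`. -/
noncomputable def IsBrownianSheet.toLp (hW : IsBrownianSheet P W) (z : ℝ≥0 × ℝ) : Lp ℝ 2 P :=
  (hW.memLp z).toLp

lemma inner_toLp {f g : Ω → ℝ} (hf : MemLp f 2 P) (hg : MemLp g 2 P) :
    inner ℝ hf.toLp hg.toLp = ∫ ω, f ω * g ω ∂P := by
  rw [L2.inner_def]
  refine integral_congr_ae ?_
  filter_upwards [hf.coeFn_toLp, hg.coeFn_toLp] with ω h1 h2
  rw [h1, h2]; simp [mul_comm]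

lemma IsBrownianSheet.inner_toLp (hW : IsBrownianSheet P W) (z z' : ℝ≥0 × ℝ) :
    inner ℝ (hW.toLp z) (hW.toLp z')
      = (min z.1 z'.1 : ℝ≥0) * ((|z.2| + |z'.2| - |z.2 - z'.2|) / 2) := by
  rw [← hW.cov]; exact _root_.inner_toLp _ _

/-- The increments of the sheet as elements of `L²`. -/
noncomputable def IsBrownianSheet.incrementLp (hW : IsBrownianSheet P W) (R : TimeSpaceRect) :
    Lp ℝ 2 P :=
  hW.toLp (R.t, R.y) - hW.toLp (R.s, R.y) - hW.toLp (R.t, R.x) + hW.toLp (R.s, R.x)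

lemma IsBrownianSheet.coeFn_incrementLp (hW : IsBrownianSheet P W) (R : TimeSpaceRect) :
    hW.incrementLp R =ᵐ[P] R.increment W := by
  have h : hW.incrementLp R = ((((hW.memLp (R.t, R.y)).sub (hW.memLp (R.s, R.y))).sub
    (hW.memLp (R.t, R.x))).add (hW.memLp (R.s, R.x))).toLp := rfl
  rw [h]
  exact MemLp.coeFn_toLp _

/-- The sheet's covariance is a product of a time and a space factor, so its mixed differences are
products of overlap lengths. The isometry follows by linearity. -/
lemma IsBrownianSheet.inner_incrementLp (hW : IsBrownianSheet P W) (R R' : TimeSpaceRect) :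
    inner ℝ (hW.incrementLp R) (hW.incrementLp R')
      = timeSpaceVolume.real (R.toSet ∩ R'.toSet) := by
  rw [TimeSpaceRect.volume_inter, ← min_increment (by exact_mod_cast R.hst) (by exact_mod_cast R'.hst),
    ← abs_increment R.hxy R'.hxy]
  simp only [incrementLp, inner_add_left, inner_add_right, inner_sub_left, inner_sub_right,
    hW.inner_toLp]
  push_cast
  ring

/-- The white-noise integral of step functions. -/
noncomputable def IsBrownianSheet.stepIntegralLp (hW : IsBrownianSheet P W) :
    (TimeSpaceRect →₀ ℝ) →ₗ[ℝ] Lp ℝ 2 P :=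
  Finsupp.linearCombination ℝ hW.incrementLp

lemma IsBrownianSheet.coeFn_stepIntegralLp (hW : IsBrownianSheet P W) (g : TimeSpaceRect →₀ ℝ) :
    hW.stepIntegralLp g =ᵐ[P] stepIntegral W g :=
  Finsupp.coeFn_linearCombination_Lp _ _ hW.coeFn_incrementLp g

lemma IsBrownianSheet.inner_stepIntegralLp (hW : IsBrownianSheet P W)
    (g h : TimeSpaceRect →₀ ℝ) :
    inner ℝ (hW.stepIntegralLp g) (hW.stepIntegralLp h) = inner ℝ (stepLp g) (stepLp h) := by
  simp only [stepIntegralLp, stepLp, Finsupp.linearCombination_apply, Finsupp.sum, sum_inner,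
    inner_sum, inner_smul_left, inner_smul_right, hW.inner_incrementLp,
    TimeSpaceRect.inner_indicatorLp]

lemma IsBrownianSheet.norm_stepIntegralLp (hW : IsBrownianSheet P W) (g : TimeSpaceRect →₀ ℝ) :
    ‖hW.stepIntegralLp g‖ = ‖stepLp g‖ := by
  rw [norm_eq_sqrt_real_inner, norm_eq_sqrt_real_inner, hW.inner_stepIntegralLp]

/-- The white-noise integral as a continuous linear map on `L²`. -/
noncomputable def IsBrownianSheet.wienerLp (hW : IsBrownianSheet P W) :
    Lp ℝ 2 timeSpaceVolume →L[ℝ] Lp ℝ 2 P :=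
  hW.stepIntegralLp.extendOfNorm stepLp

lemma IsBrownianSheet.wienerLp_stepLp (hW : IsBrownianSheet P W) (g : TimeSpaceRect →₀ ℝ) :
    hW.wienerLp (stepLp g) = hW.stepIntegralLp g :=
  LinearMap.extendOfNorm_eq denseRange_stepLp ⟨1, fun g => by rw [hW.norm_stepIntegralLp, one_mul]⟩ g

lemma IsBrownianSheet.inner_wienerLp (hW : IsBrownianSheet P W) (f h : Lp ℝ 2 timeSpaceVolume) :
    inner ℝ (hW.wienerLp f) (hW.wienerLp h) = inner ℝ f h := by
  induction f, h using denseRange_stepLp.induction_on₂ with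
  | hp => exact isClosed_eq (by fun_prop) (by fun_prop)
  | h g g' => rw [hW.wienerLp_stepLp, hW.wienerLp_stepLp, hW.inner_stepIntegralLp]

/-- Needed twice: for Gaussianity of the integral and for its orthogonality to functionals of `B`.
-/
lemma IsBrownianSheet.wienerLp_mem (hW : IsBrownianSheet P W) (f : Lp ℝ 2 timeSpaceVolume) :
    hW.wienerLp f ∈ (Submodule.span ℝ (Set.range hW.toLp)).topologicalClosure := by
  induction f using denseRange_stepLp.induction_on with
  | hp =>
    exact (Submodule.isClosed_topologicalClosure _).preimage hW.wienerLp.continuous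
  | ih g =>
    rw [hW.wienerLp_stepLp]
    refine Submodule.le_topologicalClosure _ ?_
    rw [stepIntegralLp, Finsupp.linearCombination_apply]
    have h : ∀ z, hW.toLp z ∈ Submodule.span ℝ (Set.range hW.toLp) :=
      fun z => Submodule.subset_span ⟨z, rfl⟩
    exact Submodule.sum_mem _ fun R _ => Submodule.smul_mem _ _
      (Submodule.add_mem _ (Submodule.sub_mem _ (Submodule.sub_mem _ (h _) (h _)) (h _)) (h _))

lemma eLpNorm_sub_eq_norm_toLp_sub {α : Type*} [MeasurableSpace α] {μ : Measure α} {u : Lp ℝ 2 μ}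
    {f g : α → ℝ} (hu : u =ᵐ[μ] f) (hg : MemLp g 2 μ) :
    eLpNorm (fun ω => f ω - g ω) 2 μ = ENNReal.ofReal ‖u - hg.toLp‖ := by
  rw [Lp.norm_def, ENNReal.ofReal_toReal (Lp.eLpNorm_ne_top _)]
  refine eLpNorm_congr_ae ?_
  filter_upwards [Lp.coeFn_sub u hg.toLp, hu, hg.coeFn_toLp] with ω h1 h2 h3
  rw [h1, Pi.sub_apply, h2, h3]

lemma tendsto_eLpNorm_sub_iff {α : Type*} [MeasurableSpace α] {μ : Measure α} {u : ℕ → Lp ℝ 2 μ}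
    {f : ℕ → α → ℝ} {g : α → ℝ} (hu : ∀ j, u j =ᵐ[μ] f j) (hg : MemLp g 2 μ) :
    Tendsto (fun j => eLpNorm (fun ω => f j ω - g ω) 2 μ) atTop (𝓝 0)
      ↔ Tendsto u atTop (𝓝 hg.toLp) := by
  simp_rw [eLpNorm_sub_eq_norm_toLp_sub (hu _) hg]
  rw [tendsto_iff_norm_sub_tendsto_zero]
  constructor
  · intro h
    have := (ENNReal.tendsto_toReal ENNReal.zero_ne_top).comp h
    simpa [Function.comp_def] using this
  · intro h
    simpa using ENNReal.tendsto_ofReal h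

/-- Continuity of the extended isometry makes the limit independent of the approximating step
functions; their density supplies an approximating sequence. -/
lemma IsBrownianSheet.isWhiteNoiseIntegral_iff (hW : IsBrownianSheet P W) {f : ℝ≥0 × ℝ → ℝ}
    (hf : MemLp f 2 timeSpaceVolume) (I : Ω → ℝ) :
    IsWhiteNoiseIntegral P W f I ↔ I =ᵐ[P] hW.wienerLp hf.toLp := by
  constructor
  · rintro ⟨-, hI, g, hg, hg'⟩
    rw [tendsto_eLpNorm_sub_iff (fun j => coeFn_stepLp (g j)) hf] at hg
    rw [tendsto_eLpNorm_sub_iff (fun j => hW.coeFn_stepIntegralLp (g j)) hI] at hg'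
    have h := (hW.wienerLp.continuous.tendsto _).comp hg
    simp only [Function.comp_def, hW.wienerLp_stepLp] at h
    rw [← tendsto_nhds_unique hg' h]
    exact hI.coeFn_toLp.symm
  · intro h
    have hI : MemLp I 2 P := (memLp_congr_ae h).2 (Lp.memLp _)
    have hI' : hI.toLp = hW.wienerLp hf.toLp :=
      Lp.ext (hI.coeFn_toLp.trans h)
    obtain ⟨v, hv, hvt⟩ := mem_closure_iff_seq_limit.1 (denseRange_stepLp hf.toLp)
    choose g hg using hv
    refine ⟨hf, hI, g, ?_, ?_⟩
    · rw [tendsto_eLpNorm_sub_iff (fun j => coeFn_stepLp (g j)) hf]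
      simpa only [hg] using hvt
    · rw [tendsto_eLpNorm_sub_iff (fun j => hW.coeFn_stepIntegralLp (g j)) hI, hI']
      have h := (hW.wienerLp.continuous.tendsto _).comp hvt
      simpa only [Function.comp_def, ← hg, hW.wienerLp_stepLp] using h

end Isometry

/-! ### Inner products of heat kernels. -/

lemma measurable_heatKernel (w : ℝ≥0) :
    Measurable fun p : (ℝ≥0 × ℝ) × (ℝ≥0 × ℝ) => heatKernel w p.1.1 p.1.2 p.2 := by
  unfold heatKernel
  refine Measurable.ite (measurableSet_le (by fun_prop) (by fun_prop)) ?_ measurable_const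
  exact measurable_uncurry_gaussianPDFReal.comp
    (f := fun p : (ℝ≥0 × ℝ) × (ℝ≥0 × ℝ) => ((0 : ℝ), w * (p.1.1 - p.2.1), p.1.2 - p.2.2))
    (by fun_prop)

lemma heatKernel_nonneg (w t : ℝ≥0) (r : ℝ) (z : ℝ≥0 × ℝ) : 0 ≤ heatKernel w t r z := by
  unfold heatKernel; split_ifs
  · exact gaussianPDFReal_nonneg _ _ _
  · exact le_rfl

lemma heatKernel_zero_left (t : ℝ≥0) (r : ℝ) : heatKernel 0 t r = 0 := by
  ext z; simp [heatKernel]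

lemma heatKernel_zero_time (w : ℝ≥0) (r : ℝ) : heatKernel w 0 r = 0 := by
  ext z; simp [heatKernel]

lemma measurable_heatKernel_right (w t : ℝ≥0) (r : ℝ) : Measurable (heatKernel w t r) :=
  (measurable_heatKernel w).comp (measurable_const (a := (t, r)) |>.prodMk measurable_id)

lemma measurable_gaussianPDFReal_var {α : Type*} [MeasurableSpace α] {v : α → ℝ≥0} {x : α → ℝ}
    (hv : Measurable v) (hx : Measurable x) :
    Measurable fun a => gaussianPDFReal 0 (v a) (x a) :=
  measurable_uncurry_gaussianPDFReal.comp (f := fun a => ((0 : ℝ), v a, x a)) (by fun_prop)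

/-- The spatial integral of a product of heat kernels. -/
noncomputable def heatOverlap (w s t : ℝ≥0) (x : ℝ) : ℝ≥0 → ℝ :=
  (Set.Ioc 0 (min s t)).indicator fun u => gaussianPDFReal 0 (w * (s - u) + w * (t - u)) x

/-- The convolution identity at each time u. At u = s or u = t one variance is 0, where
`gaussianPDFReal` is 0 and not a point mass, so these times are discarded as null. -/
lemma heatKernel_mul_section {w : ℝ≥0} (hw : w ≠ 0) (s t : ℝ≥0) (q r : ℝ) :
    ∀ᵐ u ∂halfLineVolume,
      Integrable (fun x => heatKernel w s q (u, x) * heatKernel w t r (u, x)) ∧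
      ∫ x, heatKernel w s q (u, x) * heatKernel w t r (u, x) = heatOverlap w s t (r - q) u := by
  filter_upwards [ae_halfLineVolume_ne 0, ae_halfLineVolume_ne s, ae_halfLineVolume_ne t]
    with u h0 hs ht
  by_cases h : u ≤ min s t
  · have h1 := h.trans (min_le_left _ _)
    have h2 := h.trans (min_le_right _ _)
    have h1' : s - u ≠ 0 := (tsub_pos_of_lt (lt_of_le_of_ne h1 hs)).ne'
    have h2' : t - u ≠ 0 := (tsub_pos_of_lt (lt_of_le_of_ne h2 ht)).ne'
    simp only [heatKernel, h1, h2, if_true, heatOverlap]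
    rw [Set.indicator_of_mem (show u ∈ Set.Ioc 0 (min s t) from ⟨pos_iff_ne_zero.2 h0, h⟩)]
    exact integral_gaussianPDFReal_mul (mul_ne_zero hw h1') (mul_ne_zero hw h2') q r
  · have : ∀ x, heatKernel w s q (u, x) * heatKernel w t r (u, x) = 0 := by
      intro x
      rw [le_min_iff, not_and_or] at h
      rcases h with h | h <;> simp [heatKernel, h]
    simp only [this, heatOverlap]
    rw [Set.indicator_of_notMem (fun hh => h hh.2)]
    simp

/-- As u runs from 0 to min(s,t), the variance w(s-u) + w(t-u) falls at rate 2w from w(s+t) to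
w|t-s|. The substitution leaves an integral of the density over its variance, and the rate gives the
factor 1/2. -/
lemma heatOverlap_integral {w : ℝ≥0} (hw : w ≠ 0) (s t : ℝ≥0) (x : ℝ) :
    Integrable (heatOverlap w s t x) halfLineVolume ∧
    w * ∫ u, heatOverlap w s t x u ∂halfLineVolume
      = (gaussAbs x (w * (t + s)) - gaussAbs x (w * nndist t s)) / 2 := by
  have hw' : (0 : ℝ) < w := by positivity
  have hm : Measurable fun u : ℝ≥0 => gaussianPDFReal 0 (w * (s - u) + w * (t - u)) x :=
    measurable_gaussianPDFReal_var (by fun_prop) measurable_const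
  have hmin : (0 : ℝ≥0) ≤ min s t := zero_le
  have hd : (w * (s + t) - 2 * w * (min s t : ℝ≥0) : ℝ) = w * nndist t s := by
    rw [NNReal.coe_min, coe_nndist, NNReal.dist_eq]
    rcases le_total (s : ℝ) t with h | h
    · rw [min_eq_left h, abs_of_nonneg (by linarith)]; ring
    · rw [min_eq_right h, abs_of_nonpos (by linarith)]; ring
  have hle : (w * nndist t s : ℝ) ≤ w * (s + t) := by
    rw [← hd]; have : (0 : ℝ) ≤ 2 * w * (min s t : ℝ≥0) := by positivity
    linarith
  have hcongr : ∀ u ∈ Set.uIcc (0 : ℝ) (min s t : ℝ≥0),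
      gaussianPDFReal 0 (w * (s - u.toNNReal) + w * (t - u.toNNReal)) x
        = gaussianPDFReal 0 (w * (s + t) - 2 * w * u).toNNReal x := by
    intro u hu
    rw [Set.uIcc_of_le (by positivity)] at hu
    obtain ⟨hu0, hu1⟩ := hu
    lift u to ℝ≥0 using hu0
    rw [Real.toNNReal_coe]
    have hu1 : u ≤ min s t := by exact_mod_cast hu1
    have h1 := hu1.trans (min_le_left _ _)
    have h2 := hu1.trans (min_le_right _ _)
    congr 1
    rw [← NNReal.coe_inj, Real.coe_toNNReal]
    · push_cast [NNReal.coe_sub h1, NNReal.coe_sub h2]; ring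
    · have h1' : (u : ℝ) ≤ s := by exact_mod_cast h1
      have h2' : (u : ℝ) ≤ t := by exact_mod_cast h2
      nlinarith
  have hI : IntervalIntegrable (fun u : ℝ => gaussianPDFReal 0 (w * (s + t) - 2 * w * u).toNNReal x)
      volume 0 (min s t : ℝ≥0) := by
    have h1 := (integrable_gaussianPDFReal_var x _ _ (by positivity) hle)
    have h2 := (h1.comp_sub_left (w * (s + t) : ℝ)).comp_mul_left (c := 2 * w)
    convert! h2.symm using 1
    · field_simp; ring
    · rw [← hd]; field_simp; ring
  unfold heatOverlap
  rw [integrable_indicator_iff measurableSet_Ioc, integral_indicator measurableSet_Ioc,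
    integrableOn_halfLineVolume_Ioc hm hmin, setIntegral_halfLineVolume_Ioc hm hmin]
  refine ⟨hI.congr (fun u hu => (hcongr u (Set.uIoc_subset_uIcc hu)).symm), ?_⟩
  rw [NNReal.coe_zero, intervalIntegral.integral_congr hcongr]
  rw [intervalIntegral.integral_comp_sub_mul (fun v : ℝ => gaussianPDFReal 0 v.toNNReal x)
    (by positivity : (2 * w : ℝ) ≠ 0)]
  rw [mul_zero, sub_zero, hd, integral_gaussianPDFReal_var x _ _ (by positivity) hle, smul_eq_mul]
  have e1 : (w * (s + t) : ℝ).toNNReal = w * (t + s) := by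
    rw [← NNReal.coe_inj, Real.coe_toNNReal _ (by positivity)]; push_cast; ring
  have e2 : (w * nndist t s : ℝ).toNNReal = w * nndist t s := by
    rw [← NNReal.coe_inj, Real.coe_toNNReal _ (by positivity)]; push_cast; ring
  rw [e1, e2]
  field_simp

lemma integrable_heatKernel_mul (w s t : ℝ≥0) (q r : ℝ) :
    Integrable (fun z => heatKernel w s q z * heatKernel w t r z) timeSpaceVolume := by
  by_cases hw : w = 0
  · subst hw; simp [heatKernel_zero_left]
  have hm : Measurable fun z => heatKernel w s q z * heatKernel w t r z :=
    (measurable_heatKernel_right w s q).mul (measurable_heatKernel_right w t r)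
  rw [timeSpaceVolume_eq, integrable_prod_iff hm.aestronglyMeasurable]
  have h := heatKernel_mul_section hw s t q r
  refine ⟨h.mono fun u hu => hu.1, (heatOverlap_integral hw s t (r - q)).1.congr ?_⟩
  filter_upwards [h] with u hu
  rw [← hu.2]
  congr 1; ext x
  rw [Real.norm_of_nonneg (mul_nonneg (heatKernel_nonneg _ _ _ _) (heatKernel_nonneg _ _ _ _))]

lemma integral_heatKernel_mul (w s t : ℝ≥0) (q r : ℝ) :
    w * ∫ z, heatKernel w s q z * heatKernel w t r z ∂timeSpaceVolume
      = (gaussAbs (r - q) (w * (t + s)) - gaussAbs (r - q) (w * nndist t s)) / 2 := by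
  by_cases hw : w = 0
  · subst hw; simp
  have hI := integrable_heatKernel_mul w s t q r
  rw [timeSpaceVolume_eq] at hI ⊢
  rw [integral_prod _ hI, ← (heatOverlap_integral hw s t (r - q)).2]
  congr 1
  exact integral_congr_ae ((heatKernel_mul_section hw s t q r).mono fun u hu => hu.2)

lemma memLp_heatKernel (w t : ℝ≥0) (r : ℝ) : MemLp (heatKernel w t r) 2 timeSpaceVolume := by
  rw [memLp_two_iff_integrable_sq (measurable_heatKernel_right w t r).aestronglyMeasurable]
  simpa [sq] using integrable_heatKernel_mul w t t r r

/-- The heat kernel as an element of `L²`. -/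
noncomputable def heatKernelLp (w : ℝ≥0) (a : ℝ≥0 × ℝ) : Lp ℝ 2 timeSpaceVolume :=
  (memLp_heatKernel w a.1 a.2).toLp

/-- Keeping the factor w on the left makes the identity valid for w = 0, where both sides vanish. -/
lemma inner_heatKernelLp (w : ℝ≥0) (a b : ℝ≥0 × ℝ) :
    w * inner ℝ (heatKernelLp w a) (heatKernelLp w b) = covDyn w a b := by
  rw [heatKernelLp, heatKernelLp, inner_toLp, integral_heatKernel_mul, covDyn, gaussPsi_eq,
    gaussPsi_eq]
  ring

/-! ### Closed subspaces of Gaussian variables. -/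

section GaussianSubspace

variable {Ω : Type*} [MeasurableSpace Ω] {P : Measure Ω} [IsProbabilityMeasure P]

lemma integral_abs_le_norm (X : Lp ℝ 2 P) : ∫ ω, |X ω| ∂P ≤ ‖X‖ := by
  have h := eLpNorm_le_eLpNorm_of_exponent_le (μ := P) (f := X) (p := 1) (q := 2) (by norm_num)
    (Lp.aestronglyMeasurable X)
  rw [Lp.norm_def]
  have h1 := ENNReal.toReal_mono (Lp.eLpNorm_ne_top X) h
  rw [eLpNorm_one_eq_lintegral_enorm] at h1
  rwa [← integral_norm_eq_lintegral_enorm (Lp.aestronglyMeasurable X)] at h1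

lemma integrable_Lp_two (X : Lp ℝ 2 P) : Integrable X P :=
  (Lp.memLp X).integrable (by norm_num)

lemma norm_exp_mul_I_sub_le (a b : ℝ) :
    ‖Complex.exp (a * Complex.I) - Complex.exp (b * Complex.I)‖ ≤ |a - b| := by
  have h : Complex.exp (a * Complex.I) - Complex.exp (b * Complex.I)
      = Complex.exp (b * Complex.I) * (Complex.exp (Complex.I * (a - b : ℝ)) - 1) := by
    rw [mul_sub, ← Complex.exp_add]; congr 2
    · push_cast; ring
    · ring
  rw [h, norm_mul, Complex.norm_exp_ofReal_mul_I, one_mul]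
  exact Real.norm_exp_I_mul_ofReal_sub_one_le

lemma integrable_exp_mul_I {X : Ω → ℝ} (hX : AEStronglyMeasurable X P) :
    Integrable (fun ω => Complex.exp (X ω * Complex.I)) P := by
  refine .of_bound ?_ 1 (ae_of_all _ fun ω => by rw [Complex.norm_exp_ofReal_mul_I])
  exact (by fun_prop : Continuous fun x : ℝ => Complex.exp (x * Complex.I)).comp_aestronglyMeasurable hX

/-- The map is Lipschitz, because |e^{ia} - e^{ib}| ≤ |a - b| and the L¹ norm is at most the L²
norm. -/
lemma continuous_integral_exp_Lp (u : ℝ) :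
    Continuous fun X : Lp ℝ 2 P => ∫ ω, Complex.exp ((u * X ω : ℝ) * Complex.I) ∂P := by
  refine (LipschitzWith.of_dist_le_mul (K := ⟨|u|, abs_nonneg u⟩) fun X Y => ?_).continuous
  have hX := integrable_exp_mul_I (P := P) ((Lp.aestronglyMeasurable X).const_mul u)
  have hY := integrable_exp_mul_I (P := P) ((Lp.aestronglyMeasurable Y).const_mul u)
  rw [dist_eq_norm, dist_eq_norm, ← integral_sub hX hY]
  refine (norm_integral_le_of_norm_le (g := fun ω => |u| * |(X - Y : Lp ℝ 2 P) ω|)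
    ((integrable_Lp_two _).abs.const_mul _) ?_).trans ?_
  · filter_upwards [Lp.coeFn_sub X Y] with ω h
    rw [h, Pi.sub_apply, ← abs_mul, mul_sub]
    exact norm_exp_mul_I_sub_le _ _
  · rw [integral_const_mul]
    exact mul_le_mul_of_nonneg_left (integral_abs_le_norm _) (abs_nonneg _)

lemma charFun_map_eq_integral {X : Ω → ℝ} (hX : AEMeasurable X P) (u : ℝ) :
    charFun (P.map X) u = ∫ ω, Complex.exp ((u * X ω : ℝ) * Complex.I) ∂P := by
  rw [charFun_apply_real, integral_map hX (by fun_prop)]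
  simp

/-- An element of `L²` whose law is the centred Gaussian law with variance `‖X‖²`. -/
def IsCenteredGaussianLp (X : Lp ℝ 2 P) : Prop :=
  ∀ u : ℝ, ∫ ω, Complex.exp ((u * X ω : ℝ) * Complex.I) ∂P = Complex.exp (-((u ^ 2 * ‖X‖ ^ 2 / 2 : ℝ)))

/-- Both sides of each characteristic-function identity are continuous in X. This is why L² limits
of Gaussian variables, the stochastic integrals among them, stay Gaussian. -/
lemma isClosed_isCenteredGaussianLp : IsClosed {X : Lp ℝ 2 P | IsCenteredGaussianLp X} := by
  simp only [IsCenteredGaussianLp, Set.ofPred_forall]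
  exact isClosed_iInter fun u => isClosed_eq (continuous_integral_exp_Lp u) (by fun_prop)

lemma IsCenteredGaussianLp.map_eq {X : Lp ℝ 2 P} (h : IsCenteredGaussianLp X) :
    P.map X = gaussianReal 0 (‖X‖ ^ 2).toNNReal := by
  have := Measure.isProbabilityMeasure_map (Lp.aestronglyMeasurable X).aemeasurable
  refine Measure.ext_of_charFun ?_
  ext u
  rw [charFun_map_eq_integral (Lp.aestronglyMeasurable X).aemeasurable, h, charFun_gaussianReal]
  rw [Real.coe_toNNReal _ (sq_nonneg _)]
  congr 1
  simp; ring

lemma isCenteredGaussianLp_of_hasGaussianLaw {X : Lp ℝ 2 P} (h : HasGaussianLaw X P)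
    (h0 : ∫ ω, X ω ∂P = 0) : IsCenteredGaussianLp X := by
  intro u
  rw [← charFun_map_eq_integral (Lp.aestronglyMeasurable X).aemeasurable, h.map_eq_gaussianReal,
    charFun_gaussianReal, h0]
  have hv : Var[X; P] = ‖X‖ ^ 2 := by
    rw [variance_of_integral_eq_zero (Lp.aestronglyMeasurable X).aemeasurable h0,
      ← real_inner_self_eq_norm_sq, L2.inner_def]
    simp [sq]
  rw [Real.coe_toNNReal _ (variance_nonneg _ _), hv]
  congr 1
  push_cast; ring

variable {ι : Type*} {V : ι → Ω → ℝ}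

lemma isCenteredGaussianLp_of_mem_closure_span (hV : IsGaussianProcess V P)
    (hV0 : ∀ i, ∫ ω, V i ω ∂P = 0) (v : ι → Lp ℝ 2 P) (hv : ∀ i, v i =ᵐ[P] V i)
    {X : Lp ℝ 2 P} (hX : X ∈ (Submodule.span ℝ (Set.range v)).topologicalClosure) :
    IsCenteredGaussianLp X := by
  have h : (Submodule.span ℝ (Set.range v) : Set (Lp ℝ 2 P)) ⊆ {X | IsCenteredGaussianLp X} := by
    intro Y hY
    obtain ⟨c, hc0⟩ := (Finsupp.mem_span_range_iff_exists_finsupp).1 hY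
    have hc : Y =ᵐ[P] fun ω => ∑ i ∈ c.support, c i * V i ω :=
      hc0 ▸ Finsupp.coeFn_linearCombination_Lp v V hv c
    have hg : HasGaussianLaw (fun ω => ∑ i ∈ c.support, c i * V i ω) P :=
      (hV.smul c).hasGaussianLaw_fun_sum
    refine isCenteredGaussianLp_of_hasGaussianLaw (hg.congr hc.symm) ?_
    rw [integral_congr_ae hc, integral_finsetSum _ fun i _ =>
      (hV.hasGaussianLaw_eval i).integrable.const_mul _]
    simp [integral_const_mul, hV0]
  exact closure_minimal h isClosed_isCenteredGaussianLp hX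

/-- Every linear functional of a finite marginal is a linear combination of the `v i`, hence in `S`.
-/
lemma isGaussianProcess_of_mem (S : Submodule ℝ (Lp ℝ 2 P)) (hS : ∀ X ∈ S, IsCenteredGaussianLp X)
    (v : ι → Lp ℝ 2 P) (hv : ∀ i, v i =ᵐ[P] V i) (hvS : ∀ i, v i ∈ S) :
    IsGaussianProcess V P where
  hasGaussianLaw I := by
    classical
    have hVm : ∀ i, AEMeasurable (V i) P := fun i =>
      (Lp.aestronglyMeasurable (v i)).aemeasurable.congr (hv i)
    refine ⟨isGaussian_of_map_eq_gaussianReal fun L => ?_⟩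
    set X : Lp ℝ 2 P := Finsupp.linearCombination ℝ (fun i : I => v i)
      (Finsupp.equivFunOnFinite.symm fun i => L (Pi.single i 1)) with hX
    have hX' : X =ᵐ[P] fun ω => L (I.restrict (V · ω)) := by
      refine (Finsupp.coeFn_linearCombination_Lp (fun i : I => v i) (fun i : I => V i)
        (fun i => hv i) _).trans (ae_of_all _ fun ω => ?_)
      dsimp only
      rw [Finsupp.sum_fintype _ _ (by simp)]
      conv_rhs => rw [← Finset.univ_sum_single (I.restrict (V · ω)), map_sum]
      refine Finset.sum_congr rfl fun i _ => ?_
      rw [Finsupp.equivFunOnFinite_symm_apply_apply]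
      have : (Pi.single i (I.restrict (V · ω) i) : I → ℝ)
          = (V i ω) • (Pi.single i 1 : I → ℝ) := by
        rw [← Pi.single_smul]; simp
      rw [this, map_smul, smul_eq_mul, mul_comm]
    have hXS : X ∈ S := by
      rw [hX, Finsupp.linearCombination_apply]
      exact Submodule.sum_mem _ fun i _ => Submodule.smul_mem _ _ (hvS i)
    refine ⟨0, (‖X‖ ^ 2).toNNReal, ?_⟩
    rw [← (hS X hXS).map_eq, AEMeasurable.map_map_of_aemeasurable (by fun_prop)
      (aemeasurable_pi_lambda (fun ω => I.restrict (V · ω)) fun i => hVm i)]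
    exact Measure.map_congr hX'.symm

end GaussianSubspace

/-! ### Two-sided Brownian motion as a Gaussian process. -/

section SumProcess

variable {Ω : Type*} [MeasurableSpace Ω] {P : Measure Ω}

/-- A finite marginal is a linear image of an independent pair of Gaussian vectors. It serves both
to glue the halves of B and to join W with B. -/
lemma IsGaussianProcess.sumElim {S T : Type*} {X : S → Ω → ℝ} {Y : T → Ω → ℝ}
    (hX : IsGaussianProcess X P) (hY : IsGaussianProcess Y P)
    (hXY : IndepFun (fun ω s => X s ω) (fun ω t => Y t ω) P) :
    IsGaussianProcess (Sum.elim X Y) P where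
  hasGaussianLaw I := by
    classical
    have hi : IndepFun (fun ω => I.toLeft.restrict (X · ω)) (fun ω => I.toRight.restrict (Y · ω)) P :=
      hXY.comp (φ := I.toLeft.restrict) (ψ := I.toRight.restrict) (Finset.measurable_restrict _)
        (Finset.measurable_restrict _)
    have h := hi.hasGaussianLaw (hX.hasGaussianLaw I.toLeft) (hY.hasGaussianLaw I.toRight)
    let L : ((I.toLeft → ℝ) × (I.toRight → ℝ)) →L[ℝ] (I → ℝ) := ContinuousLinearMap.pi fun i =>
      match i with
      | ⟨Sum.inl s, hs⟩ => (ContinuousLinearMap.proj (⟨s, by simpa using hs⟩ : I.toLeft)).comp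
          (ContinuousLinearMap.fst ℝ _ _)
      | ⟨Sum.inr t, ht⟩ => (ContinuousLinearMap.proj (⟨t, by simpa using ht⟩ : I.toRight)).comp
          (ContinuousLinearMap.snd ℝ _ _)
    convert! h.map L using 1
    ext ω i
    rcases i with ⟨s | t, hi⟩ <;> rfl

end SumProcess

namespace IsTwoSidedBrownian

variable {Ω : Type*} [MeasurableSpace Ω] {P : Measure Ω} {B : ℝ → Ω → ℝ}

lemma isGaussianProcess (hB : IsTwoSidedBrownian P B) : IsGaussianProcess B P := by
  have h := IsGaussianProcess.sumElim hB.right.isGaussianProcess hB.left.isGaussianProcess hB.indep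
  have h2 := h.comp_right (fun x : ℝ => if 0 ≤ x then Sum.inl x.toNNReal else Sum.inr (-x).toNNReal)
  convert! h2 using 1
  ext x ω
  by_cases hx : 0 ≤ x
  · simp [hx, Real.coe_toNNReal _ hx]
  · simp [hx, Real.coe_toNNReal (-x) (by linarith)]

variable [IsProbabilityMeasure P]

lemma memLp (hB : IsTwoSidedBrownian P B) (x : ℝ) : MemLp (B x) 2 P :=
  (hB.isGaussianProcess.hasGaussianLaw_eval x).memLp_two

lemma integral_eq_zero (hB : IsTwoSidedBrownian P B) (x : ℝ) : ∫ ω, B x ω ∂P = 0 := by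
  rcases le_total 0 x with hx | hx
  · lift x to ℝ≥0 using hx
    exact hB.right.integral_eval x
  · obtain ⟨y, rfl⟩ : ∃ y : ℝ≥0, x = -y := ⟨(-x).toNNReal, by rw [Real.coe_toNNReal _ (by linarith)]; ring⟩
    exact hB.left.integral_eval y

lemma integral_mul (hB : IsTwoSidedBrownian P B) (x y : ℝ) :
    ∫ ω, B x ω * B y ω ∂P = (|x| + |y| - |x - y|) / 2 := by
  have hcov : ∀ x y, ∫ ω, B x ω * B y ω ∂P = cov[B x, B y; P] := by
    intro x y
    rw [covariance_eq_sub (hB.memLp x) (hB.memLp y), hB.integral_eq_zero, zero_mul, sub_zero]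
    rfl
  have hmix : ∀ x y : ℝ≥0, ∫ ω, B x ω * B (-(y : ℝ)) ω ∂P = 0 := by
    intro x y
    have hi : IndepFun (B x) (B (-(y : ℝ))) P :=
      hB.indep.comp (φ := fun f : ℝ≥0 → ℝ => f x) (ψ := fun f : ℝ≥0 → ℝ => f y)
        (measurable_pi_apply x) (measurable_pi_apply y)
    rw [hi.integral_fun_mul_eq_mul_integral (hB.measurable _).aestronglyMeasurable
      (hB.measurable _).aestronglyMeasurable, hB.integral_eq_zero, zero_mul]
  have hmin : ∀ x y : ℝ≥0, ((min x y : ℝ≥0) : ℝ) = ((x : ℝ) + y - |(x : ℝ) - y|) / 2 := by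
    intro x y
    rcases le_total (x : ℝ) y with h | h
    · rw [NNReal.coe_min, min_eq_left h, abs_of_nonpos (by linarith)]; ring
    · rw [NNReal.coe_min, min_eq_right h, abs_of_nonneg (by linarith)]; ring
  have hr := fun x y => hB.right.covariance_fun_eval x y
  have hl := fun x y => hB.left.covariance_fun_eval x y
  rcases le_total 0 x with hx | hx <;> rcases le_total 0 y with hy | hy
  · lift x to ℝ≥0 using hx
    lift y to ℝ≥0 using hy
    rw [hcov, NNReal.abs_eq, NNReal.abs_eq, ← hmin]
    exact hr x y
  · lift x to ℝ≥0 using hx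
    obtain ⟨y, rfl⟩ : ∃ y' : ℝ≥0, y = -y' := ⟨(-y).toNNReal, by rw [Real.coe_toNNReal _ (by linarith)]; ring⟩
    rw [hmix, sub_neg_eq_add, abs_neg, NNReal.abs_eq, NNReal.abs_eq, abs_of_nonneg (by positivity)]
    ring
  · obtain ⟨x, rfl⟩ : ∃ x' : ℝ≥0, x = -x' := ⟨(-x).toNNReal, by rw [Real.coe_toNNReal _ (by linarith)]; ring⟩
    lift y to ℝ≥0 using hy
    simp_rw [mul_comm (B (-(x : ℝ)) _)]
    rw [hmix, abs_neg, NNReal.abs_eq, NNReal.abs_eq, abs_of_nonpos (by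
      have := x.coe_nonneg; have := y.coe_nonneg; linarith)]
    ring
  · obtain ⟨x, rfl⟩ : ∃ x' : ℝ≥0, x = -x' := ⟨(-x).toNNReal, by rw [Real.coe_toNNReal _ (by linarith)]; ring⟩
    obtain ⟨y, rfl⟩ : ∃ y' : ℝ≥0, y = -y' := ⟨(-y).toNNReal, by rw [Real.coe_toNNReal _ (by linarith)]; ring⟩
    rw [hcov, abs_neg, abs_neg, NNReal.abs_eq, NNReal.abs_eq, neg_sub_neg, abs_sub_comm, ← hmin]
    exact hl x y

lemma ae_continuous (hB : IsTwoSidedBrownian P B) : ∀ᵐ ω ∂P, Continuous fun x => B x ω := by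
  filter_upwards [hB.right.cont, hB.left.cont] with ω h1 h2
  have e : (fun x => B x ω) = fun x : ℝ =>
      if 0 ≤ x then B ((x.toNNReal : ℝ≥0) : ℝ) ω else B (-(((-x).toNNReal : ℝ≥0) : ℝ)) ω := by
    ext x
    by_cases hx : 0 ≤ x
    · simp [hx, Real.coe_toNNReal _ hx]
    · simp [hx, Real.coe_toNNReal (-x) (by linarith)]
  rw [e]
  refine Continuous.if_le (h1.comp (by fun_prop : Continuous Real.toNNReal))
    (h2.comp (by fun_prop : Continuous fun x : ℝ => (-x).toNNReal)) continuous_const continuous_id ?_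
  intro x hx
  have hx : 0 = x := hx
  subst hx; simp

/-- A version of `B` that is jointly measurable. -/
lemma exists_measurable_version (hB : IsTwoSidedBrownian P B) :
    ∃ B' : ℝ → Ω → ℝ, Measurable (Function.uncurry B') ∧ ∀ᵐ ω ∂P, ∀ x, B' x ω = B x ω := by
  -- Paths are set to 0 on a measurable null set that contains all discontinuous ones. Then every
  -- path is continuous, which yields joint measurability.
  obtain ⟨N, hN, hNm, hN0⟩ := exists_measurable_superset_of_null (ae_iff.1 hB.ae_continuous)
  refine ⟨fun x => Nᶜ.indicator (B x), ?_, ?_⟩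
  · refine measurable_uncurry_of_continuous_of_measurable (fun ω => ?_)
      (fun x => (hB.measurable x).indicator hNm.compl)
    by_cases hω : ω ∈ N
    · simpa [hω] using continuous_const
    · simp only [Set.indicator, Set.mem_compl_iff, hω, not_false_eq_true, if_true]
      by_contra h; exact hω (hN h)
  · have : ∀ᵐ ω ∂P, ω ∉ N := by rw [ae_iff]; simpa using hN0
    filter_upwards [this] with ω hω x
    simp [hω]

end IsTwoSidedBrownian

/-! ### Pathwise integrals of random fields. -/

section RandomField

variable {Ω T : Type*} [MeasurableSpace Ω] [MeasurableSpace T] {P : Measure Ω}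
  [IsProbabilityMeasure P] {ν : Measure T} [SFinite ν] {Z : T → Ω → ℝ} {F : T → Lp ℝ 2 P}
  {c : T → ℝ}

/-- A jointly measurable field with a locally integrable `L²` norm is integrable for the product
measure. -/
lemma integrable_prod_field (hZ : Measurable (Function.uncurry Z)) (hF : ∀ t, F t =ᵐ[P] Z t)
    (hc : Measurable c) (hcF : Integrable (fun t => c t * (1 + ‖F t‖)) ν) :
    Integrable (fun z : T × Ω => c z.1 * Z z.1 z.2) (ν.prod P) := by
  have hm : Measurable fun z : T × Ω => c z.1 * Z z.1 z.2 := (hc.comp measurable_fst).mul hZ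
  rw [integrable_prod_iff hm.aestronglyMeasurable]
  refine ⟨ae_of_all _ fun t => ((integrable_Lp_two (F t)).congr (hF t)).const_mul (c t),
    hcF.mono hm.aestronglyMeasurable.norm.integral_prod_right' (ae_of_all _ fun t => ?_)⟩
  simp only [norm_mul]
  rw [integral_const_mul, Real.norm_of_nonneg (by positivity)]
  refine mul_le_mul_of_nonneg_left ?_ (norm_nonneg _)
  rw [Real.norm_of_nonneg (by positivity)]
  have h1 : ∫ ω, ‖Z t ω‖ ∂P = ∫ ω, |F t ω| ∂P := by
    refine integral_congr_ae ?_
    filter_upwards [hF t] with ω h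
    rw [h, Real.norm_eq_abs]
  rw [h1]
  linarith [integral_abs_le_norm (F t)]

lemma ae_integrable_field (hZ : Measurable (Function.uncurry Z)) (hF : ∀ t, F t =ᵐ[P] Z t)
    (hc : Measurable c) (hcF : Integrable (fun t => c t * (1 + ‖F t‖)) ν) :
    ∀ᵐ ω ∂P, Integrable (fun t => c t * Z t ω) ν :=
  (integrable_prod_field hZ hF hc hcF).prod_left_ae

lemma integrable_integral_field (hZ : Measurable (Function.uncurry Z)) (hF : ∀ t, F t =ᵐ[P] Z t)
    (hc : Measurable c) (hcF : Integrable (fun t => c t * (1 + ‖F t‖)) ν) :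
    Integrable (fun ω => ∫ t, c t * Z t ω ∂ν) P :=
  (integrable_prod_field hZ hF hc hcF).integral_prod_right

/-- Fubini. It translates pathwise integrals into scalar integrals of inner products in L²(P);
identities between pathwise integrals are later checked event by event in this way. -/
lemma setIntegral_integral_field (hZ : Measurable (Function.uncurry Z)) (hF : ∀ t, F t =ᵐ[P] Z t)
    (hc : Measurable c) (hcF : Integrable (fun t => c t * (1 + ‖F t‖)) ν) {A : Set Ω}
    (hA : MeasurableSet A) :
    ∫ ω in A, (∫ t, c t * Z t ω ∂ν) ∂P
      = ∫ t, c t * inner ℝ (indicatorConstLp 2 hA (measure_ne_top P A) (1 : ℝ)) (F t) ∂ν := by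
  have hI := (integrable_prod_field hZ hF hc hcF).indicator (MeasurableSet.univ.prod hA)
  have h1 : ∀ ω, A.indicator (fun ω => ∫ t, c t * Z t ω ∂ν) ω
      = ∫ t, (Set.univ ×ˢ A).indicator (fun z : T × Ω => c z.1 * Z z.1 z.2) (t, ω) ∂ν := by
    intro ω
    by_cases h : ω ∈ A <;> simp [h, Set.indicator]
  rw [← integral_indicator hA]
  simp_rw [h1]
  rw [← integral_integral_swap (f := fun t ω =>
    (Set.univ ×ˢ A).indicator (fun z : T × Ω => c z.1 * Z z.1 z.2) (t, ω)) hI]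
  congr 1
  ext t
  rw [L2.inner_indicatorConstLp_one, ← integral_const_mul, ← integral_indicator hA]
  refine integral_congr_ae ?_
  filter_upwards [hF t] with ω h
  by_cases hω : ω ∈ A <;> simp [hω, Set.indicator, h]

end RandomField

/-! ### Averages of Brownian motion over laws. -/

namespace IsTwoSidedBrownian

variable {Ω : Type*} [MeasurableSpace Ω] {P : Measure Ω} [IsProbabilityMeasure P] {B : ℝ → Ω → ℝ}

/-- The values of the Brownian motion as elements of `L²`. -/
noncomputable def toLp (hB : IsTwoSidedBrownian P B) (x : ℝ) : Lp ℝ 2 P := (hB.memLp x).toLp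

lemma coeFn_toLp (hB : IsTwoSidedBrownian P B) (x : ℝ) : hB.toLp x =ᵐ[P] B x :=
  (hB.memLp x).coeFn_toLp

lemma inner_toLp (hB : IsTwoSidedBrownian P B) (x y : ℝ) :
    inner ℝ (hB.toLp x) (hB.toLp y) = (|x| + |y| - |x - y|) / 2 := by
  rw [← hB.integral_mul]; exact _root_.inner_toLp _ _

lemma norm_toLp_sub_sq (hB : IsTwoSidedBrownian P B) (x y : ℝ) :
    ‖hB.toLp x - hB.toLp y‖ ^ 2 = |x - y| := by
  rw [@norm_sub_sq_real, ← real_inner_self_eq_norm_sq, ← real_inner_self_eq_norm_sq,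
    hB.inner_toLp, hB.inner_toLp, hB.inner_toLp]
  simp; ring

lemma continuous_toLp (hB : IsTwoSidedBrownian P B) : Continuous hB.toLp := by
  rw [continuous_iff_continuousAt]
  intro x
  rw [ContinuousAt, tendsto_iff_norm_sub_tendsto_zero]
  have h : ∀ y, ‖hB.toLp y - hB.toLp x‖ = √|y - x| := fun y => by
    rw [← hB.norm_toLp_sub_sq, Real.sqrt_sq (norm_nonneg _)]
  simp_rw [h]
  have : Continuous fun y : ℝ => √|y - x| := by fun_prop
  simpa using this.tendsto x

lemma norm_toLp_le (hB : IsTwoSidedBrownian P B) (x : ℝ) : ‖hB.toLp x‖ ≤ 1 + |x| := by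
  have h : ‖hB.toLp x‖ ^ 2 = |x| := by
    rw [← real_inner_self_eq_norm_sq, hB.inner_toLp]; simp
  nlinarith [norm_nonneg (hB.toLp x), sq_nonneg (‖hB.toLp x‖ - 1)]

variable {ν ν' : Measure ℝ} [IsProbabilityMeasure ν] [IsProbabilityMeasure ν']

lemma integrable_toLp (hB : IsTwoSidedBrownian P B) (hν : Integrable (fun x : ℝ => x) ν) :
    Integrable hB.toLp ν :=
  ((integrable_const (1 : ℝ)).add hν.abs).mono' hB.continuous_toLp.aestronglyMeasurable
    (ae_of_all _ hB.norm_toLp_le)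

/-- The average of the Brownian motion over a law, as an element of `L²`. -/
noncomputable def averageLp (hB : IsTwoSidedBrownian P B) (ν : Measure ℝ) : Lp ℝ 2 P :=
  ∫ x, hB.toLp x ∂ν

lemma integrable_weight (hB : IsTwoSidedBrownian P B) (hν : Integrable (fun x : ℝ => x) ν) :
    Integrable (fun x => 1 * (1 + ‖hB.toLp x‖)) ν := by
  simpa using (integrable_const (1 : ℝ)).add (hB.integrable_toLp hν).norm

lemma ae_integrable (hB : IsTwoSidedBrownian P B) (hν : Integrable (fun x : ℝ => x) ν) :
    ∀ᵐ ω ∂P, Integrable (fun x => B x ω) ν := by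
  obtain ⟨B', hm, hB'⟩ := hB.exists_measurable_version
  have hF : ∀ x, hB.toLp x =ᵐ[P] B' x := fun x => by
    filter_upwards [hB.coeFn_toLp x, hB'] with ω h1 h2
    rw [h1, h2]
  filter_upwards [hB', ae_integrable_field hm hF measurable_const (hB.integrable_weight hν)]
    with ω h1 h2
  simpa [h1] using h2

/-- The L²-valued Bochner integral and the pathwise integral agree because they have the same
integral over every event. -/
lemma coeFn_averageLp (hB : IsTwoSidedBrownian P B) (hν : Integrable (fun x : ℝ => x) ν) :
    hB.averageLp ν =ᵐ[P] fun ω => ∫ x, B x ω ∂ν := by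
  obtain ⟨B', hm, hB'⟩ := hB.exists_measurable_version
  have hF : ∀ x, hB.toLp x =ᵐ[P] B' x := fun x => by
    filter_upwards [hB.coeFn_toLp x, hB'] with ω h1 h2
    rw [h1, h2]
  have hw := hB.integrable_weight hν
  have h : (fun ω => ∫ x, B x ω ∂ν) =ᵐ[P] fun ω => ∫ x, 1 * B' x ω ∂ν := by
    filter_upwards [hB'] with ω h1
    simp [h1]
  refine EventuallyEq.trans ?_ h.symm
  refine Integrable.ae_eq_of_forall_setIntegral_eq _ _ (integrable_Lp_two _)
    (integrable_integral_field hm hF measurable_const hw) fun A hA _ => ?_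
  rw [setIntegral_integral_field hm hF measurable_const hw hA,
    ← L2.inner_indicatorConstLp_one hA (measure_ne_top P A), averageLp,
    ← integral_inner (hB.integrable_toLp hν)]
  simp

/-- The closed span is the double orthogonal complement, and the Bochner integral commutes with
inner products. -/
lemma averageLp_mem (hB : IsTwoSidedBrownian P B) (hν : Integrable (fun x : ℝ => x) ν) :
    hB.averageLp ν ∈ (Submodule.span ℝ (Set.range hB.toLp)).topologicalClosure := by
  rw [← Submodule.orthogonal_orthogonal_eq_closure, Submodule.mem_orthogonal]
  intro U hU
  rw [averageLp, ← integral_inner (hB.integrable_toLp hν)]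
  have : ∀ x, inner ℝ U (hB.toLp x) = 0 := fun x => by
    rw [real_inner_comm]
    exact (Submodule.mem_orthogonal _ _).1 hU _ (Submodule.subset_span ⟨x, rfl⟩)
  simp [this]

lemma inner_averageLp_right (hB : IsTwoSidedBrownian P B) (hν : Integrable (fun x : ℝ => x) ν)
    (U : Lp ℝ 2 P) : inner ℝ U (hB.averageLp ν) = ∫ x, inner ℝ U (hB.toLp x) ∂ν := by
  rw [averageLp, ← integral_inner (hB.integrable_toLp hν)]

end IsTwoSidedBrownian

/-- The difference of two independent Gaussian variables is Gaussian, and the variances add. -/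
lemma integral_integral_abs_sub_gaussianReal (q r : ℝ) (v v' : ℝ≥0) :
    ∫ x, ∫ y, |x - y| ∂gaussianReal r v' ∂gaussianReal q v = gaussAbs (r - q) (v' + v) := by
  have h1 : ∀ x, ∫ y, |x - y| ∂gaussianReal r v' = ∫ y, |x + y| ∂gaussianReal (-r) v' := by
    intro x
    rw [← gaussianReal_map_neg, integral_map (by fun_prop) (by fun_prop)]
    simp [sub_eq_add_neg]
  simp_rw [h1]
  have h2 := gaussianReal_conv_gaussianReal (m₁ := q) (m₂ := -r) (v₁ := v) (v₂ := v')
  have hI : Integrable (fun x : ℝ => |x|) ((gaussianReal q v).conv (gaussianReal (-r) v')) := by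
    rw [h2]; exact integrable_abs_gaussianReal _ _
  rw [← integral_conv hI, h2, ← gaussAbs_neg, gaussAbs]
  congr 2
  · ring
  · rw [add_comm]

namespace IsTwoSidedBrownian

variable {Ω : Type*} [MeasurableSpace Ω] {P : Measure Ω} [IsProbabilityMeasure P] {B : ℝ → Ω → ℝ}

lemma inner_averageLp (hB : IsTwoSidedBrownian P B) (w : ℝ≥0) (a b : ℝ≥0 × ℝ) :
    inner ℝ (hB.averageLp (gaussianReal a.2 (w * a.1))) (hB.averageLp (gaussianReal b.2 (w * b.1)))
      = covInit w a b := by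
  have hid := integrable_id_gaussianReal
  have hab := integrable_abs_gaussianReal
  rw [hB.inner_averageLp_right (hid _ _)]
  have h1 : ∀ y, inner ℝ (hB.averageLp (gaussianReal a.2 (w * a.1))) (hB.toLp y)
      = (gaussAbs a.2 (w * a.1) + |y| - ∫ x, |y - x| ∂gaussianReal a.2 (w * a.1)) / 2 := by
    intro y
    rw [real_inner_comm, hB.inner_averageLp_right (hid _ _)]
    simp_rw [hB.inner_toLp]
    rw [integral_div, integral_sub, integral_add (integrable_const _) (hab _ _), gaussAbs]
    · simp; ring
    · exact (integrable_const _).add (hab _ _)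
    · exact ((integrable_const y).sub (hid _ _)).abs
  simp_rw [h1]
  have hI : Integrable (fun y => ∫ x, |y - x| ∂gaussianReal a.2 (w * a.1))
      (gaussianReal b.2 (w * b.1)) := by
    have : Integrable (fun z : ℝ × ℝ => |z.1 - z.2|)
        ((gaussianReal b.2 (w * b.1)).prod (gaussianReal a.2 (w * a.1))) :=
      (((hid _ _).comp_fst _).sub ((hid _ _).comp_snd _)).abs
    exact this.integral_prod_left
  have hI2 : Integrable (fun y => gaussAbs a.2 (w * a.1) + |y|) (gaussianReal b.2 (w * b.1)) :=
    (integrable_const _).add (hab _ _)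
  rw [integral_div, integral_sub hI2 hI, integral_add (integrable_const _) (hab _ _), integral_integral_abs_sub_gaussianReal]
  rw [covInit, gaussPsi_eq, gaussPsi_eq, gaussPsi_eq, gaussAbs_neg, ← gaussAbs_neg (a.2 - b.2),
    neg_sub, mul_add, add_comm (w * b.1) (w * a.1)]
  simp [gaussAbs]
  ring

end IsTwoSidedBrownian

/-! ### Measurable versions and continuity in L². -/

/-- An `L²`-continuous field has a jointly measurable version. -/
lemma exists_measurable_version_of_continuous {Ω T : Type*} [MeasurableSpace Ω] {P : Measure Ω}
    [IsProbabilityMeasure P] [TopologicalSpace T] [TopologicalSpace.SeparableSpace T] [Nonempty T]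
    [MeasurableSpace T] [OpensMeasurableSpace T] {F : T → Lp ℝ 2 P} (hF : Continuous F) :
    ∃ Z : T → Ω → ℝ, Measurable (Function.uncurry Z) ∧ ∀ t, F t =ᵐ[P] Z t := by
  classical
  let d := TopologicalSpace.denseSeq T
  -- The j-th approximation at t uses the first point of the dense sequence whose value is within
  -- 2^{-j} of `F t`. It is jointly measurable because only countably many points occur.
  let p : ℕ → T → ℕ → Prop := fun j t k => ‖F (d k) - F t‖ < (1 / 2) ^ j
  have hex : ∀ j t, ∃ k, p j t k := by
    intro j t
    have ho : IsOpen {s | ‖F s - F t‖ < (1 / 2 : ℝ) ^ j} := isOpen_lt (by fun_prop) continuous_const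
    obtain ⟨s, hs, k, rfl⟩ := (TopologicalSpace.denseRange_denseSeq T).inter_open_nonempty _ ho
      ⟨t, by simp⟩
    exact ⟨k, hs⟩
  have hkm : ∀ j, Measurable fun t => Nat.find (hex j t) := fun j =>
    measurable_find _ fun k => (isOpen_lt (by fun_prop) continuous_const).measurableSet
  let Zj : ℕ → T × Ω → ℝ := fun j q => F (d (Nat.find (hex j q.1))) q.2
  have hZj : ∀ j, Measurable (Zj j) := by
    intro j
    have h1 : Measurable fun q : ℕ × Ω => F (d q.1) q.2 :=
      measurable_from_prod_countable_right fun k => (Lp.stronglyMeasurable (F (d k))).measurable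
    exact h1.comp (((hkm j).comp measurable_fst).prodMk measurable_snd)
  -- The limsup is measurable everywhere. For fixed t the L¹ errors are summable, so the sequence
  -- converges almost surely and the limsup is its limit.
  refine ⟨fun t ω => limsup (fun j => Zj j (t, ω)) atTop, Measurable.limsup hZj, fun t => ?_⟩
  have hb : ∀ j, ∫⁻ ω, ‖Zj j (t, ω) - F t ω‖ₑ ∂P ≤ ENNReal.ofReal ((1 / 2) ^ j) := by
    intro j
    have h1 := Nat.find_spec (hex j t)
    have h2 : ∫⁻ ω, ‖Zj j (t, ω) - F t ω‖ₑ ∂P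
        = ENNReal.ofReal (∫ ω, |(F (d (Nat.find (hex j t))) - F t : Lp ℝ 2 P) ω| ∂P) := by
      rw [← ofReal_integral_norm_eq_lintegral_enorm (f := fun ω => Zj j (t, ω) - F t ω)]
      · congr 1
        refine integral_congr_ae ?_
        filter_upwards [Lp.coeFn_sub (F (d (Nat.find (hex j t)))) (F t)] with ω h
        rw [h]; rfl
      · exact (integrable_Lp_two (F (d (Nat.find (hex j t))))).sub (integrable_Lp_two (F t))
    rw [h2]
    exact ENNReal.ofReal_le_ofReal ((integral_abs_le_norm (F (d (Nat.find (hex j t))) - F t)).trans h1.le)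
  have hsum : ∫⁻ ω, ∑' j, ‖Zj j (t, ω) - F t ω‖ₑ ∂P ≠ ∞ := by
    rw [lintegral_tsum fun j => by
      exact ((hZj j).comp (measurable_const.prodMk measurable_id)).aemeasurable.sub
        (Lp.aestronglyMeasurable (F t)).aemeasurable |>.enorm]
    refine ne_top_of_le_ne_top ?_ (ENNReal.tsum_le_tsum hb)
    rw [← ENNReal.ofReal_tsum_of_nonneg (fun _ => by positivity) summable_geometric_two]
    exact ENNReal.ofReal_ne_top
  have hfin := ae_lt_top' (AEMeasurable.tsum fun j =>
      ((hZj j).comp (measurable_const.prodMk measurable_id)).aemeasurable.sub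
        (Lp.aestronglyMeasurable (F t)).aemeasurable |>.enorm) hsum
  filter_upwards [hfin] with ω hω
  have h0 := ENNReal.tendsto_atTop_zero_of_tsum_ne_top hω.ne
  have h1 : Tendsto (fun j => Zj j (t, ω)) atTop (𝓝 (F t ω)) := by
    rw [tendsto_iff_edist_tendsto_0]
    simpa [edist_eq_enorm_sub] using h0
  exact h1.limsup_eq.symm

lemma continuous_gaussPsi : Continuous fun z : ℝ≥0 × ℝ => gaussPsi z.1 z.2 := by
  simp_rw [gaussPsi_eq]
  exact ((continuous_gaussAbs.comp (f := fun z : ℝ≥0 × ℝ => (z.2, z.1)) (by fun_prop)).sub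
    continuous_snd).div_const 2

lemma Continuous.gaussPsi {α : Type*} [TopologicalSpace α] {f : α → ℝ≥0} {g : α → ℝ}
    (hf : Continuous f) (hg : Continuous g) : Continuous fun x => gaussPsi (f x) (g x) :=
  continuous_gaussPsi.comp (hf.prodMk hg)

lemma continuous_covDyn (w : ℝ≥0) :
    Continuous fun z : (ℝ≥0 × ℝ) × (ℝ≥0 × ℝ) => covDyn w z.1 z.2 :=
  (Continuous.gaussPsi (by fun_prop) (by fun_prop)).sub
    (Continuous.gaussPsi (by fun_prop) (by fun_prop))

lemma continuous_covInit (w : ℝ≥0) :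
    Continuous fun z : (ℝ≥0 × ℝ) × (ℝ≥0 × ℝ) => covInit w z.1 z.2 :=
  ((Continuous.gaussPsi (by fun_prop) (by fun_prop)).add
    (Continuous.gaussPsi (by fun_prop) (by fun_prop))).sub
    (Continuous.gaussPsi (by fun_prop) (by fun_prop))

/-- Expand ‖F y - F x‖² into inner products. -/
lemma continuous_of_continuous_inner {T E : Type*} [TopologicalSpace T] [NormedAddCommGroup E]
    [InnerProductSpace ℝ E] {F : T → E} (h : Continuous fun z : T × T => inner ℝ (F z.1) (F z.2)) :
    Continuous F := by
  rw [continuous_iff_continuousAt]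
  intro x
  rw [ContinuousAt, tendsto_iff_norm_sub_tendsto_zero]
  have e : ∀ y, ‖F y - F x‖
      = √(inner ℝ (F y) (F y) - 2 * inner ℝ (F y) (F x) + inner ℝ (F x) (F x)) := fun y => by
    rw [real_inner_self_eq_norm_sq, real_inner_self_eq_norm_sq, ← @norm_sub_sq_real,
      Real.sqrt_sq (norm_nonneg _)]
  simp_rw [e]
  have h1 : Continuous fun y => inner ℝ (F y) (F y) := h.comp (by fun_prop : Continuous fun y => (y, y))
  have h2 : Continuous fun y => inner ℝ (F y) (F x) := h.comp (by fun_prop : Continuous fun y => (y, x))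
  have h3 : Continuous fun y =>
      √(inner ℝ (F y) (F y) - 2 * inner ℝ (F y) (F x) + inner ℝ (F x) (F x)) := by fun_prop
  have := h3.tendsto x
  convert! this using 2
  simp; ring_nf; simp

/-! ### The limit process in L². -/

section LimitProcess

variable {Ω : Type*} [MeasurableSpace Ω] {P : Measure Ω} [IsProbabilityMeasure P]
  {W : ℝ≥0 × ℝ → Ω → ℝ} {B : ℝ → Ω → ℝ}

/-- The limit process as a map into `L²`. -/
noncomputable def limitLp (hW : IsBrownianSheet P W) (hB : IsTwoSidedBrownian P B) (w : ℝ≥0)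
    (a σ₀ : ℝ) (z : ℝ≥0 × ℝ) : Lp ℝ 2 P :=
  a • hW.wienerLp (heatKernelLp w z) + σ₀ • hB.averageLp (gaussianReal z.2 (w * z.1))

/-- The definition determines each Z(t,r) only up to null sets, so being a version means having the
L² class `limitLp` at each point. -/
lemma isLimitProcess_iff (hW : IsBrownianSheet P W) (hB : IsTwoSidedBrownian P B) (w : ℝ≥0)
    (a σ₀ : ℝ) (Z : ℝ≥0 × ℝ → Ω → ℝ) :
    IsLimitProcess P w a σ₀ W B Z ↔ ∀ z, limitLp hW hB w a σ₀ z =ᵐ[P] Z z := by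
  have hid := integrable_id_gaussianReal
  have hL : ∀ z, limitLp hW hB w a σ₀ z =ᵐ[P] fun ω => a * hW.wienerLp (heatKernelLp w z) ω
      + σ₀ * ∫ x, B x ω ∂gaussianReal z.2 (w * z.1) := by
    intro z
    filter_upwards [Lp.coeFn_add (a • hW.wienerLp (heatKernelLp w z))
      (σ₀ • hB.averageLp (gaussianReal z.2 (w * z.1))),
      Lp.coeFn_smul a (hW.wienerLp (heatKernelLp w z)),
      Lp.coeFn_smul σ₀ (hB.averageLp (gaussianReal z.2 (w * z.1))),
      hB.coeFn_averageLp (hid z.2 (w * z.1))] with ω h1 h2 h3 h4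
    rw [limitLp, h1, Pi.add_apply, h2, h3, Pi.smul_apply, Pi.smul_apply, h4]
    rfl
  constructor
  · rintro h ⟨t, r⟩
    obtain ⟨I, hI, hZ⟩ := h t r
    rw [hW.isWhiteNoiseIntegral_iff (memLp_heatKernel w t r)] at hI
    filter_upwards [hL (t, r), hI, hZ] with ω h1 h2 h3
    rw [h1, h3.2, h2]
    rfl
  · intro h t r
    refine ⟨hW.wienerLp (heatKernelLp w (t, r)),
      (hW.isWhiteNoiseIntegral_iff (memLp_heatKernel w t r) _).2 (ae_eq_refl _), ?_⟩
    filter_upwards [hL (t, r), h (t, r), hB.ae_integrable (hid r (w * t))] with ω h1 h2 h3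
    exact ⟨h3, by rw [← h2, h1]⟩

/-- Independence and zero means make the values of W and B orthogonal. Orthogonality passes to
closed spans on the W side and to averages on the B side. -/
lemma inner_wienerLp_averageLp (hW : IsBrownianSheet P W) (hB : IsTwoSidedBrownian P B)
    (hWB : IndepFun (fun ω z => W z ω) (fun ω x => B x ω) P) (f : Lp ℝ 2 timeSpaceVolume)
    {ν : Measure ℝ} [IsProbabilityMeasure ν] (hν : Integrable (fun x : ℝ => x) ν) :
    inner ℝ (hW.wienerLp f) (hB.averageLp ν) = 0 := by
  have h0 : ∀ z x, inner ℝ (hW.toLp z) (hB.toLp x) = 0 := by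
    intro z x
    have hi : IndepFun (W z) (B x) P :=
      hWB.comp (φ := fun f : ℝ≥0 × ℝ → ℝ => f z) (ψ := fun f : ℝ → ℝ => f x)
        (measurable_pi_apply z) (measurable_pi_apply x)
    have : inner ℝ (hW.toLp z) (hB.toLp x) = ∫ ω, W z ω * B x ω ∂P := inner_toLp _ _
    rw [this, hi.integral_fun_mul_eq_mul_integral (hW.measurable _).aestronglyMeasurable
      (hB.measurable _).aestronglyMeasurable, hW.mean, zero_mul]
  rw [hB.inner_averageLp_right hν]
  have h1 : ∀ x, inner ℝ (hW.wienerLp f) (hB.toLp x) = 0 := by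
    intro x
    have hs : Submodule.span ℝ (Set.range hW.toLp) ≤ (ℝ ∙ (hB.toLp x))ᗮ := by
      rw [Submodule.span_le]
      rintro _ ⟨z, rfl⟩
      exact Submodule.mem_orthogonal_singleton_iff_inner_left.2 (h0 z x)
    have := Submodule.topologicalClosure_minimal _ hs (Submodule.isClosed_orthogonal _)
      (hW.wienerLp_mem f)
    exact Submodule.mem_orthogonal_singleton_iff_inner_left.1 this
  simp [h1]

lemma inner_limitLp (hW : IsBrownianSheet P W) (hB : IsTwoSidedBrownian P B)
    (hWB : IndepFun (fun ω z => W z ω) (fun ω x => B x ω) P) {w : ℝ≥0} {a m : ℝ} (σ₀ : ℝ)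
    (ha : a ^ 2 = w * m) (y z : ℝ≥0 × ℝ) :
    inner ℝ (limitLp hW hB w a σ₀ y) (limitLp hW hB w a σ₀ z)
      = m * covDyn w y z + σ₀ ^ 2 * covInit w y z := by
  have hc := fun f v => inner_wienerLp_averageLp hW hB hWB f (integrable_id_gaussianReal (Prod.fst v)
    (Prod.snd v))
  have hc' := fun f v => (real_inner_comm _ _).trans (hc f v)
  simp only [limitLp, inner_add_left, inner_add_right, inner_smul_left, inner_smul_right,
    hW.inner_wienerLp, hB.inner_averageLp, RCLike.conj_to_real]
  rw [hc _ (z.2, w * z.1), hc' _ (y.2, w * y.1), ← inner_heatKernelLp]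
  linear_combination (inner ℝ (heatKernelLp w y) (heatKernelLp w z)) * ha

lemma continuous_limitLp (hW : IsBrownianSheet P W) (hB : IsTwoSidedBrownian P B)
    (hWB : IndepFun (fun ω z => W z ω) (fun ω x => B x ω) P) {w : ℝ≥0} {a m : ℝ} (σ₀ : ℝ)
    (ha : a ^ 2 = w * m) : Continuous (limitLp hW hB w a σ₀) := by
  refine continuous_of_continuous_inner ?_
  simp_rw [inner_limitLp hW hB hWB σ₀ ha]
  exact ((continuous_covDyn w).const_mul m).add ((continuous_covInit w).const_mul _)

/-- The closed linear span of the two driving Brownian motions. -/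
noncomputable def noiseSpan (hW : IsBrownianSheet P W) (hB : IsTwoSidedBrownian P B) :
    Submodule ℝ (Lp ℝ 2 P) :=
  (Submodule.span ℝ (Set.range (Sum.elim hW.toLp hB.toLp))).topologicalClosure

lemma limitLp_mem (hW : IsBrownianSheet P W) (hB : IsTwoSidedBrownian P B) (w : ℝ≥0) (a σ₀ : ℝ)
    (z : ℝ≥0 × ℝ) : limitLp hW hB w a σ₀ z ∈ noiseSpan hW hB := by
  have h1 : Set.range hW.toLp ⊆ Set.range (Sum.elim hW.toLp hB.toLp) := by
    rintro _ ⟨z, rfl⟩; exact ⟨Sum.inl z, rfl⟩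
  have h2 : Set.range hB.toLp ⊆ Set.range (Sum.elim hW.toLp hB.toLp) := by
    rintro _ ⟨z, rfl⟩; exact ⟨Sum.inr z, rfl⟩
  exact Submodule.add_mem _
    (Submodule.smul_mem _ _ (Submodule.topologicalClosure_mono (Submodule.span_mono h1)
      (hW.wienerLp_mem _)))
    (Submodule.smul_mem _ _ (Submodule.topologicalClosure_mono (Submodule.span_mono h2)
      (hB.averageLp_mem (integrable_id_gaussianReal _ _))))

lemma isCenteredGaussianLp_of_mem_noiseSpan (hW : IsBrownianSheet P W)
    (hB : IsTwoSidedBrownian P B) (hWB : IndepFun (fun ω z => W z ω) (fun ω x => B x ω) P)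
    {X : Lp ℝ 2 P} (hX : X ∈ noiseSpan hW hB) : IsCenteredGaussianLp X := by
  refine isCenteredGaussianLp_of_mem_closure_span
    (IsGaussianProcess.sumElim hW.gaussian hB.isGaussianProcess hWB) ?_ _ ?_ hX
  · rintro (z | x)
    · exact hW.mean z
    · exact hB.integral_eq_zero x
  · rintro (z | x)
    · exact (hW.memLp z).coeFn_toLp
    · exact hB.coeFn_toLp x

lemma IsCenteredGaussianLp.integral_eq_zero {X : Lp ℝ 2 P} (h : IsCenteredGaussianLp X) :
    ∫ ω, X ω ∂P = 0 := by
  have h1 := integral_map (μ := P) (φ := X) (Lp.aestronglyMeasurable X).aemeasurable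
    (f := fun x : ℝ => x) (by fun_prop)
  rw [← h1, h.map_eq, integral_id_gaussianReal]

end LimitProcess

/-! ### The heat kernel in weak form. -/

section Parabolic

lemma integral_mul_gaussianPDFReal_sub {v : ℝ≥0} (hv : v ≠ 0) {f : ℝ → ℝ} (hf : Measurable f)
    (x : ℝ) : ∫ r, f r * gaussianPDFReal 0 v (r - x) = ∫ n, f (x + √(v : ℝ) * n) ∂gaussianReal 0 1 := by
  rw [← integral_gaussianReal_eq_std hf, integral_gaussianReal_eq_integral_smul hv]
  congr 1; ext r
  rw [gaussianPDFReal_sub, zero_add, smul_eq_mul, mul_comm]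

lemma ContDiff.exists_derivs {φ : ℝ → ℝ} (hφ : ContDiff ℝ (⊤ : ℕ∞) φ) (hc : HasCompactSupport φ) :
    (∀ x, HasDerivAt φ (deriv φ x) x) ∧ (∀ x, HasDerivAt (deriv φ) (iteratedDeriv 2 φ x) x) ∧
    Continuous (iteratedDeriv 2 φ) ∧ HasCompactSupport (iteratedDeriv 2 φ) ∧
    ∃ C, ∀ x, |φ x| ≤ C ∧ |deriv φ x| ≤ C ∧ |iteratedDeriv 2 φ x| ≤ C := by
  have h2 : iteratedDeriv 2 φ = deriv (deriv φ) := by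
    rw [iteratedDeriv_succ, iteratedDeriv_one]
  have hd : ContDiff ℝ (⊤ : ℕ∞) (deriv φ) := by
    have := hφ.iterate_deriv 1; simpa using this
  have hdd : Continuous (iteratedDeriv 2 φ) := by
    rw [h2]; exact hd.continuous_deriv (by simp)
  have hcc : HasCompactSupport (iteratedDeriv 2 φ) := by rw [h2]; exact hc.deriv.deriv
  have hb : ∀ f : ℝ → ℝ, Continuous f → HasCompactSupport f → ∃ C, ∀ x, |f x| ≤ C := fun f h h' =>
    h'.exists_bound_of_continuous h
  obtain ⟨C1, h1⟩ := hb φ hφ.continuous hc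
  obtain ⟨C2, h2'⟩ := hb _ hd.continuous hc.deriv
  obtain ⟨C3, h3⟩ := hb _ hdd hcc
  refine ⟨fun x => (hφ.differentiable (by simp) x).hasDerivAt, fun x => ?_, hdd, hcc,
    max C1 (max C2 C3), fun x => ⟨?_, ?_, ?_⟩⟩
  · rw [h2]; exact (hd.differentiable (by simp) x).hasDerivAt
  · exact (h1 x).trans (le_max_left _ _)
  · exact (h2' x).trans ((le_max_left _ _).trans (le_max_right _ _))
  · exact (h3 x).trans ((le_max_right _ _).trans (le_max_right _ _))

/-- The heat kernel solves the heat equation in the sense of distributions. -/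
lemma heatKernel_weak {w : ℝ≥0} (hw : w ≠ 0) {φ : ℝ → ℝ} (hφ : ContDiff ℝ (⊤ : ℕ∞) φ)
    (hc : HasCompactSupport φ) {t : ℝ≥0} {y : ℝ≥0 × ℝ} (hy : y.1 ≠ t)
    (hI : IntegrableOn (fun z => iteratedDeriv 2 φ z.2 * heatKernel w z.1 z.2 y)
      (Set.Iic t ×ˢ Set.univ) timeSpaceVolume) :
    (∫ r, φ r * heatKernel w t r y) - (w : ℝ) / 2 * (∫ z in Set.Iic t ×ˢ Set.univ,
        iteratedDeriv 2 φ z.2 * heatKernel w z.1 z.2 y ∂timeSpaceVolume)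
      = if y.1 ≤ t then φ y.2 else 0 := by
  obtain ⟨u, x⟩ := y
  obtain ⟨h1, h2, hdd, -, C, hC⟩ := hφ.exists_derivs hc
  have hw' : (0 : ℝ) < w := by positivity
  have hres : timeSpaceVolume.restrict (Set.Iic t ×ˢ Set.univ)
      = (halfLineVolume.restrict (Set.Iic t)).prod volume := by
    rw [timeSpaceVolume_eq, ← Measure.prod_restrict, Measure.restrict_univ]
  rw [IntegrableOn, hres] at hI
  rw [hres, integral_prod _ hI]
  by_cases hu : u ≤ t
  · have hut : u < t := lt_of_le_of_ne hu hy
    simp only [hu, if_true]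
    have e1 : ∫ r, φ r * heatKernel w t r (u, x)
        = ∫ n, φ (x + √(w * (t - u) : ℝ) * n) ∂gaussianReal 0 1 := by
      simp only [heatKernel, hu, if_true]
      rw [integral_mul_gaussianPDFReal_sub (mul_ne_zero hw (tsub_pos_of_lt hut).ne')
        hφ.continuous.measurable, NNReal.coe_mul, NNReal.coe_sub hu]
    let G : ℝ → ℝ := fun v => ∫ n, iteratedDeriv 2 φ (x + √v * n) ∂gaussianReal 0 1
    have hG : Continuous G := continuous_gaussian_smooth hdd (fun x => (hC x).2.2) x
    have e2 : ∫ s in Set.Iic t, (∫ r : ℝ, iteratedDeriv 2 φ r * heatKernel w s r (u, x)) ∂halfLineVolume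
        = ∫ s in Set.Ioc u t, G (w * (s - u)) ∂halfLineVolume := by
      have hsub : Set.Ioc u t ⊆ Set.Iic t := fun s hs => hs.2
      rw [← integral_indicator measurableSet_Iic, ← integral_indicator measurableSet_Ioc]
      refine integral_congr_ae ?_
      filter_upwards [ae_halfLineVolume_ne u] with s hs
      by_cases hst : s ∈ Set.Iic t
      · rw [Set.indicator_of_mem hst]
        by_cases hus : u < s
        · rw [Set.indicator_of_mem (show s ∈ Set.Ioc u t from ⟨hus, hst⟩)]
          simp only [heatKernel, hus.le, if_true, G]
          rw [integral_mul_gaussianPDFReal_sub (mul_ne_zero hw (tsub_pos_of_lt hus).ne')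
            hdd.measurable, NNReal.coe_mul, NNReal.coe_sub hus.le]
        · rw [Set.indicator_of_notMem (fun h => hus h.1)]
          have : ¬ u ≤ s := fun h => hus (lt_of_le_of_ne h hs.symm)
          simp [heatKernel, this]
      · rw [Set.indicator_of_notMem hst, Set.indicator_of_notMem (fun h => hst h.2)]
    -- The substitution v = w(s - u) turns the time integral into the variance integral of the
    -- semigroup identity; its factor 1/w cancels the w in front.
    have e3 : ∫ s in Set.Ioc u t, G (w * (s - u)) ∂halfLineVolume
        = (w : ℝ)⁻¹ * ∫ v in (0 : ℝ)..(w * (t - u)), G v := by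
      rw [setIntegral_halfLineVolume_Ioc (f := fun s : ℝ≥0 => G (w * (s - u)))
        (hG.comp (by fun_prop)).measurable hu]
      rw [intervalIntegral.integral_congr (g := fun s : ℝ => G (w * s - w * u))]
      · rw [intervalIntegral.integral_comp_mul_sub _ hw'.ne', smul_eq_mul]
        congr 2 <;> ring
      · intro s hs
        rw [Set.uIcc_of_le (by exact_mod_cast hu)] at hs
        have h0 : (0 : ℝ) ≤ s := u.2.trans hs.1
        simp only [Real.coe_toNNReal _ h0, mul_sub]
    have e4 := gaussian_smooth_sub h1 h2 hdd (fun x => (hC x).1) (fun x => (hC x).2.1)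
      (fun x => (hC x).2.2) x (v := (w * (t - u) : ℝ))
      (mul_nonneg hw'.le (sub_nonneg.2 (by exact_mod_cast hu)))
    rw [e1, e2, e3]
    rw [sub_eq_iff_eq_add] at e4
    rw [e4]
    field_simp
    ring
  · have : ∀ s ∈ Set.Iic t, ∫ r, iteratedDeriv 2 φ r * heatKernel w s r (u, x) = 0 := by
      intro s hs
      have : ¬ u ≤ s := fun h => hu (h.trans hs)
      simp [heatKernel, this]
    rw [setIntegral_congr_fun measurableSet_Iic this]
    simp [heatKernel, hu]

lemma integrableOn_timeSpaceVolume_of_compact {f : ℝ → ℝ} (hf : Continuous f)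
    (hc : HasCompactSupport f) {h : ℝ≥0 × ℝ → ℝ} (hh : Continuous h) (t : ℝ≥0) :
    IntegrableOn (fun z => f z.2 * h z) (Set.Iic t ×ˢ Set.univ) timeSpaceVolume := by
  have hm : Continuous fun z : ℝ≥0 × ℝ => f z.2 * h z := by fun_prop
  have hK : IsCompact (Set.Icc 0 t ×ˢ tsupport f) := isCompact_Icc.prod hc
  obtain ⟨C, hC⟩ := hK.exists_bound_of_continuousOn hm.continuousOn
  have hfin : timeSpaceVolume (Set.Icc 0 t ×ˢ tsupport f) ≠ ∞ := by
    rw [timeSpaceVolume_eq, Measure.prod_prod]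
    refine ENNReal.mul_ne_top ?_ hc.measure_lt_top.ne
    have : Set.Icc 0 t = Set.Iic t := by ext; simp
    rw [this, halfLineVolume_Iic]
    exact ENNReal.ofReal_ne_top
  have h1 : IntegrableOn (fun z => f z.2 * h z) (Set.Icc 0 t ×ˢ tsupport f) timeSpaceVolume :=
    Measure.integrableOn_of_bounded hfin hm.aestronglyMeasurable
      ((ae_restrict_iff' (measurableSet_Icc.prod (isClosed_tsupport f).measurableSet)).2
        (ae_of_all _ hC))
  refine h1.of_forall_sdiff_eq_zero (measurableSet_Iic.prod MeasurableSet.univ) ?_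
  rintro ⟨s, r⟩ ⟨⟨hs, -⟩, hz⟩
  have : r ∉ tsupport f := fun hr => hz ⟨⟨zero_le, hs⟩, hr⟩
  simp [image_eq_zero_of_notMem_tsupport this]

/-- The Fubini condition for smoothing a source G dν. The parametrisation ζ allows both a fixed time
and all of time-space. -/
lemma integrable_prod_heatKernel {w : ℝ≥0} {ν : Measure (ℝ≥0 × ℝ)} [SFinite ν] {G : ℝ≥0 × ℝ → ℝ}
    (hG : Measurable G) {h : ℝ≥0 × ℝ → ℝ}
    (hGh : ∀ z, Integrable (fun y => G y * heatKernel w z.1 z.2 y) ν ∧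
      ∫ y, |G y| * heatKernel w z.1 z.2 y ∂ν ≤ h z)
    {T : Type*} [MeasurableSpace T] {ρ : Measure T} [SFinite ρ] {ζ : T → ℝ≥0 × ℝ}
    (hζ : Measurable ζ) {c : T → ℝ} (hc : Measurable c)
    (hch : Integrable (fun τ => c τ * h (ζ τ)) ρ) :
    Integrable (fun q : T × (ℝ≥0 × ℝ) => c q.1 * (G q.2 * heatKernel w (ζ q.1).1 (ζ q.1).2 q.2))
      (ρ.prod ν) := by
  have hm : Measurable fun q : T × (ℝ≥0 × ℝ) =>
      c q.1 * (G q.2 * heatKernel w (ζ q.1).1 (ζ q.1).2 q.2) :=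
    (hc.comp measurable_fst).mul ((hG.comp measurable_snd).mul
      ((measurable_heatKernel w).comp ((hζ.comp measurable_fst).prodMk measurable_snd)))
  rw [integrable_prod_iff hm.aestronglyMeasurable]
  refine ⟨ae_of_all _ fun τ => (hGh (ζ τ)).1.const_mul (c τ),
    hch.mono hm.aestronglyMeasurable.norm.integral_prod_right' (ae_of_all _ fun τ => ?_)⟩
  have h0 : 0 ≤ ∫ y, |G y| * heatKernel w (ζ τ).1 (ζ τ).2 y ∂ν :=
    integral_nonneg fun y => mul_nonneg (abs_nonneg _) (heatKernel_nonneg _ _ _ _)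
  simp only [norm_mul, Real.norm_of_nonneg (heatKernel_nonneg _ _ _ _), Real.norm_eq_abs]
  rw [integral_const_mul, abs_mul, abs_abs, abs_of_nonneg h0,
    abs_of_nonneg (h0.trans (hGh (ζ τ)).2)]
  exact mul_le_mul_of_nonneg_left (hGh (ζ τ)).2 (abs_nonneg _)

/-- Integrate the identity for a single source point y against G dν. Time-space volume as ν gives
the noise term; Lebesgue measure on the time-zero slice gives the initial term. -/
lemma heatKernel_duality {w : ℝ≥0} (hw : w ≠ 0) {φ : ℝ → ℝ} (hφ : ContDiff ℝ (⊤ : ℕ∞) φ)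
    (hc : HasCompactSupport φ) {t : ℝ≥0} {ν : Measure (ℝ≥0 × ℝ)} [SFinite ν]
    (hν : ∀ᵐ y ∂ν, y.1 ≠ t) {G : ℝ≥0 × ℝ → ℝ} (hG : Measurable G) {h : ℝ≥0 × ℝ → ℝ}
    (hh : Continuous h) (hGh : ∀ z, Integrable (fun y => G y * heatKernel w z.1 z.2 y) ν ∧
      ∫ y, |G y| * heatKernel w z.1 z.2 y ∂ν ≤ h z) :
    (∫ r, φ r * ∫ y, G y * heatKernel w t r y ∂ν) - (w : ℝ) / 2 *
        (∫ z in Set.Iic t ×ˢ Set.univ,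
          iteratedDeriv 2 φ z.2 * ∫ y, G y * heatKernel w z.1 z.2 y ∂ν ∂timeSpaceVolume)
      = ∫ y, G y * (if y.1 ≤ t then φ y.2 else 0) ∂ν := by
  obtain ⟨-, -, hdd, hcc, -⟩ := hφ.exists_derivs hc
  have I1 : Integrable (fun q : ℝ × (ℝ≥0 × ℝ) => φ q.1 * (G q.2 * heatKernel w t q.1 q.2))
      (volume.prod ν) :=
    integrable_prod_heatKernel hG hGh (ρ := volume) (ζ := fun r : ℝ => (t, r))
      (by fun_prop) hφ.continuous.measurable
      ((hφ.continuous.mul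
        (hh.comp (by fun_prop : Continuous fun r : ℝ => (t, r)))).integrable_of_hasCompactSupport
          hc.mul_right)
  set ρ := timeSpaceVolume.restrict (Set.Iic t ×ˢ Set.univ) with hρ
  have I2 : Integrable (fun q : (ℝ≥0 × ℝ) × (ℝ≥0 × ℝ) =>
      iteratedDeriv 2 φ q.1.2 * (G q.2 * heatKernel w q.1.1 q.1.2 q.2)) (ρ.prod ν) :=
    integrable_prod_heatKernel hG hGh (ρ := ρ) (ζ := id) measurable_id
      (hdd.measurable.comp measurable_snd)
      (integrableOn_timeSpaceVolume_of_compact hdd hcc hh t)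
  have e1 : (∫ r, φ r * ∫ y, G y * heatKernel w t r y ∂ν)
      = ∫ y, (∫ r, φ r * (G y * heatKernel w t r y)) ∂ν := by
    simp_rw [← integral_const_mul]
    exact integral_integral_swap I1
  have e2 : (∫ z, iteratedDeriv 2 φ z.2 * ∫ y, G y * heatKernel w z.1 z.2 y ∂ν ∂ρ)
      = ∫ y, ∫ z, iteratedDeriv 2 φ z.2 * (G y * heatKernel w z.1 z.2 y) ∂ρ ∂ν := by
    simp_rw [← integral_const_mul]
    exact integral_integral_swap I2
  rw [e1, e2, ← integral_const_mul, ← integral_sub I1.integral_prod_right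
    (I2.integral_prod_right.const_mul _)]
  refine integral_congr_ae ?_
  filter_upwards [hν, I2.prod_left_ae] with y hy hy2
  -- Fubini gives integrability of the section only with the factor `G y`; it can be divided out
  -- unless it is 0, and then both sides vanish.
  by_cases h0 : G y = 0
  · simp [h0]
  have hI : Integrable (fun z => iteratedDeriv 2 φ z.2 * heatKernel w z.1 z.2 y) ρ := by
    refine (hy2.const_mul (G y)⁻¹).congr (ae_of_all _ fun z => ?_)
    field_simp
  rw [← heatKernel_weak hw hφ hc hy hI, mul_sub, ← hρ, mul_left_comm, ← integral_const_mul,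
    ← integral_const_mul (G y)]
  congr 1
  · congr 1; ext r; ring
  · rw [← integral_const_mul (G y), ← integral_const_mul]
    congr 1; ext z; ring

end Parabolic

/-! ### The stochastic heat equation. -/

section WeakSolution

lemma continuous_heatKernelLp {w : ℝ≥0} (hw : w ≠ 0) : Continuous (heatKernelLp w) := by
  refine continuous_of_continuous_inner ?_
  have : ∀ z : (ℝ≥0 × ℝ) × (ℝ≥0 × ℝ), inner ℝ (heatKernelLp w z.1) (heatKernelLp w z.2)
      = (w : ℝ)⁻¹ * covDyn w z.1 z.2 := fun z => by
    rw [← inner_heatKernelLp]; field_simp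
  simp_rw [this]
  exact (continuous_covDyn w).const_mul _

lemma memLp_testFunction {φ : ℝ → ℝ} (hφ : Continuous φ) (hc : HasCompactSupport φ) (t : ℝ≥0) :
    MemLp (fun z : ℝ≥0 × ℝ => if z.1 ≤ t then φ z.2 else 0) 2 timeSpaceVolume := by
  have hm : Measurable fun z : ℝ≥0 × ℝ => if z.1 ≤ t then φ z.2 else 0 :=
    Measurable.ite (measurableSet_le measurable_fst measurable_const) (by fun_prop) measurable_const
  rw [memLp_two_iff_integrable_sq hm.aestronglyMeasurable]
  have h := integrableOn_timeSpaceVolume_of_compact hφ hc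
    (h := fun z => φ z.2) (by fun_prop) t
  rw [← integrable_indicator_iff (measurableSet_Iic.prod MeasurableSet.univ)] at h
  refine h.congr (ae_of_all _ fun z => ?_)
  by_cases hz : z.1 ≤ t <;> simp [Set.indicator, hz, sq]

/-- Duality with source density g; Cauchy–Schwarz supplies the continuous dominating function. -/
lemma inner_heatKernelLp_weak {w : ℝ≥0} (hw : w ≠ 0) {φ : ℝ → ℝ} (hφ : ContDiff ℝ (⊤ : ℕ∞) φ)
    (hc : HasCompactSupport φ) (t : ℝ≥0) (g : Lp ℝ 2 timeSpaceVolume) :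
    (∫ r, φ r * inner ℝ g (heatKernelLp w (t, r))) - (w : ℝ) / 2 *
        (∫ z in Set.Iic t ×ˢ Set.univ,
          iteratedDeriv 2 φ z.2 * inner ℝ g (heatKernelLp w z) ∂timeSpaceVolume)
      = inner ℝ g (memLp_testFunction hφ.continuous hc t).toLp := by
  have hg : ∀ {f : ℝ≥0 × ℝ → ℝ} (hf : MemLp f 2 timeSpaceVolume),
      inner ℝ g hf.toLp = ∫ y, g y * f y ∂timeSpaceVolume := fun hf => by
    conv_lhs => rw [← Lp.toLp_coeFn g (Lp.memLp g)]
    exact inner_toLp _ _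
  rw [hg]
  simp_rw [heatKernelLp, hg]
  refine heatKernel_duality hw hφ hc (h := fun z => ‖g‖ * ‖heatKernelLp w z‖) ?_
    (Lp.stronglyMeasurable g).measurable ?_ fun z => ⟨?_, ?_⟩
  · rw [timeSpaceVolume_eq]
    exact Measure.quasiMeasurePreserving_fst.ae (ae_halfLineVolume_ne t)
  · exact continuous_const.mul (continuous_heatKernelLp hw).norm
  · exact (Lp.memLp g).integrable_mul (memLp_heatKernel w z.1 z.2)
  · have h1 : ∫ y, |g y| * heatKernel w z.1 z.2 y ∂timeSpaceVolume
        = inner ℝ (Lp.memLp g).abs.toLp (heatKernelLp w z) := (inner_toLp _ _).symm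
    rw [h1]
    refine (real_inner_le_norm _ _).trans_eq ?_
    congr 1
    rw [Lp.norm_toLp, Lp.norm_def]
    congr 1
    exact eLpNorm_norm (g : ℝ≥0 × ℝ → ℝ)

lemma integral_gaussianReal_weak (w : ℝ≥0) {φ : ℝ → ℝ} (hφ : ContDiff ℝ (⊤ : ℕ∞) φ)
    (hc : HasCompactSupport φ) (t : ℝ≥0) {b : ℝ → ℝ} (hb : Continuous b) {C : ℝ}
    (hC : ∀ x, |b x| ≤ C * (1 + |x|)) :
    (∫ r, φ r * ∫ x, b x ∂gaussianReal r (w * t)) - (w : ℝ) / 2 *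
        (∫ z in Set.Iic t ×ˢ Set.univ,
          iteratedDeriv 2 φ z.2 * ∫ x, b x ∂gaussianReal z.2 (w * z.1) ∂timeSpaceVolume)
      = ∫ x, φ x * b x := by
  -- For w = 0 or t = 0 the law at time t is a point mass while the kernel is 0, so duality does not
  -- apply; the claim is immediate there.
  by_cases hw : w = 0
  · simp [hw, gaussianReal_zero_var]
  by_cases ht : t = 0
  · have h0 : timeSpaceVolume (Set.Iic (0 : ℝ≥0) ×ˢ (Set.univ : Set ℝ)) = 0 := by
      rw [timeSpaceVolume_eq, Measure.prod_prod, halfLineVolume_Iic]; simp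
    rw [ht, Measure.restrict_eq_zero.2 h0]
    simp [gaussianReal_zero_var]
  have hib : ∀ r v, Integrable b (gaussianReal r v) := fun r v =>
    (((integrable_const 1).add (integrable_abs_gaussianReal r v)).const_mul C).mono'
      hb.aestronglyMeasurable (ae_of_all _ hC)
  -- Initial data are sources at time zero.
  let ν : Measure (ℝ≥0 × ℝ) := (volume : Measure ℝ).map fun x => ((0 : ℝ≥0), x)
  have hmap : Measurable fun x : ℝ => ((0 : ℝ≥0), x) := by fun_prop
  have hk : ∀ (f : ℝ → ℝ) (s : ℝ≥0) (r : ℝ), s ≠ 0 →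
      (fun x => f x * heatKernel w s r (0, x)) = fun x => gaussianPDFReal r (w * s) x * f x := by
    intro f s r hs
    ext x
    have : gaussianPDFReal 0 (w * s) (r - x) = gaussianPDFReal r (w * s) x := by
      simp only [gaussianPDFReal]; congr 3; ring
    simp [heatKernel, this, mul_comm]
  have hint : ∀ (f : ℝ → ℝ) (s : ℝ≥0) (r : ℝ), s ≠ 0 →
      ∫ x, f x * heatKernel w s r (0, x) = ∫ x, f x ∂gaussianReal r (w * s) := by
    intro f s r hs
    rw [hk f s r hs, integral_gaussianReal_eq_integral_smul (mul_ne_zero hw hs)]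
    rfl
  have hνF : ∀ F : ℝ≥0 × ℝ → ℝ, Measurable F → ∫ y, F y ∂ν = ∫ x, F (0, x) := fun F hF =>
    integral_map hmap.aemeasurable hF.aestronglyMeasurable
  have hν : ∀ (f : ℝ → ℝ) (hf : Measurable f) (s : ℝ≥0) (r : ℝ),
      ∫ y, f y.2 * heatKernel w s r y ∂ν = ∫ x, f x * heatKernel w s r (0, x) := by
    intro f hf s r
    exact hνF _ ((hf.comp measurable_snd).mul (measurable_heatKernel_right w s r))
  have key := heatKernel_duality hw hφ hc (t := t) (ν := ν) (G := fun y => b y.2)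
    (h := fun z => C * (1 + gaussAbs z.2 (w * z.1))) ?_ (hb.measurable.comp measurable_snd) ?_
    fun z => ⟨?_, ?_⟩
  · rw [show (∫ x, φ x * b x) = ∫ y, b y.2 * (if y.1 ≤ t then φ y.2 else 0) ∂ν by
      have : Measurable fun z : ℝ≥0 × ℝ => if z.1 ≤ t then φ z.2 else 0 :=
        Measurable.ite (measurableSet_le measurable_fst measurable_const)
          (hφ.continuous.measurable.comp measurable_snd) measurable_const
      refine Eq.trans ?_ (hνF _ ((hb.measurable.comp measurable_snd).mul this)).symm
      simp [mul_comm], ← key]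
    congr 1
    · congr 1; ext r
      rw [hν b hb.measurable, hint b t r ht]
    · congr 1
      refine setIntegral_congr_ae (measurableSet_Iic.prod MeasurableSet.univ) ?_
      have : ∀ᵐ z ∂timeSpaceVolume, z.1 ≠ 0 := by
        rw [timeSpaceVolume_eq]
        exact Measure.quasiMeasurePreserving_fst.ae (ae_halfLineVolume_ne 0)
      filter_upwards [this] with z hz _
      rw [hν b hb.measurable, hint b z.1 z.2 hz]
  · refine (ae_map_iff hmap.aemeasurable (measurable_fst (measurableSet_singleton t).compl)).2 ?_
    exact ae_of_all _ fun x => Ne.symm ht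
  · exact ((continuous_gaussAbs.comp (f := fun z : ℝ≥0 × ℝ => (z.2, w * z.1))
      (by fun_prop)).const_add 1).const_mul C
  · refine (integrable_map_measure ((hb.measurable.comp measurable_snd).mul
      (measurable_heatKernel_right w z.1 z.2)).aestronglyMeasurable hmap.aemeasurable).2 ?_
    by_cases hz : z.1 = 0
    · simp [hz, heatKernel_zero_time, Function.comp_def]
    · have := hk b z.1 z.2 hz
      simp only [Function.comp_def, Pi.mul_apply]
      rw [this, integrable_gaussianPDFReal_smul_iff (mul_ne_zero hw hz)]
      exact hib _ _
  · have hC0 : 0 ≤ C := by simpa using (abs_nonneg _).trans (hC 0)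
    have hga : ∫ x, C * (1 + |x|) ∂gaussianReal z.2 (w * z.1)
        = C * (1 + gaussAbs z.2 (w * z.1)) := by
      rw [integral_const_mul, integral_add (integrable_const _) (integrable_abs_gaussianReal _ _)]
      simp [gaussAbs]
    rw [hν (fun x => |b x|) hb.measurable.abs]
    by_cases hz : z.1 = 0
    · simp only [hz, heatKernel_zero_time, Pi.zero_apply, mul_zero, integral_zero]
      have : 0 ≤ gaussAbs z.2 0 := integral_nonneg fun _ => abs_nonneg _
      positivity
    · rw [hint (fun x => |b x|) z.1 z.2 hz, ← hga]
      exact integral_mono (hib _ _).abs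
        (((integrable_const 1).add (integrable_abs_gaussianReal _ _)).const_mul C) hC

variable {Ω : Type*} [MeasurableSpace Ω] {P : Measure Ω} [IsProbabilityMeasure P]
  {W : ℝ≥0 × ℝ → Ω → ℝ} {B : ℝ → Ω → ℝ}

/-- The weak form of the heat equation, tested against an element of `L²`. -/
lemma inner_limitLp_weak (hW : IsBrownianSheet P W) (hB : IsTwoSidedBrownian P B)
    (hWB : IndepFun (fun ω z => W z ω) (fun ω x => B x ω) P) {w : ℝ≥0} {a m : ℝ} (σ₀ : ℝ)
    (ha : a ^ 2 = w * m) {φ : ℝ → ℝ} (hφ : ContDiff ℝ (⊤ : ℕ∞) φ) (hc : HasCompactSupport φ)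
    (t : ℝ≥0) (U : Lp ℝ 2 P) :
    (∫ r, φ r * inner ℝ U (limitLp hW hB w a σ₀ (t, r)))
        - σ₀ * ∫ r, φ r * inner ℝ U (hB.toLp r)
      = (w : ℝ) / 2 * (∫ z in Set.Iic t ×ˢ Set.univ,
          iteratedDeriv 2 φ z.2 * inner ℝ U (limitLp hW hB w a σ₀ z) ∂timeSpaceVolume)
        + a * inner ℝ U (hW.wienerLp (memLp_testFunction hφ.continuous hc t).toLp) := by
  obtain ⟨-, -, hdd, hcc, -⟩ := hφ.exists_derivs hc
  have hid := integrable_id_gaussianReal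
  have hU : ∀ z, inner ℝ U (limitLp hW hB w a σ₀ z) = a * inner ℝ U (hW.wienerLp (heatKernelLp w z))
      + σ₀ * ∫ x, inner ℝ U (hB.toLp x) ∂gaussianReal z.2 (w * z.1) := by
    intro z
    rw [limitLp, inner_add_right, inner_smul_right, inner_smul_right,
      hB.inner_averageLp_right (hid _ _)]
  have hb : Continuous fun x => inner ℝ U (hB.toLp x) :=
    continuous_const.inner hB.continuous_toLp
  have hbC : ∀ x, |inner ℝ U (hB.toLp x)| ≤ ‖U‖ * (1 + |x|) := fun x =>
    (abs_real_inner_le_norm _ _).trans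
      (mul_le_mul_of_nonneg_left (hB.norm_toLp_le x) (norm_nonneg _))
  have key := integral_gaussianReal_weak w hφ hc t hb hbC
  have hcont : Continuous fun z => inner ℝ U (limitLp hW hB w a σ₀ z) :=
    continuous_const.inner (continuous_limitLp hW hB hWB σ₀ ha)
  by_cases hw : w = 0
  -- Without diffusion the noise coefficient vanishes too, and only the initial term is left.
  · have ha0 : a = 0 := by simpa [hw] using ha
    simp only [hU]
    simp only [ha0, hw, NNReal.coe_zero, zero_mul, zero_div, zero_add, add_zero, sub_zero] at key ⊢
    rw [← key]
    simp_rw [mul_left_comm _ σ₀, integral_const_mul]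
    ring
  -- The adjoint moves the test variable from L²(P) to a function on time-space, where the
  -- deterministic duality applies.
  set g := ContinuousLinearMap.adjoint hW.wienerLp U with hg
  have hgU : ∀ f, inner ℝ U (hW.wienerLp f) = inner ℝ g f := fun f =>
    (ContinuousLinearMap.adjoint_inner_left _ _ _).symm
  have keyW := inner_heatKernelLp_weak hw hφ hc t g
  simp only [hgU] at hU ⊢
  have hcW : Continuous fun z => inner ℝ g (heatKernelLp w z) :=
    continuous_const.inner (continuous_heatKernelLp hw)
  have hcB : Continuous fun z : ℝ≥0 × ℝ =>
      σ₀ * ∫ x, inner ℝ U (hB.toLp x) ∂gaussianReal z.2 (w * z.1) := by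
    have : (fun z : ℝ≥0 × ℝ => σ₀ * ∫ x, inner ℝ U (hB.toLp x) ∂gaussianReal z.2 (w * z.1))
        = fun z => inner ℝ U (limitLp hW hB w a σ₀ z) - a * inner ℝ g (heatKernelLp w z) := by
      ext z; rw [hU]; ring
    rw [this]; fun_prop
  have i1 : ∀ {h : ℝ≥0 × ℝ → ℝ}, Continuous h → Integrable fun r => φ r * h (t, r) := fun hh =>
    (hφ.continuous.mul (hh.comp (by fun_prop : Continuous fun r : ℝ => (t, r)))).integrable_of_hasCompactSupport
      hc.mul_right
  have i2 : ∀ {h : ℝ≥0 × ℝ → ℝ}, Continuous h → Integrable (fun z => iteratedDeriv 2 φ z.2 * h z)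
      (timeSpaceVolume.restrict (Set.Iic t ×ˢ Set.univ)) := fun hh =>
    integrableOn_timeSpaceVolume_of_compact hdd hcc hh t
  have hcW' : Continuous fun z => a * inner ℝ g (heatKernelLp w z) := hcW.const_mul a
  simp only [hU, mul_add]
  rw [integral_add (i1 hcW') (i1 hcB), integral_add (i2 hcW') (i2 hcB)]
  simp_rw [mul_left_comm _ a, mul_left_comm _ σ₀, integral_const_mul]
  rw [← keyW, ← key]
  ring

/-- Both sides are integrable random variables with equal integrals over every event A, by
`inner_limitLp_weak` with U = 1_A; hence they agree almost surely. -/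
lemma IsBrownianSheet.isWeakSolutionSHE (hW : IsBrownianSheet P W) (hB : IsTwoSidedBrownian P B)
    (hWB : IndepFun (fun ω z => W z ω) (fun ω x => B x ω) P) {w : ℝ≥0} {a m σ₀ : ℝ}
    (ha : a ^ 2 = w * m) {Z : ℝ≥0 × ℝ → Ω → ℝ} (hZ : ∀ z, limitLp hW hB w a σ₀ z =ᵐ[P] Z z)
    (hZm : Measurable fun q : (ℝ≥0 × ℝ) × Ω => Z q.1 q.2) :
    IsWeakSolutionSHE P w a σ₀ W B Z := by
  refine ⟨hZm, fun r => ?_, fun φ hφ hc t => ?_⟩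
  · have h0 : limitLp hW hB w a σ₀ (0, r) = σ₀ • hB.toLp r := by
      have : heatKernelLp w (0, r) = 0 := by
        rw [Lp.eq_zero_iff_ae_eq_zero]
        refine (MemLp.coeFn_toLp _).trans ?_
        rw [heatKernel_zero_time]
      simp [limitLp, this, IsTwoSidedBrownian.averageLp, gaussianReal_zero_var]
    filter_upwards [hZ (0, r), Lp.coeFn_smul σ₀ (hB.toLp r), hB.coeFn_toLp r] with ω h1 h2 h3
    rw [← h1, h0, h2, Pi.smul_apply, h3, smul_eq_mul]
  obtain ⟨-, -, hdd, hcc, -⟩ := hφ.exists_derivs hc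
  have hφt := memLp_testFunction hφ.continuous hc t
  have hLc := continuous_limitLp hW hB hWB σ₀ ha
  obtain ⟨B', hB'm, hB'⟩ := hB.exists_measurable_version
  have hFB : ∀ x, hB.toLp x =ᵐ[P] B' x := fun x => by
    filter_upwards [hB.coeFn_toLp x, hB'] with ω h1 h2
    rw [h1, h2]
  have hFt : ∀ r, limitLp hW hB w a σ₀ (t, r) =ᵐ[P] Z (t, r) := fun r => hZ _
  have hZt : Measurable (Function.uncurry fun r => Z (t, r)) :=
    hZm.comp (f := fun q : ℝ × Ω => ((t, q.1), q.2)) (by fun_prop)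
  have w1 : Integrable fun r => φ r * (1 + ‖limitLp hW hB w a σ₀ (t, r)‖) :=
    (hφ.continuous.mul ((hLc.comp
      (by fun_prop : Continuous fun r : ℝ => (t, r))).norm.const_add 1)).integrable_of_hasCompactSupport
      hc.mul_right
  have w2 : Integrable fun r => φ r * (1 + ‖hB.toLp r‖) :=
    (hφ.continuous.mul (hB.continuous_toLp.norm.const_add 1)).integrable_of_hasCompactSupport
      hc.mul_right
  have w3 : Integrable (fun z => iteratedDeriv 2 φ z.2 * (1 + ‖limitLp hW hB w a σ₀ z‖))
      (timeSpaceVolume.restrict (Set.Iic t ×ˢ Set.univ)) :=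
    integrableOn_timeSpaceVolume_of_compact hdd hcc (hLc.norm.const_add 1) t
  have m1 := hφ.continuous.measurable
  have m3 : Measurable fun z : ℝ≥0 × ℝ => iteratedDeriv 2 φ z.2 := hdd.measurable.comp measurable_snd
  refine ⟨hW.wienerLp hφt.toLp, (hW.isWhiteNoiseIntegral_iff hφt _).2 (ae_eq_refl _), ?_⟩
  have J1 := integrable_integral_field hZt hFt m1 w1
  have J2 := (integrable_integral_field hB'm hFB m1 w2).const_mul σ₀
  have J3 := (integrable_integral_field hZm hZ m3 w3).const_mul ((w : ℝ) / 2)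
  have J4 := (integrable_Lp_two (hW.wienerLp hφt.toLp)).const_mul a
  have key := Integrable.ae_eq_of_forall_setIntegral_eq _ _ (J1.sub J2) (J3.add J4) fun A hA _ => by
    simp only [Pi.sub_apply, Pi.add_apply]
    rw [integral_sub J1.integrableOn J2.integrableOn, integral_add J3.integrableOn J4.integrableOn,
      integral_const_mul, integral_const_mul, integral_const_mul,
      setIntegral_integral_field hZt hFt m1 w1 hA, setIntegral_integral_field hB'm hFB m1 w2 hA,
      setIntegral_integral_field hZm hZ m3 w3 hA,
      ← L2.inner_indicatorConstLp_one hA (measure_ne_top P A)]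
    exact inner_limitLp_weak hW hB hWB σ₀ ha hφ hc t _
  filter_upwards [key, hB', ae_integrable_field hZt hFt m1 w1, ae_integrable_field hB'm hFB m1 w2,
    ae_integrable_field hZm hZ m3 w3] with ω h h1 h2 h3 h4
  simp only [Pi.sub_apply, Pi.add_apply] at h
  simp only [h1] at h h3
  exact ⟨h2, h3, h4, h⟩

end WeakSolution

/-! ### Second-order expansion of characteristic functions. -/

lemma norm_prod_sub_prod_le {ι : Type*} (s : Finset ι) {a b : ι → ℂ} (ha : ∀ i ∈ s, ‖a i‖ ≤ 1)
    (hb : ∀ i ∈ s, ‖b i‖ ≤ 1) : ‖∏ i ∈ s, a i - ∏ i ∈ s, b i‖ ≤ ∑ i ∈ s, ‖a i - b i‖ := by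
  classical
  induction s using Finset.induction_on with
  | empty => simp
  | insert j s hj ih =>
    rw [Finset.prod_insert hj, Finset.prod_insert hj, Finset.sum_insert hj]
    have h1 : a j * ∏ i ∈ s, a i - b j * ∏ i ∈ s, b i
        = (a j - b j) * ∏ i ∈ s, a i + b j * (∏ i ∈ s, a i - ∏ i ∈ s, b i) := by ring
    rw [h1]
    refine (norm_add_le _ _).trans (add_le_add ?_ ?_)
    · rw [norm_mul]
      refine mul_le_of_le_one_right (norm_nonneg _) ?_
      rw [norm_prod]
      exact Finset.prod_le_one (fun _ _ => norm_nonneg _)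
        fun i hi => ha i (Finset.mem_insert_of_mem hi)
    · rw [norm_mul]
      refine (mul_le_of_le_one_left (norm_nonneg _) (hb j (Finset.mem_insert_self _ _))).trans ?_
      exact ih (fun i hi => ha i (Finset.mem_insert_of_mem hi))
        fun i hi => hb i (Finset.mem_insert_of_mem hi)

lemma norm_pow_sub_pow_le_mul {a b : ℂ} (ha : ‖a‖ ≤ 1) (hb : ‖b‖ ≤ 1) (k : ℕ) :
    ‖a ^ k - b ^ k‖ ≤ k * ‖a - b‖ := by
  simpa using norm_prod_sub_prod_le (Finset.range k) (a := fun _ => a) (b := fun _ => b)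
    (fun _ _ => ha) (fun _ _ => hb)

lemma Complex.norm_exp_sub_quadratic_le {x : ℂ} (hx : ‖x‖ ≤ 1) :
    ‖Complex.exp x - (1 + x + x ^ 2 / 2)‖ ≤ ‖x‖ ^ 3 := by
  have h := Complex.exp_bound hx (n := 3) (by norm_num)
  simp only [Finset.sum_range_succ, Finset.sum_range_zero, Nat.factorial] at h
  norm_num at h
  refine h.trans ?_
  have := pow_nonneg (norm_nonneg x) 3
  linarith

/-- `G z = 1 + m (z - 1) + b (z - 1) ^ 2 / 2 + o(|z - 1| ^ 2)` in the closed unit disc. -/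
def HasQuadraticExpansion (G : ℂ → ℂ) (m b : ℝ) : Prop :=
  ∀ ε > 0, ∃ ρ > 0, ∀ z : ℂ, ‖z‖ ≤ 1 → ‖z - 1‖ ≤ ρ →
    ‖G z - (1 + m * (z - 1) + b / 2 * (z - 1) ^ 2)‖ ≤ ε * ‖z - 1‖ ^ 2

lemma norm_pow_sub_linear_le {z : ℂ} (hz : ‖z‖ ≤ 1) (k : ℕ) :
    ‖z ^ k - 1 - k * (z - 1)‖ ≤ k ^ 2 / 2 * ‖z - 1‖ ^ 2 := by
  induction k with
  | zero => simp
  | succ k ih =>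
    have h : z ^ (k + 1) - 1 - (k + 1 : ℕ) * (z - 1)
        = z * (z ^ k - 1 - k * (z - 1)) + k * (z - 1) ^ 2 := by push_cast; ring
    rw [h]
    refine (norm_add_le _ _).trans ?_
    rw [norm_mul, norm_mul, norm_pow, Complex.norm_natCast]
    have := mul_le_of_le_one_left (norm_nonneg (z ^ k - 1 - k * (z - 1))) hz
    push_cast
    nlinarith [sq_nonneg ‖z - 1‖]

lemma norm_pow_sub_quadratic_le {z : ℂ} (hz : ‖z‖ ≤ 1) (k : ℕ) :
    ‖z ^ k - (1 + k * (z - 1) + (k * (k - 1) : ℂ) / 2 * (z - 1) ^ 2)‖ ≤ k ^ 2 * ‖z - 1‖ ^ 2 := by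
  have h : z ^ k - (1 + k * (z - 1) + (k * (k - 1) : ℂ) / 2 * (z - 1) ^ 2)
      = (z ^ k - 1 - k * (z - 1)) - (k * (k - 1) : ℂ) / 2 * (z - 1) ^ 2 := by ring
  rw [h]
  refine (norm_sub_le _ _).trans ?_
  have h1 : ‖(k * (k - 1) : ℂ) / 2 * (z - 1) ^ 2‖ ≤ k ^ 2 / 2 * ‖z - 1‖ ^ 2 := by
    rw [norm_mul, norm_pow]
    refine mul_le_mul_of_nonneg_right ?_ (by positivity)
    rcases k with _ | k
    · simp
    · have : (((k + 1 : ℕ) : ℂ) * ((k + 1 : ℕ) - 1)) / 2 = (((k + 1) * k / 2 : ℝ) : ℂ) := by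
        push_cast; ring
      rw [this, Complex.norm_real, Real.norm_of_nonneg (by positivity)]
      push_cast
      nlinarith [(k.cast_nonneg : (0 : ℝ) ≤ k)]
  linarith [norm_pow_sub_linear_le hz k]

/-- This bound has the better order in z - 1 but needs a third moment of k;
`norm_pow_sub_quadratic_le` needs only a second moment. The minimum of the two is used. -/
lemma norm_pow_sub_quadratic_le_cube {z : ℂ} (hz : ‖z‖ ≤ 1) (k : ℕ) :
    ‖z ^ k - (1 + k * (z - 1) + (k * (k - 1) : ℂ) / 2 * (z - 1) ^ 2)‖ ≤ k ^ 3 * ‖z - 1‖ ^ 3 := by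
  induction k with
  | zero => simp
  | succ k ih =>
    have h : z ^ (k + 1) - (1 + (k + 1 : ℕ) * (z - 1)
          + ((k + 1 : ℕ) * ((k + 1 : ℕ) - 1) : ℂ) / 2 * (z - 1) ^ 2)
        = z * (z ^ k - (1 + k * (z - 1) + (k * (k - 1) : ℂ) / 2 * (z - 1) ^ 2))
          + (k * (k - 1) : ℂ) / 2 * (z - 1) ^ 3 := by push_cast; ring
    rw [h]
    refine (norm_add_le _ _).trans ?_
    have h1 : ‖(k * (k - 1) : ℂ) / 2 * (z - 1) ^ 3‖ ≤ k ^ 2 / 2 * ‖z - 1‖ ^ 3 := by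
      rw [norm_mul, norm_pow]
      refine mul_le_mul_of_nonneg_right ?_ (by positivity)
      rcases k with _ | k
      · simp
      · have : (((k + 1 : ℕ) : ℂ) * ((k + 1 : ℕ) - 1)) / 2 = (((k + 1) * k / 2 : ℝ) : ℂ) := by
          push_cast; ring
        rw [this, Complex.norm_real, Real.norm_of_nonneg (by positivity)]
        push_cast
        nlinarith [(k.cast_nonneg : (0 : ℝ) ≤ k)]
    rw [norm_mul]
    have h2 := mul_le_of_le_one_left (norm_nonneg
      (z ^ k - (1 + k * (z - 1) + (k * (k - 1) : ℂ) / 2 * (z - 1) ^ 2))) hz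
    have h3 : (0 : ℝ) ≤ ‖z - 1‖ ^ 3 := by positivity
    have h4 : (k : ℝ) ^ 3 + k ^ 2 / 2 ≤ ((k + 1 : ℕ) : ℝ) ^ 3 := by
      push_cast; nlinarith [(k.cast_nonneg : (0 : ℝ) ≤ k), sq_nonneg (k : ℝ)]
    calc _ ≤ ((k : ℝ) ^ 3 + k ^ 2 / 2) * ‖z - 1‖ ^ 3 := by linarith
      _ ≤ _ := mul_le_mul_of_nonneg_right h4 h3

/-- The relative error is at most E[min(N², N³ρ)] for |z - 1| ≤ ρ, which tends to 0 with ρ by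
dominated convergence with bound N². The coefficient b is the factorial moment E[N(N-1)]. -/
lemma hasQuadraticExpansion_integral_pow {Ω : Type*} [MeasurableSpace Ω] {P : Measure Ω}
    [IsProbabilityMeasure P] {N : Ω → ℕ} (hN : Measurable N)
    (hN2 : MemLp (fun ω => (N ω : ℝ)) 2 P) :
    HasQuadraticExpansion (fun z => ∫ ω, z ^ N ω ∂P) (∫ ω, (N ω : ℝ) ∂P)
      (variance (fun ω => (N ω : ℝ)) P + (∫ ω, (N ω : ℝ) ∂P) ^ 2 - ∫ ω, (N ω : ℝ) ∂P) := by
  have hNr : Measurable fun ω => (N ω : ℝ) := by fun_prop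
  have i1 : Integrable (fun ω => (N ω : ℝ)) P := hN2.integrable (by norm_num)
  have i2 : Integrable (fun ω => (N ω : ℝ) ^ 2) P := hN2.integrable_sq
  have hlim : Tendsto (fun ρ : ℝ => ∫ ω, min ((N ω : ℝ) ^ 2) ((N ω : ℝ) ^ 3 * ρ) ∂P) (𝓝[>] 0)
      (𝓝 0) := by
    rw [show (0 : ℝ) = ∫ ω, (0 : ℝ) ∂P by simp]
    refine tendsto_integral_filter_of_dominated_convergence (fun ω => (N ω : ℝ) ^ 2)
      (.of_forall fun ρ => by fun_prop) ?_ i2 (ae_of_all _ fun ω => ?_)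
    · filter_upwards [self_mem_nhdsWithin] with ρ hρ
      have hρ : (0 : ℝ) < ρ := by simpa using hρ
      refine ae_of_all _ fun ω => ?_
      rw [Real.norm_of_nonneg (by positivity)]
      exact min_le_left _ _
    · have : Continuous fun ρ : ℝ => min ((N ω : ℝ) ^ 2) ((N ω : ℝ) ^ 3 * ρ) := by fun_prop
      have h := this.tendsto 0
      simp only [mul_zero] at h
      rw [min_eq_right (by positivity)] at h
      simpa using h.mono_left nhdsWithin_le_nhds
  intro ε hε
  have hev := (hlim.eventually (gt_mem_nhds hε)).and self_mem_nhdsWithin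
  obtain ⟨ρ, hρ, hρ0⟩ := hev.exists
  have hρ0 : (0 : ℝ) < ρ := by simpa using hρ0
  refine ⟨ρ, hρ0, fun z hz hzρ => ?_⟩
  have hpow : Integrable (fun ω => z ^ N ω) P :=
    .of_bound (hN.const_pow z |>.aestronglyMeasurable) 1
      (ae_of_all _ fun ω => by rw [norm_pow]; exact pow_le_one₀ (norm_nonneg _) hz)
  have i1c : Integrable (fun ω => (N ω : ℂ)) P := by simpa using i1.ofReal (𝕜 := ℂ)
  have i2c : Integrable (fun ω => (N ω : ℂ) ^ 2) P := by simpa using i2.ofReal (𝕜 := ℂ)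
  have i3c : Integrable (fun ω => ((N ω * (N ω - 1) : ℂ)) / 2) P := by
    have := (i2c.sub i1c).div_const 2
    refine this.congr (ae_of_all _ fun ω => ?_)
    simp only [Pi.sub_apply]; ring
  have hq : Integrable (fun ω =>
      1 + (N ω : ℂ) * (z - 1) + ((N ω * (N ω - 1) : ℂ)) / 2 * (z - 1) ^ 2) P :=
    ((integrable_const _).add (i1c.mul_const _)).add (i3c.mul_const _)
  have e1 : ∫ ω, (N ω : ℂ) ∂P = ((∫ ω, (N ω : ℝ) ∂P : ℝ) : ℂ) := by
    rw [← integral_complex_ofReal]; simp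
  have e2 : ∫ ω, (N ω : ℂ) ^ 2 ∂P = ((∫ ω, (N ω : ℝ) ^ 2 ∂P : ℝ) : ℂ) := by
    rw [← integral_complex_ofReal]; simp
  have e3 : ∫ ω, ((N ω * (N ω - 1) : ℂ)) / 2 ∂P
      = ((∫ ω, (N ω : ℝ) ^ 2 ∂P : ℝ) - (∫ ω, (N ω : ℝ) ∂P : ℝ)) / 2 := by
    rw [← e1, ← e2, ← integral_sub i2c i1c, ← integral_div]
    congr 1; ext ω; ring
  have hval : ∫ ω, (1 + (N ω : ℂ) * (z - 1) + ((N ω * (N ω - 1) : ℂ)) / 2 * (z - 1) ^ 2) ∂P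
      = 1 + ((∫ ω, (N ω : ℝ) ∂P : ℝ) : ℂ) * (z - 1)
        + ((variance (fun ω => (N ω : ℝ)) P + (∫ ω, (N ω : ℝ) ∂P) ^ 2 - ∫ ω, (N ω : ℝ) ∂P : ℝ) : ℂ)
          / 2 * (z - 1) ^ 2 := by
    have j1 : Integrable (fun ω => 1 + (N ω : ℂ) * (z - 1)) P :=
      (integrable_const _).add (i1c.mul_const _)
    rw [integral_add j1 (i3c.mul_const _),
      integral_add (integrable_const _) (i1c.mul_const _), integral_mul_const, integral_mul_const,
      e1, e3, variance_eq_sub hN2]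
    simp
  rw [← hval, ← integral_sub hpow hq]
  calc _ ≤ ∫ ω, min ((N ω : ℝ) ^ 2) ((N ω : ℝ) ^ 3 * ρ) * ‖z - 1‖ ^ 2 ∂P := by
        refine norm_integral_le_of_norm_le ?_ (ae_of_all _ fun ω => ?_)
        · refine Integrable.mul_const (i2.mono' (by fun_prop) (ae_of_all _ fun ω => ?_)) _
          rw [Real.norm_of_nonneg (by positivity)]
          exact min_le_left _ _
        · rw [min_mul_of_nonneg _ _ (by positivity)]
          refine le_min (norm_pow_sub_quadratic_le hz _)
            ((norm_pow_sub_quadratic_le_cube hz _).trans ?_)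
          rw [mul_assoc]
          refine mul_le_mul_of_nonneg_left ?_ (by positivity)
          nlinarith [sq_nonneg ‖z - 1‖]
    _ = (∫ ω, min ((N ω : ℝ) ^ 2) ((N ω : ℝ) ^ 3 * ρ) ∂P) * ‖z - 1‖ ^ 2 := integral_mul_const _ _
    _ ≤ ε * ‖z - 1‖ ^ 2 := mul_le_mul_of_nonneg_right hρ.le (by positivity)

-- The deterministic core, with e, s, q standing for E h, E h², E|h| and Θ a bound of |h|. Every
-- error keeps a factor q, so that summation over sites is controlled by the sum of E|h_x|.
set_option maxHeartbeats 800000 in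
lemma norm_sub_exp_le_of_expansion {g ψ : ℂ} {e s q Θ d κ m σ b : ℝ} (hm : 0 ≤ m) (hd : 0 < d)
    (hd1 : d ≤ 1) (hb : b = σ ^ 2 + m ^ 2 - m) (heq : |e| ≤ q) (hq : q ≤ Θ) (hs : 0 ≤ s)
    (hs' : s ≤ Θ * q) (hκ : 0 ≤ κ)
    (h2 : ‖ψ - 1 - (d * e : ℝ) * Complex.I + (d ^ 2 * s / 2 : ℝ)‖ ≤ d ^ 3 * Θ ^ 2 * q)
    (h1 : ‖ψ - 1 - (d * e : ℝ) * Complex.I‖ ≤ d ^ 2 * Θ * q) (h0 : ‖ψ - 1‖ ≤ d * q)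
    (hg : ‖g - (1 + m * (ψ - 1) + b / 2 * (ψ - 1) ^ 2)‖ ≤ κ * ‖ψ - 1‖ ^ 2)
    (hdΘ : d * (Θ * (m + (2 * m + σ ^ 2) * Θ)) ≤ 1) :
    ‖g - Complex.exp ((d * m * e : ℝ) * Complex.I
        - (d ^ 2 / 2 * (m * (s - e ^ 2) + σ ^ 2 * e ^ 2) : ℝ))‖
      ≤ (κ * Θ + (m * Θ ^ 2 + |b| * Θ ^ 2 + Θ ^ 2 * (m + (2 * m + σ ^ 2) * Θ) ^ 3
        + (m * (2 * m + σ ^ 2) * Θ ^ 2 + (2 * m + σ ^ 2) ^ 2 * Θ ^ 3)) * d) * d ^ 2 * q := by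
  have hq0 : 0 ≤ q := (abs_nonneg e).trans heq
  have hΘ : 0 ≤ Θ := hq0.trans hq
  set C₁ := 2 * m + σ ^ 2 with hC₁
  have hC₁0 : 0 ≤ C₁ := by positivity
  set V := m * (s - e ^ 2) + σ ^ 2 * e ^ 2 with hV
  have he2 : e ^ 2 ≤ Θ * q := by
    rw [← sq_abs]; nlinarith [abs_nonneg e]
  have hVabs : |V| ≤ C₁ * (Θ * q) := by
    rw [abs_le]
    have a1 : m * s ≤ m * (Θ * q) := mul_le_mul_of_nonneg_left hs' hm
    have a2 : m * e ^ 2 ≤ m * (Θ * q) := mul_le_mul_of_nonneg_left he2 hm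
    have a3 : σ ^ 2 * e ^ 2 ≤ σ ^ 2 * (Θ * q) := mul_le_mul_of_nonneg_left he2 (sq_nonneg _)
    have a4 : 0 ≤ m * s := by positivity
    have a5 : 0 ≤ m * e ^ 2 := by positivity
    have a6 : 0 ≤ σ ^ 2 * e ^ 2 := by positivity
    have a7 : 0 ≤ m * (Θ * q) := by positivity
    have a8 : 0 ≤ σ ^ 2 * (Θ * q) := by positivity
    constructor <;> (simp only [hV, hC₁]; nlinarith)
  set C₂ := m + C₁ * Θ with hC₂
  have hC₂0 : 0 ≤ C₂ := by positivity
  set y : ℂ := (d * m * e : ℝ) * Complex.I - (d ^ 2 / 2 * V : ℝ) with hy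
  have hynorm : ‖y‖ ≤ d * q * C₂ := by
    refine (norm_sub_le _ _).trans ?_
    rw [norm_mul, Complex.norm_I, mul_one, Complex.norm_real, Complex.norm_real, Real.norm_eq_abs,
      Real.norm_eq_abs, abs_mul, abs_mul (d ^ 2 / 2), abs_of_nonneg (by positivity : 0 ≤ d * m),
      abs_of_nonneg (by positivity : 0 ≤ d ^ 2 / 2)]
    have b1 : d * m * |e| ≤ d * m * q := mul_le_mul_of_nonneg_left heq (by positivity)
    have b2 : d ^ 2 / 2 * |V| ≤ d * (C₁ * (Θ * q)) :=
      mul_le_mul (by nlinarith) hVabs (abs_nonneg _) hd.le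
    calc _ ≤ d * m * q + d * (C₁ * (Θ * q)) := add_le_add b1 b2
      _ = d * q * C₂ := by rw [hC₂]; ring
  have hy1 : ‖y‖ ≤ 1 := by
    refine hynorm.trans (le_trans ?_ hdΘ)
    rw [mul_assoc]
    exact mul_le_mul_of_nonneg_left (mul_le_mul_of_nonneg_right hq hC₂0) hd.le
  have t1 : ‖g - (1 + m * (ψ - 1) + b / 2 * (ψ - 1) ^ 2)‖ ≤ κ * Θ * d ^ 2 * q := by
    refine hg.trans ?_
    have c1 : ‖ψ - 1‖ ^ 2 ≤ (d * q) ^ 2 := pow_le_pow_left₀ (norm_nonneg _) h0 2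
    calc κ * ‖ψ - 1‖ ^ 2 ≤ κ * (d * q) ^ 2 := mul_le_mul_of_nonneg_left c1 hκ
      _ = κ * d ^ 2 * q * q := by ring
      _ ≤ κ * d ^ 2 * q * Θ := mul_le_mul_of_nonneg_left hq (by positivity)
      _ = _ := by ring
  have t3 : ‖(ψ - 1) ^ 2 - ((d * e : ℝ) * Complex.I) ^ 2‖ ≤ 2 * (d ^ 3 * Θ ^ 2 * q) := by
    have c1 : (ψ - 1) ^ 2 - ((d * e : ℝ) * Complex.I) ^ 2
        = (ψ - 1 - (d * e : ℝ) * Complex.I) * ((ψ - 1) + (d * e : ℝ) * Complex.I) := by ring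
    have c2 : ‖(ψ - 1) + (d * e : ℝ) * Complex.I‖ ≤ 2 * (d * Θ) := by
      refine (norm_add_le _ _).trans ?_
      rw [norm_mul, Complex.norm_I, mul_one, Complex.norm_real, Real.norm_eq_abs, abs_mul,
        abs_of_pos hd]
      have c3 : d * q ≤ d * Θ := mul_le_mul_of_nonneg_left hq hd.le
      have c4 : d * |e| ≤ d * Θ := mul_le_mul_of_nonneg_left (heq.trans hq) hd.le
      linarith
    rw [c1, norm_mul]
    calc _ ≤ d ^ 2 * Θ * q * (2 * (d * Θ)) :=
          mul_le_mul h1 c2 (norm_nonneg _) (by positivity)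
      _ = _ := by ring
  have t4 : ‖Complex.exp y - (1 + y + y ^ 2 / 2)‖ ≤ d ^ 3 * Θ ^ 2 * C₂ ^ 3 * q := by
    refine (Complex.norm_exp_sub_quadratic_le hy1).trans ?_
    have c1 : q ^ 2 ≤ Θ ^ 2 := pow_le_pow_left₀ hq0 hq 2
    calc ‖y‖ ^ 3 ≤ (d * q * C₂) ^ 3 := pow_le_pow_left₀ (norm_nonneg _) hynorm 3
      _ = d ^ 3 * q * C₂ ^ 3 * q ^ 2 := by ring
      _ ≤ d ^ 3 * q * C₂ ^ 3 * Θ ^ 2 := mul_le_mul_of_nonneg_left c1 (by positivity)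
      _ = _ := by ring
  have t5 : ‖y ^ 2 / 2 + (d ^ 2 * m ^ 2 * e ^ 2 / 2 : ℝ)‖
      ≤ d ^ 3 * (m * C₁ * Θ ^ 2 + C₁ ^ 2 * Θ ^ 3) * q := by
    have c1 : y ^ 2 / 2 + (d ^ 2 * m ^ 2 * e ^ 2 / 2 : ℝ)
        = ((d ^ 4 * V ^ 2 / 8 : ℝ) : ℂ) - (d ^ 3 * m * e * V / 2 : ℝ) * Complex.I := by
      rw [hy]; push_cast
      linear_combination (d ^ 2 * m ^ 2 * e ^ 2 / 2 : ℂ) * Complex.I_sq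
    rw [c1]
    refine (norm_sub_le _ _).trans ?_
    rw [norm_mul, Complex.norm_I, mul_one, Complex.norm_real, Complex.norm_real, Real.norm_eq_abs,
      Real.norm_eq_abs, abs_of_nonneg (by positivity : 0 ≤ d ^ 4 * V ^ 2 / 8)]
    have c2 : |d ^ 3 * m * e * V / 2| = d ^ 3 * m * |e| * |V| / 2 := by
      rw [abs_div, abs_mul, abs_mul, abs_of_nonneg (by positivity : 0 ≤ d ^ 3 * m)]; simp
    rw [c2]
    have c3 : |V| ≤ C₁ * (Θ * Θ) := hVabs.trans (by gcongr)
    have c4 : d ^ 3 * m * |e| * |V| ≤ d ^ 3 * m * q * (C₁ * (Θ * Θ)) := by gcongr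
    have c5 : V ^ 2 ≤ (C₁ * (Θ * q)) * (C₁ * (Θ * Θ)) := by
      rw [← sq_abs, sq]; exact mul_le_mul hVabs c3 (abs_nonneg _) (by positivity)
    have c6 : d ^ 4 * V ^ 2 ≤ d ^ 3 * ((C₁ * (Θ * q)) * (C₁ * (Θ * Θ))) := by
      refine mul_le_mul ?_ c5 (sq_nonneg _) (by positivity)
      calc d ^ 4 = d ^ 3 * d := by ring
        _ ≤ d ^ 3 * 1 := mul_le_mul_of_nonneg_left hd1 (by positivity)
        _ = d ^ 3 := mul_one _
    have c7 : 0 ≤ d ^ 3 * ((C₁ * (Θ * q)) * (C₁ * (Θ * Θ))) := by positivity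
    have c8 : 0 ≤ d ^ 3 * m * q * (C₁ * (Θ * Θ)) := by positivity
    have c9 : d ^ 3 * (m * C₁ * Θ ^ 2 + C₁ ^ 2 * Θ ^ 3) * q
        = d ^ 3 * m * q * (C₁ * (Θ * Θ)) + d ^ 3 * ((C₁ * (Θ * q)) * (C₁ * (Θ * Θ))) := by ring
    rw [c9]
    linarith
  -- The second-order terms match: m s + (σ² + m² - m) e² = V + m² e², and the last summand comes
  -- from the square of the phase.
  have split : g - Complex.exp y = (g - (1 + m * (ψ - 1) + b / 2 * (ψ - 1) ^ 2))
      + m * (ψ - 1 - (d * e : ℝ) * Complex.I + (d ^ 2 * s / 2 : ℝ))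
      + b / 2 * ((ψ - 1) ^ 2 - ((d * e : ℝ) * Complex.I) ^ 2)
      - (Complex.exp y - (1 + y + y ^ 2 / 2))
      - (y ^ 2 / 2 + (d ^ 2 * m ^ 2 * e ^ 2 / 2 : ℝ)) := by
    rw [hy, hb, hV]; push_cast
    linear_combination (((σ : ℂ) ^ 2 + m ^ 2 - m) / 2 * (d ^ 2 * e ^ 2 : ℂ)) * Complex.I_sq
  rw [split]
  have n2 : ‖(m : ℂ) * (ψ - 1 - (d * e : ℝ) * Complex.I + (d ^ 2 * s / 2 : ℝ))‖
      ≤ m * (d ^ 3 * Θ ^ 2 * q) := by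
    rw [norm_mul, Complex.norm_real, Real.norm_of_nonneg hm]
    exact mul_le_mul_of_nonneg_left h2 hm
  have n3 : ‖(b : ℂ) / 2 * ((ψ - 1) ^ 2 - ((d * e : ℝ) * Complex.I) ^ 2)‖
      ≤ |b| / 2 * (2 * (d ^ 3 * Θ ^ 2 * q)) := by
    rw [norm_mul, norm_div, Complex.norm_real, Real.norm_eq_abs]
    simp only [Complex.norm_ofNat]
    exact mul_le_mul_of_nonneg_left t3 (by positivity)
  refine (norm_sub_le _ _).trans ((add_le_add ((norm_sub_le _ _).trans (add_le_add
    (norm_add₃_le.trans (add_le_add (add_le_add t1 n2) n3)) t4)) t5).trans (le_of_eq ?_))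
  ring

/-- The generating function of the occupation number at the characteristic function of a bounded
weight is close to a Gaussian characteristic function. -/
lemma exists_norm_sub_exp_le {G : ℂ → ℂ} {m σ : ℝ} (hm : 0 ≤ m)
    (hG : HasQuadraticExpansion G m (σ ^ 2 + m ^ 2 - m)) {Θ : ℝ} (hΘ : 0 ≤ Θ) {Ω : Type*}
    [MeasurableSpace Ω] {ε : ℝ} (hε : 0 < ε) :
    ∃ δ₀ > 0, ∀ d : ℝ, 0 < d → d ≤ δ₀ → ∀ (μ : Measure Ω) [IsProbabilityMeasure μ] (h : Ω → ℝ),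
      Measurable h → (∀ ω, |h ω| ≤ Θ) →
      ‖G (∫ ω, Complex.exp ((d * h ω : ℝ) * Complex.I) ∂μ)
        - Complex.exp ((d * m * (∫ ω, h ω ∂μ) : ℝ) * Complex.I
          - (d ^ 2 / 2 * (m * ((∫ ω, h ω ^ 2 ∂μ) - (∫ ω, h ω ∂μ) ^ 2)
            + σ ^ 2 * (∫ ω, h ω ∂μ) ^ 2) : ℝ))‖ ≤ ε * d ^ 2 * ∫ ω, |h ω| ∂μ := by
  set b := σ ^ 2 + m ^ 2 - m with hb
  set C := m * Θ ^ 2 + |b| * Θ ^ 2 + Θ ^ 2 * (m + (2 * m + σ ^ 2) * Θ) ^ 3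
        + (m * (2 * m + σ ^ 2) * Θ ^ 2 + (2 * m + σ ^ 2) ^ 2 * Θ ^ 3) with hC
  have hC0 : 0 ≤ C := by positivity
  set κ := ε / (2 * (Θ + 1)) with hκ
  have hκ0 : 0 < κ := by positivity
  obtain ⟨ρ, hρ, hGρ⟩ := hG κ hκ0
  set D := Θ * (m + (2 * m + σ ^ 2) * Θ) with hD
  have hD0 : 0 ≤ D := by positivity
  -- In order: d ≤ 1; dΘ ≤ 1 for expanding the exponential of the weight; dΘ ≤ ρ for expanding G; dD
  -- ≤ 1 for expanding the Gaussian factor; dC ≤ ε/2 for the cubic errors.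
  refine ⟨min (min 1 (1 / (Θ + 1))) (min (min (ρ / (Θ + 1)) (1 / (D + 1))) (ε / (2 * (C + 1)))),
    by positivity, ?_⟩
  intro d hd hdle μ _ h hh hbd
  simp only [le_min_iff] at hdle
  obtain ⟨⟨d1, d2⟩, ⟨d3, d4⟩, d5⟩ := hdle
  rw [le_div_iff₀ (by positivity)] at d2 d3 d4 d5
  have hdΘ : d * Θ ≤ 1 := by linarith
  have i0 : ∀ {f : Ω → ℝ} {c : ℝ}, Measurable f → (∀ ω, |f ω| ≤ c) → Integrable f μ :=
    fun hf hc => .of_bound hf.aestronglyMeasurable _ (ae_of_all _ hc)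
  have ih : Integrable h μ := i0 hh hbd
  have ia : Integrable (fun ω => |h ω|) μ := ih.abs
  have hsq : ∀ ω, h ω ^ 2 ≤ Θ * |h ω| := fun ω => by
    rw [← sq_abs]; nlinarith [hbd ω, abs_nonneg (h ω)]
  have is : Integrable (fun ω => h ω ^ 2) μ :=
    (ia.const_mul Θ).mono' (by fun_prop) (ae_of_all _ fun ω => by
      rw [Real.norm_of_nonneg (sq_nonneg _)]; exact hsq ω)
  have ie : Integrable (fun ω => Complex.exp ((d * h ω : ℝ) * Complex.I)) μ :=
    integrable_exp_mul_I (hh.const_mul d).aestronglyMeasurable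
  have ihc : Integrable (fun ω => ((d * h ω : ℝ) : ℂ) * Complex.I) μ :=
    ((ih.const_mul d).ofReal).mul_const _
  have isc : Integrable (fun ω => ((d ^ 2 * h ω ^ 2 / 2 : ℝ) : ℂ)) μ :=
    ((is.const_mul (d ^ 2)).div_const 2).ofReal
  have nx : ∀ ω, ‖((d * h ω : ℝ) : ℂ) * Complex.I‖ = d * |h ω| := fun ω => by
    rw [norm_mul, Complex.norm_I, mul_one, Complex.norm_real, Real.norm_eq_abs, abs_mul,
      abs_of_pos hd]
  have nx1 : ∀ ω, ‖((d * h ω : ℝ) : ℂ) * Complex.I‖ ≤ 1 := fun ω => by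
    rw [nx]; exact (mul_le_mul_of_nonneg_left (hbd ω) hd.le).trans hdΘ
  have e1 : ∫ ω, ((d * h ω : ℝ) : ℂ) * Complex.I ∂μ = (d * ∫ ω, h ω ∂μ : ℝ) * Complex.I := by
    rw [integral_mul_const, integral_complex_ofReal, integral_const_mul]
  have e2 : ∫ ω, ((d ^ 2 * h ω ^ 2 / 2 : ℝ) : ℂ) ∂μ = (d ^ 2 * (∫ ω, h ω ^ 2 ∂μ) / 2 : ℝ) := by
    rw [integral_complex_ofReal, integral_div, integral_const_mul]
  have f0 : (∫ ω, Complex.exp ((d * h ω : ℝ) * Complex.I) ∂μ) - 1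
      = ∫ ω, (Complex.exp ((d * h ω : ℝ) * Complex.I) - 1) ∂μ := by
    rw [integral_sub ie (integrable_const _)]; simp
  have ie1 : Integrable (fun ω => Complex.exp ((d * h ω : ℝ) * Complex.I) - 1) μ :=
    ie.sub (integrable_const _)
  have ie2 : Integrable (fun ω => Complex.exp ((d * h ω : ℝ) * Complex.I) - 1
      - (d * h ω : ℝ) * Complex.I) μ := ie1.sub ihc
  have f1 : (∫ ω, Complex.exp ((d * h ω : ℝ) * Complex.I) ∂μ) - 1
        - (d * ∫ ω, h ω ∂μ : ℝ) * Complex.I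
      = ∫ ω, (Complex.exp ((d * h ω : ℝ) * Complex.I) - 1 - (d * h ω : ℝ) * Complex.I) ∂μ := by
    rw [integral_sub ie1 ihc, e1, ← f0]
  have f2 : (∫ ω, Complex.exp ((d * h ω : ℝ) * Complex.I) ∂μ) - 1
        - (d * ∫ ω, h ω ∂μ : ℝ) * Complex.I + (d ^ 2 * (∫ ω, h ω ^ 2 ∂μ) / 2 : ℝ)
      = ∫ ω, (Complex.exp ((d * h ω : ℝ) * Complex.I) - 1 - (d * h ω : ℝ) * Complex.I
          + (d ^ 2 * h ω ^ 2 / 2 : ℝ)) ∂μ := by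
    rw [integral_add ie2 isc, e2, ← f1]
  have hqΘ : ∫ ω, |h ω| ∂μ ≤ Θ := by
    calc ∫ ω, |h ω| ∂μ ≤ ∫ _, Θ ∂μ := integral_mono ia (integrable_const _) hbd
      _ = Θ := by simp
  have b0 : ‖(∫ ω, Complex.exp ((d * h ω : ℝ) * Complex.I) ∂μ) - 1‖ ≤ d * ∫ ω, |h ω| ∂μ := by
    rw [f0, ← integral_const_mul]
    refine norm_integral_le_of_norm_le (ia.const_mul d) (ae_of_all _ fun ω => ?_)
    have := norm_exp_mul_I_sub_le (d * h ω) 0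
    simpa [abs_mul, abs_of_pos hd] using this
  have key := norm_sub_exp_le_of_expansion (g := G (∫ ω, Complex.exp ((d * h ω : ℝ) * Complex.I) ∂μ))
    (ψ := ∫ ω, Complex.exp ((d * h ω : ℝ) * Complex.I) ∂μ) (e := ∫ ω, h ω ∂μ)
    (s := ∫ ω, h ω ^ 2 ∂μ) (q := ∫ ω, |h ω| ∂μ) (Θ := Θ) (d := d) (κ := κ) (m := m) (σ := σ) (b := b)
    hm hd d1 hb abs_integral_le_integral_abs hqΘ
    (integral_nonneg (f := fun ω => h ω ^ 2) fun _ => sq_nonneg _) ?_ hκ0.le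
    ?_ ?_ b0 ?_ ?_
  · refine key.trans ?_
    have hq0 : 0 ≤ ∫ ω, |h ω| ∂μ := integral_nonneg fun _ => abs_nonneg _
    refine mul_le_mul_of_nonneg_right (mul_le_mul_of_nonneg_right ?_ (sq_nonneg d)) hq0
    have k1 : κ * Θ ≤ ε / 2 := by
      rw [hκ, div_mul_eq_mul_div, div_le_div_iff₀ (by positivity) (by norm_num)]
      linarith
    have k2 : C * d ≤ ε / 2 := by linarith
    linarith
  · rw [← integral_const_mul]; exact integral_mono is (ia.const_mul Θ) hsq
  · rw [f2, ← integral_const_mul]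
    refine norm_integral_le_of_norm_le (ia.const_mul _) (ae_of_all _ fun ω => ?_)
    have := Complex.norm_exp_sub_quadratic_le (nx1 ω)
    have e3 : Complex.exp ((d * h ω : ℝ) * Complex.I) - 1 - (d * h ω : ℝ) * Complex.I
          + (d ^ 2 * h ω ^ 2 / 2 : ℝ) = Complex.exp ((d * h ω : ℝ) * Complex.I)
            - (1 + (d * h ω : ℝ) * Complex.I + ((d * h ω : ℝ) * Complex.I) ^ 2 / 2) := by
      push_cast
      linear_combination (d ^ 2 * h ω ^ 2 / 2 : ℂ) * Complex.I_sq
    rw [e3]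
    refine this.trans ?_
    rw [nx]
    have h2 : |h ω| ^ 2 ≤ Θ ^ 2 := pow_le_pow_left₀ (abs_nonneg _) (hbd ω) 2
    calc (d * |h ω|) ^ 3 = d ^ 3 * |h ω| * |h ω| ^ 2 := by ring
      _ ≤ d ^ 3 * |h ω| * Θ ^ 2 := mul_le_mul_of_nonneg_left h2 (by positivity)
      _ = _ := by ring
  · rw [f1, ← integral_const_mul]
    refine norm_integral_le_of_norm_le (ia.const_mul _) (ae_of_all _ fun ω => ?_)
    refine (Complex.norm_exp_sub_one_sub_id_le (nx1 ω)).trans ?_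
    rw [nx, mul_pow, mul_assoc, sq_abs]
    exact mul_le_mul_of_nonneg_left (hsq ω) (by positivity)
  · refine hGρ _ ?_ (b0.trans ?_)
    · refine (norm_integral_le_integral_norm _).trans ?_
      simp only [Complex.norm_exp_ofReal_mul_I]; simp
    · have : d * ∫ ω, |h ω| ∂μ ≤ d * Θ := mul_le_mul_of_nonneg_left hqΘ hd.le
      linarith
  · rw [← hD]; linarith

/-! ### Convergence of absolute moments. -/

lemma abs_integral_abs_sub_integral_min_le {Ω : Type*} [MeasurableSpace Ω] {Q : Measure Ω}
    [IsProbabilityMeasure Q] {f : Ω → ℝ} (hf : Measurable f)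
    (hf2 : Integrable (fun ω => f ω ^ 2) Q) {M : ℝ} (hM : 0 < M) :
    |∫ ω, |f ω| ∂Q - ∫ ω, min |f ω| M ∂Q| ≤ (∫ ω, f ω ^ 2 ∂Q) / M := by
  have j1 : Integrable f Q := ((memLp_two_iff_integrable_sq hf.aestronglyMeasurable).2
    hf2).integrable (by norm_num)
  have j2 : Integrable (fun ω => min |f ω| M) Q := j1.abs.mono' (by fun_prop)
    (ae_of_all _ fun ω => by
      rw [Real.norm_of_nonneg (le_min (abs_nonneg _) hM.le)]; exact min_le_left _ _)
  rw [← integral_sub j1.abs j2, ← integral_div]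
  refine (abs_integral_le_integral_abs).trans (integral_mono (j1.abs.sub j2).abs
    (hf2.div_const M) fun ω => ?_)
  simp only
  rw [le_div_iff₀ hM]
  rcases le_total |f ω| M with h | h
  · rw [min_eq_left h]; simp; positivity
  · rw [min_eq_right h, abs_of_nonneg (by linarith), ← sq_abs]
    nlinarith

/-- Convergence of characteristic functions to a Gaussian one and bounded second moments give
convergence of the absolute first moments. -/
lemma tendsto_integral_abs_gaussAbs {Ω : Type*} [MeasurableSpace Ω] {P : Measure Ω}
    [IsProbabilityMeasure P] {D : ℕ → Ω → ℝ} (hD : ∀ n, Measurable (D n)) {ρ : ℝ} {V : ℝ≥0}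
    (hc : ∀ u : ℝ, Tendsto (fun n => ∫ ω, Complex.exp ((u * D n ω : ℝ) * Complex.I) ∂P) atTop
      (𝓝 (Complex.exp (u * ρ * Complex.I - V * u ^ 2 / 2))))
    {C : ℝ} (hi : ∀ n, Integrable (fun ω => D n ω ^ 2) P)
    (hC : ∀ᶠ n in atTop, ∫ ω, D n ω ^ 2 ∂P ≤ C) :
    Tendsto (fun n => ∫ ω, |D n ω| ∂P) atTop (𝓝 (gaussAbs ρ V)) := by
  let μs : ℕ → ProbabilityMeasure ℝ := fun n =>
    ⟨P.map (D n), Measure.isProbabilityMeasure_map (hD n).aemeasurable⟩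
  let μ₀ : ProbabilityMeasure ℝ := ⟨gaussianReal ρ V, inferInstance⟩
  have hw : Tendsto μs atTop (𝓝 μ₀) := by
    rw [ProbabilityMeasure.tendsto_iff_tendsto_charFun]
    intro u
    change Tendsto (fun n => charFun (P.map (D n)) u) atTop (𝓝 (charFun (gaussianReal ρ V) u))
    rw [charFun_gaussianReal]
    exact (hc u).congr fun n => (charFun_map_eq_integral (hD n).aemeasurable u).symm
  rw [ProbabilityMeasure.tendsto_iff_forall_integral_tendsto] at hw
  have i0 : Integrable (fun x : ℝ => x ^ 2) (gaussianReal ρ V) :=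
    (memLp_id_gaussianReal (μ := ρ) (v := V) 2).integrable_sq
  set C' := max C (∫ x, x ^ 2 ∂gaussianReal ρ V) with hC'
  rw [Metric.tendsto_nhds]
  intro ε hε
  have hC0 : 0 ≤ C' := le_max_of_le_right (integral_nonneg fun _ => sq_nonneg _)
  -- Truncation at M costs at most C'/M ≤ ε/4 for `D n` and for the limit; ε/2 remains for the
  -- bounded continuous function.
  set M := 4 * (C' + 1) / ε with hM
  have hM0 : 0 < M := by positivity
  let g : BoundedContinuousFunction ℝ ℝ := BoundedContinuousFunction.ofNormedAddCommGroup
    (fun x => min |x| M) (by fun_prop) M (fun x => by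
      rw [Real.norm_of_nonneg (le_min (abs_nonneg _) hM0.le)]; exact min_le_right _ _)
  have hg := hw g
  have hg1 : ∀ n, ∫ x, g x ∂(μs n : Measure ℝ) = ∫ ω, min |D n ω| M ∂P := fun n =>
    integral_map (hD n).aemeasurable g.continuous.aestronglyMeasurable
  simp_rw [hg1] at hg
  have hg2 : ∫ x, g x ∂(μ₀ : Measure ℝ) = ∫ x, min |x| M ∂gaussianReal ρ V := rfl
  rw [hg2, Metric.tendsto_nhds] at hg
  have hCM : C' / M ≤ ε / 4 := by
    rw [hM, div_div_eq_mul_div, div_le_div_iff₀ (by positivity) (by norm_num)]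
    nlinarith
  filter_upwards [hg (ε / 2) (by positivity), hC] with n h1 h2
  have h3 := abs_integral_abs_sub_integral_min_le (hD n) (hi n) hM0
  have h4 := abs_integral_abs_sub_integral_min_le (f := fun x : ℝ => x) measurable_id i0 hM0
  have h5 : (∫ ω, D n ω ^ 2 ∂P) / M ≤ ε / 4 :=
    (div_le_div_of_nonneg_right (h2.trans (le_max_left _ _)) hM0.le).trans hCM
  have h6 : (∫ x, x ^ 2 ∂gaussianReal ρ V) / M ≤ ε / 4 :=
    (div_le_div_of_nonneg_right (le_max_right _ _) hM0.le).trans hCM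
  rw [Real.dist_eq] at h1 ⊢
  rw [gaussAbs]
  have h7 := abs_le.1 (h3.trans h5)
  have h8 := abs_le.1 (h4.trans h6)
  have h9 := abs_lt.1 h1
  rw [abs_lt]
  constructor <;> linarith [h7.1, h7.2, h8.1, h8.2, h9.1, h9.2]

/-! ### The central limit theorem for the walks. -/

section Step

variable (p : PMF ℤ)

/-- The law of the sequence of steps of a walk. -/
noncomputable def stepSeqLaw : Measure (ℕ → ℤ) := Measure.infinitePi fun _ => p.toMeasure

instance : IsProbabilityMeasure (stepSeqLaw p) :=
  inferInstanceAs (IsProbabilityMeasure (Measure.infinitePi _))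

lemma map_eval_stepSeqLaw (l : ℕ) : (stepSeqLaw p).map (fun ξ => ξ l) = p.toMeasure :=
  Measure.infinitePi_map_eval _ l

lemma iIndepFun_stepSeqLaw {f : ℕ → ℤ → ℝ} :
    iIndepFun (fun l (ξ : ℕ → ℤ) => f l (ξ l)) (stepSeqLaw p) :=
  iIndepFun_infinitePi fun _ => measurable_of_countable _

variable {p}

lemma exists_abs_le_of_support_finite (hp : p.support.Finite) :
    ∃ K : ℕ, ∀ᵐ x ∂p.toMeasure, |x| ≤ (K : ℤ) := by
  obtain ⟨K, hK⟩ := (hp.image fun x => x.natAbs).bddAbove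
  refine ⟨K, ?_⟩
  rw [ae_iff, PMF.toMeasure_apply_eq_zero_iff _ (Set.to_countable _).measurableSet,
    Set.disjoint_left]
  intro x hx h
  refine h ?_
  have := hK (Set.mem_image_of_mem _ hx)
  rw [Int.abs_eq_natAbs]
  exact_mod_cast this

lemma integrable_of_support_finite (hp : p.support.Finite) (f : ℤ → ℝ) :
    Integrable f p.toMeasure := by
  obtain ⟨C, hC⟩ := (hp.image fun x => |f x|).bddAbove
  refine .of_bound (measurable_of_countable f).aestronglyMeasurable C ?_
  rw [ae_iff, PMF.toMeasure_apply_eq_zero_iff _ (Set.to_countable _).measurableSet,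
    Set.disjoint_left]
  intro x hx h
  exact h (hC (Set.mem_image_of_mem _ hx))

lemma integral_step (hp : p.support.Finite) : ∫ x, (x : ℝ) ∂p.toMeasure = stepMean p := by
  rw [PMF.integral_eq_tsum _ _ (integrable_of_support_finite hp _), stepMean]
  congr 1; ext x; rw [smul_eq_mul, mul_comm]

lemma integral_step_sub (hp : p.support.Finite) :
    ∫ x, ((x : ℝ) - stepMean p) ∂p.toMeasure = 0 := by
  rw [integral_sub (integrable_of_support_finite hp _) (integrable_const _), integral_step hp]
  simp

lemma integral_step_sub_sq (hp : p.support.Finite) :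
    ∫ x, ((x : ℝ) - stepMean p) ^ 2 ∂p.toMeasure = stepVar p := by
  rw [PMF.integral_eq_tsum _ _ (integrable_of_support_finite hp _)]
  change _ = ∑' x : ℤ, _
  congr 1; ext x; rw [smul_eq_mul, mul_comm]

/-- The characteristic function of a centred step. -/
noncomputable def stepCharFun (p : PMF ℤ) (u : ℝ) : ℂ :=
  ∫ x, Complex.exp ((u * ((x : ℝ) - stepMean p) : ℝ) * Complex.I) ∂p.toMeasure

lemma norm_stepCharFun_le (u : ℝ) : ‖stepCharFun p u‖ ≤ 1 := by
  refine (norm_integral_le_integral_norm _).trans ?_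
  simp only [Complex.norm_exp_ofReal_mul_I]; simp

/-- The expansion made for the particle system also yields the central limit theorem: take G = id, m
= 1, σ = 0 and the centred step as weight. -/
lemma exists_norm_stepCharFun_sub_le (hp : p.support.Finite) (u : ℝ) {ε : ℝ} (hε : 0 < ε) :
    ∃ δ₀ > 0, ∀ d : ℝ, 0 < d → d ≤ δ₀ →
      ‖stepCharFun p (d * u) - Complex.exp (-(d ^ 2 / 2 * (u ^ 2 * stepVar p) : ℝ))‖
        ≤ ε * d ^ 2 := by
  obtain ⟨K, hK⟩ := exists_abs_le_of_support_finite hp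
  have hG : HasQuadraticExpansion id 1 ((0 : ℝ) ^ 2 + 1 ^ 2 - 1) := fun ε hε =>
    ⟨1, one_pos, fun z _ _ => by simp; positivity⟩
  set Θ := |u| * (K + |stepMean p|) with hΘ
  have hΘ0 : 0 ≤ Θ := by positivity
  obtain ⟨δ₀, hδ, h⟩ := exists_norm_sub_exp_le (zero_le_one) hG hΘ0 (Ω := ℤ)
    (ε := ε / (Θ + 1)) (by positivity)
  refine ⟨δ₀, hδ, fun d hd hd' => ?_⟩
  -- The weight has to be bounded everywhere and not only on the support, hence the truncation.
  let f : ℤ → ℝ := fun x => if |x| ≤ (K : ℤ) then u * ((x : ℝ) - stepMean p) else 0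
  have hf : ∀ᵐ x ∂p.toMeasure, f x = u * ((x : ℝ) - stepMean p) := by
    filter_upwards [hK] with x hx
    simp [f, hx]
  have hfΘ : ∀ x, |f x| ≤ Θ := by
    intro x
    by_cases hx : |x| ≤ (K : ℤ)
    · simp only [f, hx, if_true, abs_mul, hΘ]
      refine mul_le_mul_of_nonneg_left ((abs_sub _ _).trans ?_) (abs_nonneg _)
      have : |(x : ℝ)| ≤ K := by exact_mod_cast hx
      linarith
    · simp [f, hx, hΘ0]
  have hfm : Measurable f := measurable_of_countable f
  have key := h d hd hd' p.toMeasure f hfm hfΘ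
  have k1 : ∫ x, f x ∂p.toMeasure = 0 := by
    rw [integral_congr_ae hf, integral_const_mul, integral_step_sub hp, mul_zero]
  have k2 : ∫ x, f x ^ 2 ∂p.toMeasure = u ^ 2 * stepVar p := by
    rw [← integral_step_sub_sq hp, ← integral_const_mul]
    refine integral_congr_ae ?_
    filter_upwards [hf] with x hx
    rw [hx, mul_pow]
  have k3 : ∫ x, Complex.exp ((d * f x : ℝ) * Complex.I) ∂p.toMeasure = stepCharFun p (d * u) := by
    refine integral_congr_ae ?_
    filter_upwards [hf] with x hx
    rw [hx, mul_assoc]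
  have k4 : ∫ x, |f x| ∂p.toMeasure ≤ Θ := by
    calc ∫ x, |f x| ∂p.toMeasure ≤ ∫ _, Θ ∂p.toMeasure :=
          integral_mono (integrable_of_support_finite hp _) (integrable_const _) hfΘ
      _ = Θ := by simp
  rw [k1, k2, k3] at key
  simp only [id, mul_zero, Complex.ofReal_zero, zero_mul, zero_sub, one_mul, sub_zero, add_zero,
    ne_eq, OfNat.ofNat_ne_zero, not_false_eq_true, zero_pow] at key
  refine key.trans ?_
  rw [div_mul_eq_mul_div, div_mul_eq_mul_div, div_le_iff₀ (by positivity)]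
  exact mul_le_mul_of_nonneg_left (by linarith) (by positivity)

/-- Each of the k(n) = O(n) factors differs from its Gaussian counterpart by at most a small
multiple of 1/n. -/
lemma tendsto_stepCharFun_pow (hp : p.support.Finite) (u : ℝ) {k : ℕ → ℕ} {τ : ℝ}
    (hk : Tendsto (fun n => (k n : ℝ) / n) atTop (𝓝 τ)) :
    Tendsto (fun n : ℕ => stepCharFun p (u / √n) ^ k n) atTop
      (𝓝 (Complex.exp (-(τ * stepVar p * u ^ 2 / 2 : ℝ)))) := by
  have h1 : Tendsto (fun n : ℕ => Complex.exp (-((k n : ℝ) / n * stepVar p * u ^ 2 / 2 : ℝ))) atTop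
      (𝓝 (Complex.exp (-(τ * stepVar p * u ^ 2 / 2 : ℝ)))) := by
    have : Continuous fun x : ℝ => Complex.exp (-(x * stepVar p * u ^ 2 / 2 : ℝ)) := by fun_prop
    exact (this.tendsto τ).comp hk
  refine tendsto_of_tendsto_of_dist h1 ?_
  rw [Metric.tendsto_nhds]
  intro ε hε
  have hτ : 0 ≤ τ := ge_of_tendsto' hk fun n => by positivity
  obtain ⟨δ₀, hδ, h⟩ := exists_norm_stepCharFun_sub_le hp u (ε := ε / (2 * (τ + 1))) (by positivity)
  have hs : Tendsto (fun n : ℕ => 1 / √(n : ℝ)) atTop (𝓝 0) := by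
    simp_rw [one_div]
    exact tendsto_inv_atTop_zero.comp
      (Real.tendsto_sqrt_atTop.comp tendsto_natCast_atTop_atTop)
  filter_upwards [hs.eventually (gt_mem_nhds hδ), hk.eventually (gt_mem_nhds (lt_add_one τ)),
    eventually_gt_atTop 0] with n hn1 hn2 hn3
  have hn : (0 : ℝ) < n := by exact_mod_cast hn3
  have hsn : 0 < √(n : ℝ) := Real.sqrt_pos.2 hn
  have hb := h (1 / √n) (by positivity) hn1.le
  have e1 : Complex.exp (-((k n : ℝ) / n * stepVar p * u ^ 2 / 2 : ℝ))
      = Complex.exp (-((1 / √(n : ℝ)) ^ 2 / 2 * (u ^ 2 * stepVar p) : ℝ)) ^ k n := by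
    rw [← Complex.exp_nat_mul]
    congr 1
    rw [div_pow, Real.sq_sqrt hn.le]
    push_cast; ring
  have e2 : ‖Complex.exp (-((1 / √(n : ℝ)) ^ 2 / 2 * (u ^ 2 * stepVar p) : ℝ))‖ ≤ 1 := by
    rw [← Complex.ofReal_neg, ← Complex.ofReal_exp, Complex.norm_real,
      Real.norm_of_nonneg (Real.exp_pos _).le, Real.exp_le_one_iff, neg_nonpos]
    positivity
  have hb' := norm_pow_sub_pow_le_mul (norm_stepCharFun_le (p := p) (1 / √n * u)) e2 (k n)
  rw [Real.dist_eq, sub_zero, abs_of_nonneg dist_nonneg, dist_comm, dist_eq_norm, e1,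
    show u / √(n : ℝ) = 1 / √n * u by ring]
  refine (hb'.trans (mul_le_mul_of_nonneg_left hb (Nat.cast_nonneg _))).trans_lt ?_
  rw [div_pow, Real.sq_sqrt hn.le]
  calc (k n : ℝ) * (ε / (2 * (τ + 1)) * (1 ^ 2 / n)) = (k n / n) * (ε / (2 * (τ + 1))) := by ring
    _ ≤ (τ + 1) * (ε / (2 * (τ + 1))) := mul_le_mul_of_nonneg_right hn2.le (by positivity)
    _ = ε / 2 := by field_simp
    _ < ε := by linarith

end Step

section BlockSum

variable (p : PMF ℤ)

/-- The sum of the centred steps with indices in `I`. -/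
noncomputable def centredSum (I : Finset ℕ) (ξ : ℕ → ℤ) : ℝ := ∑ l ∈ I, ((ξ l : ℝ) - stepMean p)

lemma measurable_centredSum (I : Finset ℕ) : Measurable (centredSum p I) := by
  unfold centredSum
  refine Finset.measurable_fun_sum _ fun l _ => Measurable.sub_const ?_ _
  exact (measurable_of_countable (fun x : ℤ => (x : ℝ))).comp (measurable_pi_apply l)

lemma measurable_centredStep (l : ℕ) : Measurable fun ξ : ℕ → ℤ => (ξ l : ℝ) - stepMean p :=
  (measurable_of_countable (fun x : ℤ => (x : ℝ) - stepMean p)).comp (measurable_pi_apply l)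

lemma integral_comp_eval_stepSeqLaw {E : Type*} [NormedAddCommGroup E] [NormedSpace ℝ E]
    [MeasurableSpace E] [BorelSpace E] [SecondCountableTopology E] (f : ℤ → E) (l : ℕ) :
    ∫ ξ, f (ξ l) ∂stepSeqLaw p = ∫ x, f x ∂p.toMeasure := by
  rw [← map_eval_stepSeqLaw p l, integral_map (measurable_pi_apply l).aemeasurable
    (measurable_of_countable f).aestronglyMeasurable]

lemma integral_exp_centredSum (I : Finset ℕ) (u : ℝ) :
    ∫ ξ, Complex.exp ((u * centredSum p I ξ : ℝ) * Complex.I) ∂stepSeqLaw p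
      = stepCharFun p u ^ I.card := by
  rw [← charFun_map_eq_integral (measurable_centredSum p I).aemeasurable]
  have h := iIndepFun.charFun_map_fun_finsetSum_eq_prod (s := I)
    (X := fun l (ξ : ℕ → ℤ) => (ξ l : ℝ) - stepMean p) (P := stepSeqLaw p)
    (fun l _ => (measurable_centredStep p l).aemeasurable)
    ((iIndepFun_stepSeqLaw p (f := fun _ x => (x : ℝ) - stepMean p)).restrict I)
  have h' := congrFun h u
  refine h'.trans ?_
  rw [Finset.prod_apply]
  refine (Finset.prod_congr rfl fun l _ => ?_).trans (Finset.prod_const _)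
  rw [charFun_map_eq_integral (measurable_centredStep p l).aemeasurable]
  exact integral_comp_eval_stepSeqLaw p
    (fun x : ℤ => Complex.exp ((u * ((x : ℝ) - stepMean p) : ℝ) * Complex.I)) l

variable {p}

lemma memLp_centredStep (hp : p.support.Finite) (l : ℕ) :
    MemLp (fun ξ : ℕ → ℤ => (ξ l : ℝ) - stepMean p) 2 (stepSeqLaw p) := by
  rw [memLp_two_iff_integrable_sq (measurable_centredStep p l).aestronglyMeasurable]
  have h := integrable_of_support_finite hp fun x => ((x : ℝ) - stepMean p) ^ 2
  rw [← map_eval_stepSeqLaw p l] at h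
  exact h.comp_measurable (measurable_pi_apply l)

lemma memLp_centredSum (hp : p.support.Finite) (I : Finset ℕ) :
    MemLp (centredSum p I) 2 (stepSeqLaw p) :=
  memLp_finsetSum _ fun l _ => memLp_centredStep hp l

lemma integral_centredStep (hp : p.support.Finite) (l : ℕ) :
    ∫ ξ, ((ξ l : ℝ) - stepMean p) ∂stepSeqLaw p = 0 := by
  rw [integral_comp_eval_stepSeqLaw p (fun x : ℤ => (x : ℝ) - stepMean p), integral_step_sub hp]

lemma integral_centredSum_sq (hp : p.support.Finite) (I : Finset ℕ) :
    ∫ ξ, centredSum p I ξ ^ 2 ∂stepSeqLaw p = I.card * stepVar p := by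
  have h0 : ∫ ξ, centredSum p I ξ ∂stepSeqLaw p = 0 := by
    unfold centredSum
    rw [integral_finsetSum _ fun l _ => (memLp_centredStep hp l).integrable (by norm_num)]
    exact Finset.sum_eq_zero fun l _ => integral_centredStep hp l
  rw [← variance_of_integral_eq_zero (measurable_centredSum p I).aemeasurable h0]
  have hv := IndepFun.variance_sum (μ := stepSeqLaw p) (s := I)
    (X := fun l (ξ : ℕ → ℤ) => (ξ l : ℝ) - stepMean p) (fun l _ => memLp_centredStep hp l)
    (fun i _ j _ hij => (iIndepFun_stepSeqLaw p (f := fun _ x => (x : ℝ) - stepMean p)).indepFun hij)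
  have e : centredSum p I = ∑ l ∈ I, fun ξ : ℕ → ℤ => (ξ l : ℝ) - stepMean p := by
    ext ξ; simp [centredSum]
  rw [e, hv]
  refine (Finset.sum_congr rfl fun l _ => ?_).trans (by rw [Finset.sum_const, nsmul_eq_mul])
  rw [variance_of_integral_eq_zero (measurable_centredStep p l).aemeasurable
    (integral_centredStep hp l), integral_comp_eval_stepSeqLaw p
    (fun x : ℤ => ((x : ℝ) - stepMean p) ^ 2), integral_step_sub_sq hp]

/-- The limit of the mean distance of two independent walks. -/
lemma tendsto_integral_abs_centredSum (hp : p.support.Finite) {c : ℕ → ℝ} {I J : ℕ → Finset ℕ}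
    {ρ : ℝ} {τ τ' : ℝ≥0} (hc : Tendsto (fun n => c n / √n) atTop (𝓝 ρ))
    (hI : Tendsto (fun n => ((I n).card : ℝ) / n) atTop (𝓝 τ))
    (hJ : Tendsto (fun n => ((J n).card : ℝ) / n) atTop (𝓝 τ')) :
    Tendsto (fun n : ℕ => (∫ ξ, |c n - centredSum p (I n) ξ.1 + centredSum p (J n) ξ.2|
      ∂(stepSeqLaw p).prod (stepSeqLaw p)) / √n) atTop (𝓝 (gaussAbs ρ (stepVar p * (τ + τ')))) := by
  -- Two independent blocks of steps. An empty block reduces this to a single walk, and a block of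
  -- indices between two times to an increment of one walk.
  let D : ℕ → (ℕ → ℤ) × (ℕ → ℤ) → ℝ := fun n ξ =>
    (c n - centredSum p (I n) ξ.1 + centredSum p (J n) ξ.2) / √n
  have m1 : ∀ n, Measurable fun ξ : (ℕ → ℤ) × (ℕ → ℤ) => centredSum p (I n) ξ.1 := fun n =>
    (measurable_centredSum p _).comp measurable_fst
  have m2 : ∀ n, Measurable fun ξ : (ℕ → ℤ) × (ℕ → ℤ) => centredSum p (J n) ξ.2 := fun n =>
    (measurable_centredSum p _).comp measurable_snd
  have hD : ∀ n, Measurable (D n) := fun n => (((m1 n).const_sub (c n)).add (m2 n)).div_const _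
  have l1 : ∀ n, MemLp (fun ξ : (ℕ → ℤ) × (ℕ → ℤ) => centredSum p (I n) ξ.1) 2
      ((stepSeqLaw p).prod (stepSeqLaw p)) := fun n => (memLp_centredSum hp (I n)).comp_fst _
  have l2 : ∀ n, MemLp (fun ξ : (ℕ → ℤ) × (ℕ → ℤ) => centredSum p (J n) ξ.2) 2
      ((stepSeqLaw p).prod (stepSeqLaw p)) := fun n => (memLp_centredSum hp (J n)).comp_snd _
  have lD : ∀ n, MemLp (D n) 2 ((stepSeqLaw p).prod (stepSeqLaw p)) := fun n => by
    have := (((memLp_const (c n)).sub (l1 n)).add (l2 n)).const_mul (√(n : ℝ))⁻¹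
    refine this.congr_norm (hD n).aestronglyMeasurable (ae_of_all _ fun ξ => ?_)
    simp only [D, Pi.add_apply, Pi.sub_apply]
    rw [div_eq_inv_mul]
  have hDabs : ∀ n, (∫ ξ, |c n - centredSum p (I n) ξ.1 + centredSum p (J n) ξ.2|
      ∂(stepSeqLaw p).prod (stepSeqLaw p)) / √n
      = ∫ ξ, |D n ξ| ∂(stepSeqLaw p).prod (stepSeqLaw p) := fun n => by
    rw [← integral_div]
    congr 1; ext ξ
    simp only [D]
    rw [abs_div, abs_of_nonneg (Real.sqrt_nonneg _)]
  simp_rw [hDabs]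
  have hsq : ∀ n, ∫ ξ, D n ξ ^ 2 ∂(stepSeqLaw p).prod (stepSeqLaw p)
      ≤ 3 * ((c n / √n) ^ 2 + ((I n).card : ℝ) / n * stepVar p
        + ((J n).card : ℝ) / n * stepVar p) := by
    intro n
    have e1 : ∫ ξ, centredSum p (I n) ξ.1 ^ 2 ∂(stepSeqLaw p).prod (stepSeqLaw p)
        = (I n).card * stepVar p := by
      rw [← integral_centredSum_sq hp]
      exact (integral_fun_fst (fun ξ => centredSum p (I n) ξ ^ 2)).trans (by simp)
    have e2 : ∫ ξ, centredSum p (J n) ξ.2 ^ 2 ∂(stepSeqLaw p).prod (stepSeqLaw p)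
        = (J n).card * stepVar p := by
      rw [← integral_centredSum_sq hp]
      exact (integral_fun_snd (fun ξ => centredSum p (J n) ξ ^ 2)).trans (by simp)
    have i1 := (l1 n).integrable_sq
    have i2 := (l2 n).integrable_sq
    calc ∫ ξ, D n ξ ^ 2 ∂(stepSeqLaw p).prod (stepSeqLaw p)
        ≤ ∫ ξ, 3 * ((c n / √n) ^ 2 + centredSum p (I n) ξ.1 ^ 2 / n
          + centredSum p (J n) ξ.2 ^ 2 / n) ∂(stepSeqLaw p).prod (stepSeqLaw p) := by
          refine integral_mono (lD n).integrable_sq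
            ((((integrable_const _).add (i1.div_const _)).add (i2.div_const _)).const_mul 3)
            fun ξ => ?_
          simp only [D, div_pow, Real.sq_sqrt (n.cast_nonneg : (0 : ℝ) ≤ n)]
          rw [← add_div, ← add_div, ← mul_div_assoc]
          refine div_le_div_of_nonneg_right ?_ (Nat.cast_nonneg n)
          nlinarith [sq_nonneg (c n + centredSum p (I n) ξ.1),
            sq_nonneg (c n - centredSum p (J n) ξ.2),
            sq_nonneg (centredSum p (I n) ξ.1 + centredSum p (J n) ξ.2)]
      _ = _ := by
          have j1 : Integrable (fun ξ : (ℕ → ℤ) × (ℕ → ℤ) => (c n / √n) ^ 2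
              + centredSum p (I n) ξ.1 ^ 2 / n) ((stepSeqLaw p).prod (stepSeqLaw p)) :=
            (integrable_const _).add (i1.div_const _)
          rw [integral_const_mul, integral_add j1 (i2.div_const _),
            integral_add (integrable_const _) (i1.div_const _), integral_div, integral_div, e1, e2]
          simp; ring
  have hb : Tendsto (fun n => 3 * ((c n / √n) ^ 2 + ((I n).card : ℝ) / n * stepVar p
        + ((J n).card : ℝ) / n * stepVar p)) atTop
      (𝓝 (3 * (ρ ^ 2 + τ * stepVar p + τ' * stepVar p))) :=
    (((hc.pow 2).add (hI.mul_const _)).add (hJ.mul_const _)).const_mul 3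
  refine tendsto_integral_abs_gaussAbs hD (fun u => ?_) (fun n => (lD n).integrable_sq)
    (C := 3 * (ρ ^ 2 + τ * stepVar p + τ' * stepVar p) + 1)
    ((hb.eventually (gt_mem_nhds (lt_add_one _))).mono fun n hn => (hsq n).trans hn.le)
  have hchar : ∀ n : ℕ, ∫ ξ, Complex.exp ((u * D n ξ : ℝ) * Complex.I)
        ∂(stepSeqLaw p).prod (stepSeqLaw p)
      = Complex.exp ((u * (c n / √n) : ℝ) * Complex.I)
        * (stepCharFun p (-u / √n) ^ (I n).card * stepCharFun p (u / √n) ^ (J n).card) := by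
    intro n
    rw [← integral_exp_centredSum, ← integral_exp_centredSum, ← integral_prod_mul,
      ← integral_const_mul]
    congr 1; ext ξ
    rw [← Complex.exp_add, ← Complex.exp_add]
    congr 1
    simp only [D]
    push_cast
    ring
  simp_rw [hchar]
  have t0 : Tendsto (fun n : ℕ => Complex.exp ((u * (c n / √n) : ℝ) * Complex.I)) atTop
      (𝓝 (Complex.exp ((u * ρ : ℝ) * Complex.I))) := by
    have : Continuous fun x : ℝ => Complex.exp ((u * x : ℝ) * Complex.I) := by fun_prop
    exact (this.tendsto ρ).comp hc
  have t := t0.mul ((tendsto_stepCharFun_pow hp (-u) hI).mul (tendsto_stepCharFun_pow hp u hJ))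
  convert! t using 2
  rw [← Complex.exp_add, ← Complex.exp_add]
  congr 1
  push_cast
  ring

end BlockSum

/-! ### Counting crossings. -/

/-- The contribution to the current of a particle that starts at `x` and ends to the right of the
observer if and only if `α < x`. -/
def crossing (α x : ℤ) : ℝ := (if α < x then 1 else 0) - (if 0 < x then 1 else 0)

lemma abs_crossing_le (α x : ℤ) : |crossing α x| ≤ 1 := by
  unfold crossing; split_ifs <;> simp

lemma abs_crossing (α x : ℤ) : |crossing α x| = crossing α x ^ 2 := by
  unfold crossing; split_ifs <;> simp

lemma crossing_eq_zero {α x : ℤ} {N : ℕ} (hα : |α| ≤ N) (hx : x ∉ Finset.Icc (-(N : ℤ)) N) :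
    crossing α x = 0 := by
  rw [abs_le] at hα
  rw [Finset.mem_Icc, not_and_or, not_le, not_le] at hx
  unfold crossing
  split_ifs <;> first | (exfalso; omega) | simp

lemma sum_sq_indicator_sub {α β : ℤ} {N : ℕ} (hα : |α| ≤ N) (hβ : |β| ≤ N) :
    ∑ x ∈ Finset.Icc (-(N : ℤ)) N, ((if α < x then (1 : ℝ) else 0) - (if β < x then 1 else 0)) ^ 2
      = |(α : ℝ) - β| := by
  wlog h : α ≤ β generalizing α β
  · rw [abs_sub_comm, ← this hβ hα (le_of_not_ge h)]
    exact Finset.sum_congr rfl fun x _ => by ring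
  rw [abs_le] at hα hβ
  have h1 : ∀ x : ℤ, ((if α < x then (1 : ℝ) else 0) - (if β < x then 1 else 0)) ^ 2
      = if x ∈ Finset.Ioc α β then 1 else 0 := by
    intro x
    simp only [Finset.mem_Ioc]
    split_ifs <;> first | (exfalso; omega) | simp
  simp_rw [h1]
  rw [Finset.sum_ite_mem, Finset.inter_eq_right.2, Finset.sum_const, Int.card_Ioc, nsmul_eq_mul,
    mul_one]
  · have : ((β - α).toNat : ℝ) = ((β - α : ℤ) : ℝ) := by
      exact_mod_cast congrArg (Int.cast (R := ℝ)) (Int.toNat_of_nonneg (sub_nonneg.2 h))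
    rw [this, abs_sub_comm, abs_of_nonneg (by simpa using h)]
    push_cast; ring
  · intro x hx
    rw [Finset.mem_Ioc] at hx
    rw [Finset.mem_Icc]
    omega

/-- Polarisation: the squared difference of two indicators, summed over x, counts the integers
between α and β. This is where the covariance of two-sided Brownian motion enters on the particle
side. -/
lemma sum_crossing_mul {α β : ℤ} {N : ℕ} (hα : |α| ≤ N) (hβ : |β| ≤ N) :
    ∑ x ∈ Finset.Icc (-(N : ℤ)) N, crossing α x * crossing β x
      = (|(α : ℝ)| + |(β : ℝ)| - |(α : ℝ) - β|) / 2 := by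
  have h0 : |(0 : ℤ)| ≤ N := by simp
  have e1 := sum_sq_indicator_sub hα h0
  have e2 := sum_sq_indicator_sub hβ h0
  have e3 := sum_sq_indicator_sub hα hβ
  simp only [Int.cast_zero, sub_zero] at e1 e2
  rw [← e1, ← e2, ← e3, ← Finset.sum_add_distrib, ← Finset.sum_sub_distrib, Finset.sum_div]
  refine Finset.sum_congr rfl fun x _ => ?_
  unfold crossing
  ring

lemma sum_abs_crossing {α : ℤ} {N : ℕ} (hα : |α| ≤ N) :
    ∑ x ∈ Finset.Icc (-(N : ℤ)) N, |crossing α x| = |(α : ℝ)| := by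
  have := sum_crossing_mul hα hα
  simp only [sub_self, abs_zero, sub_zero, add_self_div_two] at this
  rw [← this]
  exact Finset.sum_congr rfl fun x _ => by rw [abs_crossing, sq]

/-! ### Back positions and their scaling limits. -/

section BackPosition

variable (p : PMF ℤ)

/-- The number of steps made until time `n t`. -/
noncomputable def timeIndex (n : ℕ) (t : ℝ≥0) : ℕ := ⌊(n : ℝ≥0) * t⌋₊

/-- The starting points `x` of the particles with steps `ξ` that end up to the right of the observer
are those with `backPosition < x`. -/
noncomputable def backPosition (n : ℕ) (a : ℝ≥0 × ℝ) (ξ : ℕ → ℤ) : ℤ :=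
  ⌊observer (stepMean p) n a.1 a.2⌋ - ∑ j ∈ Finset.range (timeIndex n a.1), ξ j

/-- The mean of `backPosition`. -/
noncomputable def backCentre (n : ℕ) (a : ℝ≥0 × ℝ) : ℝ :=
  ⌊observer (stepMean p) n a.1 a.2⌋ - timeIndex n a.1 * stepMean p

lemma backPosition_lt_iff (n : ℕ) (a : ℝ≥0 × ℝ) (ξ : ℕ → ℤ) (x : ℤ) :
    backPosition p n a ξ < x ↔ observer (stepMean p) n a.1 a.2
      < ((x + ∑ j ∈ Finset.range (timeIndex n a.1), ξ j : ℤ) : ℝ) := by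
  rw [← Int.floor_lt, backPosition, sub_lt_iff_lt_add]

lemma cast_backPosition (n : ℕ) (a : ℝ≥0 × ℝ) (ξ : ℕ → ℤ) :
    (backPosition p n a ξ : ℝ)
      = backCentre p n a - centredSum p (Finset.range (timeIndex n a.1)) ξ := by
  simp [backPosition, backCentre, centredSum]

lemma measurable_backPosition (n : ℕ) (a : ℝ≥0 × ℝ) : Measurable (backPosition p n a) := by
  unfold backPosition
  exact (Finset.measurable_fun_sum _ fun j _ => measurable_pi_apply j).const_sub _

lemma tendsto_timeIndex_div (t : ℝ≥0) :
    Tendsto (fun n => (timeIndex n t : ℝ) / n) atTop (𝓝 t) := by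
  have h := (tendsto_nat_floor_mul_div_atTop (R := ℝ) (a := (t : ℝ)) t.coe_nonneg).comp tendsto_natCast_atTop_atTop
  refine h.congr fun n => ?_
  simp only [Function.comp, timeIndex]
  congr 2
  rw [mul_comm, ← NNReal.coe_natCast, ← NNReal.coe_mul]
  rfl

lemma tendsto_backCentre_div (a : ℝ≥0 × ℝ) :
    Tendsto (fun n => backCentre p n a / √n) atTop (𝓝 a.2) := by
  set v := stepMean p
  -- The floor of the observer and the floor in its definition cost at most 1 each; replacing nt by
  -- its floor in the drift costs at most |v|.
  have hs : Tendsto (fun n : ℕ => (2 + |v|) * (√(n : ℝ))⁻¹) atTop (𝓝 0) := by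
    have h := (tendsto_inv_atTop_zero.comp
      (Real.tendsto_sqrt_atTop.comp tendsto_natCast_atTop_atTop)).const_mul (2 + |v|)
    rwa [mul_zero] at h
  rw [tendsto_iff_dist_tendsto_zero]
  refine squeeze_zero' (.of_forall fun _ => dist_nonneg) ?_ hs
  filter_upwards [eventually_gt_atTop 0] with n hn
  have hn : (0 : ℝ) < n := by exact_mod_cast hn
  have hsn : 0 < √(n : ℝ) := Real.sqrt_pos.2 hn
  rw [Real.dist_eq, div_sub' hsn.ne', abs_div, abs_of_pos hsn, div_eq_mul_inv]
  refine mul_le_mul_of_nonneg_right ?_ (by positivity)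
  have h1 := Int.floor_le (observer v n a.1 a.2)
  have h2 := Int.lt_floor_add_one (observer v n a.1 a.2)
  have h3 := Int.floor_le ((n : ℝ) * a.1 * v)
  have h4 := Int.lt_floor_add_one ((n : ℝ) * a.1 * v)
  have h5 : (timeIndex n a.1 : ℝ) ≤ n * a.1 := by
    exact_mod_cast Nat.floor_le (zero_le : 0 ≤ (n : ℝ≥0) * a.1)
  have h6 : (n : ℝ) * a.1 < timeIndex n a.1 + 1 := by
    exact_mod_cast Nat.lt_floor_add_one ((n : ℝ≥0) * a.1)
  have h7 : |(n : ℝ) * a.1 * v - timeIndex n a.1 * v| ≤ |v| := by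
    rw [← sub_mul, abs_mul]
    refine mul_le_of_le_one_left (abs_nonneg _) ?_
    rw [abs_le]; constructor <;> linarith
  rw [abs_le] at h7
  have ho : observer v n a.1 a.2 = (⌊(n : ℝ) * a.1 * v⌋ : ℝ) + a.2 * √(n : ℝ) := rfl
  rw [ho] at h1 h2
  rw [backCentre, abs_le, ho]
  constructor <;> linarith [h7.1, h7.2]

variable {p}

/-- For independent walks the step counts add, which gives the variance at t + s. -/
lemma tendsto_integral_abs_backPosition_indep (hp : p.support.Finite) (a b : ℝ≥0 × ℝ) :
    Tendsto (fun n : ℕ => (∫ ξ, |(backPosition p n a ξ.1 : ℝ) - backPosition p n b ξ.2|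
      ∂(stepSeqLaw p).prod (stepSeqLaw p)) / √n) atTop
      (𝓝 (gaussAbs (b.2 - a.2) (stepVar p * (b.1 + a.1)))) := by
  have hc : Tendsto (fun n => (backCentre p n a - backCentre p n b) / √n) atTop
      (𝓝 (a.2 - b.2)) := by
    simp_rw [sub_div]
    exact (tendsto_backCentre_div p a).sub (tendsto_backCentre_div p b)
  have h := tendsto_integral_abs_centredSum hp (I := fun n => Finset.range (timeIndex n a.1))
    (J := fun n => Finset.range (timeIndex n b.1)) hc
    (by simpa using tendsto_timeIndex_div a.1) (by simpa using tendsto_timeIndex_div b.1)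
  rw [← gaussAbs_neg, neg_sub, add_comm b.1]
  refine h.congr fun n => ?_
  congr 2; ext ξ
  rw [cast_backPosition, cast_backPosition]
  congr 1; ring

lemma tendsto_integral_abs_backPosition (hp : p.support.Finite) (a : ℝ≥0 × ℝ) :
    Tendsto (fun n : ℕ => (∫ ξ, |(backPosition p n a ξ : ℝ)| ∂stepSeqLaw p) / √n) atTop
      (𝓝 (gaussAbs a.2 (stepVar p * a.1))) := by
  have h := tendsto_integral_abs_centredSum hp (I := fun n => Finset.range (timeIndex n a.1))
    (J := fun _ => ∅) (τ' := 0) (tendsto_backCentre_div p a)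
    (by simpa using tendsto_timeIndex_div a.1) (by simp)
  rw [add_zero] at h
  refine h.congr fun n => ?_
  congr 1
  have := integral_fun_fst (μ := stepSeqLaw p) (ν := stepSeqLaw p)
    (fun ξ => |(backPosition p n a ξ : ℝ)|)
  simp only [probReal_univ, one_smul] at this
  rw [← this]
  congr 1; ext ξ
  rw [cast_backPosition]
  simp [centredSum]

/-- For one walk seen at two times the common steps cancel; about n|t - s| steps remain. -/
lemma tendsto_integral_abs_backPosition_sub (hp : p.support.Finite) (a b : ℝ≥0 × ℝ) :
    Tendsto (fun n : ℕ => (∫ ξ, |(backPosition p n a ξ : ℝ) - backPosition p n b ξ|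
      ∂stepSeqLaw p) / √n) atTop
      (𝓝 (gaussAbs (b.2 - a.2) (stepVar p * nndist b.1 a.1))) := by
  wlog hab : a.1 ≤ b.1 generalizing a b
  · rw [nndist_comm, ← gaussAbs_neg, neg_sub]
    simp_rw [abs_sub_comm (backPosition p _ a _ : ℝ)]
    exact this b a (le_of_not_ge hab)
  have hmono : ∀ n, timeIndex n a.1 ≤ timeIndex n b.1 := fun n =>
    Nat.floor_mono (mul_le_mul_of_nonneg_left hab zero_le)
  have hc : Tendsto (fun n => (backCentre p n a - backCentre p n b) / √n) atTop
      (𝓝 (a.2 - b.2)) := by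
    simp_rw [sub_div]
    exact (tendsto_backCentre_div p a).sub (tendsto_backCentre_div p b)
  have hJ : Tendsto (fun n => ((Finset.Ico (timeIndex n a.1) (timeIndex n b.1)).card : ℝ) / n)
      atTop (𝓝 (nndist b.1 a.1 : ℝ≥0)) := by
    have hab' : (a.1 : ℝ) ≤ b.1 := by exact_mod_cast hab
    rw [coe_nndist, NNReal.dist_eq, abs_of_nonneg (by linarith)]
    refine ((tendsto_timeIndex_div b.1).sub (tendsto_timeIndex_div a.1)).congr fun n => ?_
    rw [Nat.card_Ico, Nat.cast_sub (hmono n), sub_div]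
  have h := tendsto_integral_abs_centredSum hp (I := fun _ => ∅) (τ := 0)
    (J := fun n => Finset.Ico (timeIndex n a.1) (timeIndex n b.1)) hc (by simp) hJ
  rw [zero_add] at h
  rw [← gaussAbs_neg, neg_sub]
  refine h.congr fun n => ?_
  congr 1
  have := integral_fun_snd (μ := stepSeqLaw p) (ν := stepSeqLaw p)
    (fun ξ => |(backPosition p n a ξ : ℝ) - backPosition p n b ξ|)
  simp only [probReal_univ, one_smul] at this
  rw [← this]
  congr 1; ext ξ
  rw [cast_backPosition, cast_backPosition]
  have e : centredSum p (Finset.range (timeIndex n b.1)) ξ.2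
      = centredSum p (Finset.range (timeIndex n a.1)) ξ.2
        + centredSum p (Finset.Ico (timeIndex n a.1) (timeIndex n b.1)) ξ.2 :=
    (Finset.sum_range_add_sum_Ico _ (hmono n)).symm
  rw [e]
  simp [centredSum]
  congr 1; ring

end BackPosition

/-! ### Weights of particles and their moments. -/

section Weight

/-- Steps of bounded size give a deterministic window of starting points outside which no particle
counts, so that all sums over x become finite. -/
lemma exists_ae_abs_backPosition_le {p : PMF ℤ} (hp : p.support.Finite) {k : ℕ}
    (a : Fin k → ℝ≥0 × ℝ) (n : ℕ) :
    ∃ N : ℕ, ∀ᵐ ξ ∂stepSeqLaw p, ∀ i, |backPosition p n (a i) ξ| ≤ N := by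
  obtain ⟨K, hK⟩ := exists_abs_le_of_support_finite hp
  have hξ : ∀ᵐ ξ ∂stepSeqLaw p, ∀ l, |ξ l| ≤ (K : ℤ) := by
    rw [ae_all_iff]
    intro l
    rw [← map_eval_stepSeqLaw p l] at hK
    exact ae_of_ae_map (measurable_pi_apply l).aemeasurable hK
  refine ⟨∑ i, (⌊observer (stepMean p) n (a i).1 (a i).2⌋.natAbs + timeIndex n (a i).1 * K), ?_⟩
  filter_upwards [hξ] with ξ h i
  have h1 : |backPosition p n (a i) ξ|
      ≤ ((⌊observer (stepMean p) n (a i).1 (a i).2⌋.natAbs + timeIndex n (a i).1 * K : ℕ) : ℤ) := by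
    refine (abs_sub _ _).trans ?_
    push_cast
    refine add_le_add le_rfl ((Finset.abs_sum_le_sum_abs _ _).trans ?_)
    refine (Finset.sum_le_sum fun j _ => h j).trans ?_
    simp
  refine h1.trans ?_
  exact_mod_cast Finset.single_le_sum (f := fun i =>
    ⌊observer (stepMean p) n (a i).1 (a i).2⌋.natAbs + timeIndex n (a i).1 * K)
    (fun _ _ => Nat.zero_le _) (Finset.mem_univ i)

variable (p : PMF ℤ) {k : ℕ} (a : Fin k → ℝ≥0 × ℝ) (θ : Fin k → ℝ)

/-- The contribution of a particle to a linear combination of currents. -/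
noncomputable def crossWeight (n : ℕ) (x : ℤ) (ξ : ℕ → ℤ) : ℝ :=
  ∑ i, θ i * crossing (backPosition p n (a i) ξ) x

lemma measurable_crossing_backPosition (n : ℕ) (b : ℝ≥0 × ℝ) (x : ℤ) :
    Measurable fun ξ => crossing (backPosition p n b ξ) x :=
  (measurable_of_countable fun α : ℤ => crossing α x).comp (measurable_backPosition p n b)

lemma measurable_crossWeight (n : ℕ) (x : ℤ) : Measurable (crossWeight p a θ n x) :=
  Finset.measurable_fun_sum _ fun i _ => (measurable_crossing_backPosition p n (a i) x).const_mul _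

lemma abs_crossWeight_le (n : ℕ) (x : ℤ) (ξ : ℕ → ℤ) : |crossWeight p a θ n x ξ| ≤ ∑ i, |θ i| := by
  refine (Finset.abs_sum_le_sum_abs _ _).trans (Finset.sum_le_sum fun i _ => ?_)
  rw [abs_mul]
  exact mul_le_of_le_one_right (abs_nonneg _) (abs_crossing_le _ _)

lemma integrable_crossing (n : ℕ) (b : ℝ≥0 × ℝ) (x : ℤ) :
    Integrable (fun ξ => crossing (backPosition p n b ξ) x) (stepSeqLaw p) :=
  .of_bound (measurable_crossing_backPosition p n b x).aestronglyMeasurable 1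
    (ae_of_all _ fun _ => abs_crossing_le _ _)

lemma integrable_crossing_mul (n : ℕ) (b b' : ℝ≥0 × ℝ) (x : ℤ) :
    Integrable (fun ξ => crossing (backPosition p n b ξ) x * crossing (backPosition p n b' ξ) x)
      (stepSeqLaw p) :=
  (integrable_crossing p n b x).mul_bdd (c := 1)
    (measurable_crossing_backPosition p n b' x).aestronglyMeasurable
    (ae_of_all _ fun _ => abs_crossing_le _ _)

variable {p}

lemma integrable_backPosition (hp : p.support.Finite) (n : ℕ) (b : ℝ≥0 × ℝ) :
    Integrable (fun ξ => (backPosition p n b ξ : ℝ)) (stepSeqLaw p) := by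
  simp_rw [cast_backPosition]
  exact (integrable_const _).sub ((memLp_centredSum hp _).integrable (by norm_num))

lemma sum_integral_crossing_mul {n N : ℕ} {b b' : ℝ≥0 × ℝ}
    (hb : ∀ᵐ ξ ∂stepSeqLaw p, |backPosition p n b ξ| ≤ N)
    (hb' : ∀ᵐ ξ ∂stepSeqLaw p, |backPosition p n b' ξ| ≤ N) :
    ∑ x ∈ Finset.Icc (-(N : ℤ)) N,
        ∫ ξ, crossing (backPosition p n b ξ) x * crossing (backPosition p n b' ξ) x ∂stepSeqLaw p
      = ∫ ξ, (|(backPosition p n b ξ : ℝ)| + |(backPosition p n b' ξ : ℝ)|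
          - |(backPosition p n b ξ : ℝ) - backPosition p n b' ξ|) / 2 ∂stepSeqLaw p := by
  rw [← integral_finsetSum _ fun x _ => integrable_crossing_mul p n b b' x]
  refine integral_congr_ae ?_
  filter_upwards [hb, hb'] with ξ h h'
  exact sum_crossing_mul h h'

lemma sum_integral_mul_integral_crossing {n N : ℕ} {b b' : ℝ≥0 × ℝ}
    (hb : ∀ᵐ ξ ∂stepSeqLaw p, |backPosition p n b ξ| ≤ N)
    (hb' : ∀ᵐ ξ ∂stepSeqLaw p, |backPosition p n b' ξ| ≤ N) :
    ∑ x ∈ Finset.Icc (-(N : ℤ)) N, (∫ ξ, crossing (backPosition p n b ξ) x ∂stepSeqLaw p)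
        * ∫ ξ, crossing (backPosition p n b' ξ) x ∂stepSeqLaw p
      = ∫ ξ, (|(backPosition p n b ξ.1 : ℝ)| + |(backPosition p n b' ξ.2 : ℝ)|
          - |(backPosition p n b ξ.1 : ℝ) - backPosition p n b' ξ.2|) / 2
          ∂(stepSeqLaw p).prod (stepSeqLaw p) := by
  simp_rw [← integral_prod_mul]
  rw [← integral_finsetSum _ fun x _ =>
    (integrable_crossing p n b x).mul_prod (integrable_crossing p n b' x)]
  refine integral_congr_ae ?_
  filter_upwards [Measure.quasiMeasurePreserving_fst.ae hb,
    Measure.quasiMeasurePreserving_snd.ae hb'] with ξ h h'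
  exact sum_crossing_mul h h'

/-- Only |α| sites have a nonzero crossing, and E|α| is of order √n. This bound absorbs the errors
of all factors of the characteristic function. -/
lemma sum_integral_abs_crossWeight_le (hp : p.support.Finite) {n N : ℕ}
    (hN : ∀ᵐ ξ ∂stepSeqLaw p, ∀ i, |backPosition p n (a i) ξ| ≤ N) :
    ∑ x ∈ Finset.Icc (-(N : ℤ)) N, ∫ ξ, |crossWeight p a θ n x ξ| ∂stepSeqLaw p
      ≤ ∑ i, |θ i| * ∫ ξ, |(backPosition p n (a i) ξ : ℝ)| ∂stepSeqLaw p := by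
  have i1 : ∀ x, Integrable (fun ξ => |crossWeight p a θ n x ξ|) (stepSeqLaw p) := fun x =>
    .of_bound (measurable_crossWeight p a θ n x).abs.aestronglyMeasurable (∑ i, |θ i|)
      (ae_of_all _ fun ξ => by simpa using abs_crossWeight_le p a θ n x ξ)
  have i2 : ∀ i, Integrable (fun ξ => |θ i| * |(backPosition p n (a i) ξ : ℝ)|) (stepSeqLaw p) :=
    fun i => (integrable_backPosition hp n (a i)).abs.const_mul _
  rw [← integral_finsetSum _ fun x _ => i1 x]
  simp_rw [← integral_const_mul]
  rw [← integral_finsetSum _ fun i _ => i2 i]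
  refine integral_mono_ae (integrable_finsetSum _ fun x _ => i1 x)
    (integrable_finsetSum _ fun i _ => i2 i) ?_
  filter_upwards [hN] with ξ h
  calc ∑ x ∈ Finset.Icc (-(N : ℤ)) N, |crossWeight p a θ n x ξ|
      ≤ ∑ x ∈ Finset.Icc (-(N : ℤ)) N, ∑ i, |θ i| * |crossing (backPosition p n (a i) ξ) x| :=
        Finset.sum_le_sum fun x _ => (Finset.abs_sum_le_sum_abs _ _).trans
          (Finset.sum_le_sum fun i _ => (abs_mul _ _).le)
    _ = ∑ i, |θ i| * |(backPosition p n (a i) ξ : ℝ)| := by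
        rw [Finset.sum_comm]
        refine Finset.sum_congr rfl fun i _ => ?_
        rw [← Finset.mul_sum, sum_abs_crossing (h i)]

lemma integral_crossWeight (n : ℕ) (x : ℤ) :
    ∫ ξ, crossWeight p a θ n x ξ ∂stepSeqLaw p
      = ∑ i, θ i * ∫ ξ, crossing (backPosition p n (a i) ξ) x ∂stepSeqLaw p := by
  unfold crossWeight
  rw [integral_finsetSum _ fun i _ => (integrable_crossing p n (a i) x).const_mul _]
  simp_rw [integral_const_mul]

lemma sum_integral_crossWeight_sq (n N : ℕ) :
    ∑ x ∈ Finset.Icc (-(N : ℤ)) N, ∫ ξ, crossWeight p a θ n x ξ ^ 2 ∂stepSeqLaw p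
      = ∑ i, ∑ j, θ i * θ j * ∑ x ∈ Finset.Icc (-(N : ℤ)) N,
        ∫ ξ, crossing (backPosition p n (a i) ξ) x * crossing (backPosition p n (a j) ξ) x
          ∂stepSeqLaw p := by
  have h : ∀ x, ∫ ξ, crossWeight p a θ n x ξ ^ 2 ∂stepSeqLaw p
      = ∑ i, ∑ j, θ i * θ j *
        ∫ ξ, crossing (backPosition p n (a i) ξ) x * crossing (backPosition p n (a j) ξ) x
          ∂stepSeqLaw p := by
    intro x
    simp_rw [← integral_const_mul]
    have i1 : ∀ i j, Integrable (fun ξ => θ i * θ j * (crossing (backPosition p n (a i) ξ) x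
        * crossing (backPosition p n (a j) ξ) x)) (stepSeqLaw p) := fun i j =>
      (integrable_crossing_mul p n (a i) (a j) x).const_mul _
    simp_rw [← fun i => integral_finsetSum Finset.univ fun j _ => i1 i j]
    rw [← integral_finsetSum _ fun i _ => integrable_finsetSum _ fun j _ => i1 i j]
    congr 1; ext ξ
    rw [crossWeight, sq, Finset.sum_mul_sum]
    exact Finset.sum_congr rfl fun i _ => Finset.sum_congr rfl fun j _ => by ring
  simp_rw [h, Finset.mul_sum]
  rw [Finset.sum_comm]
  exact Finset.sum_congr rfl fun i _ => Finset.sum_comm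

lemma sum_sq_integral_crossWeight (n N : ℕ) :
    ∑ x ∈ Finset.Icc (-(N : ℤ)) N, (∫ ξ, crossWeight p a θ n x ξ ∂stepSeqLaw p) ^ 2
      = ∑ i, ∑ j, θ i * θ j * ∑ x ∈ Finset.Icc (-(N : ℤ)) N,
        (∫ ξ, crossing (backPosition p n (a i) ξ) x ∂stepSeqLaw p)
          * ∫ ξ, crossing (backPosition p n (a j) ξ) x ∂stepSeqLaw p := by
  simp_rw [integral_crossWeight, sq, Finset.sum_mul_sum, Finset.mul_sum]
  rw [Finset.sum_comm]
  refine Finset.sum_congr rfl fun i _ => ?_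
  rw [Finset.sum_comm]
  exact Finset.sum_congr rfl fun j _ => Finset.sum_congr rfl fun x _ => by ring

/-- One walk for both crossings: the terms at variance w(t+s) cancel in Γ₁ + Γ₂ and the one at
w|t-s| stays. -/
lemma tendsto_sum_integral_crossing_mul (hp : p.support.Finite) {N : ℕ → ℕ} {b b' : ℝ≥0 × ℝ}
    (hb : ∀ n, ∀ᵐ ξ ∂stepSeqLaw p, |backPosition p n b ξ| ≤ N n)
    (hb' : ∀ n, ∀ᵐ ξ ∂stepSeqLaw p, |backPosition p n b' ξ| ≤ N n) :
    Tendsto (fun n : ℕ => (∑ x ∈ Finset.Icc (-(N n : ℤ)) (N n),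
        ∫ ξ, crossing (backPosition p n b ξ) x * crossing (backPosition p n b' ξ) x ∂stepSeqLaw p)
        / √n) atTop (𝓝 (covDyn (stepVar p) b b' + covInit (stepVar p) b b')) := by
  have h := (((tendsto_integral_abs_backPosition hp b).add
    (tendsto_integral_abs_backPosition hp b')).sub
    (tendsto_integral_abs_backPosition_sub hp b b')).div_const 2
  have e : covDyn (stepVar p) b b' + covInit (stepVar p) b b'
      = (gaussAbs b.2 (stepVar p * b.1) + gaussAbs b'.2 (stepVar p * b'.1)
        - gaussAbs (b'.2 - b.2) (stepVar p * nndist b'.1 b.1)) / 2 := by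
    rw [covDyn, covInit, gaussPsi_eq, gaussPsi_eq, gaussPsi_eq, gaussPsi_eq, gaussAbs_neg]
    ring
  rw [e]
  refine h.congr fun n => ?_
  have i1 := (integrable_backPosition hp n b)
  have i2 := (integrable_backPosition hp n b')
  have s1 : Integrable (fun ξ => |(backPosition p n b ξ : ℝ)| + |(backPosition p n b' ξ : ℝ)|)
    (stepSeqLaw p) := i1.abs.add i2.abs
  have s2 : Integrable (fun ξ => |(backPosition p n b ξ : ℝ) - backPosition p n b' ξ|)
    (stepSeqLaw p) := (i1.sub i2).abs
  rw [sum_integral_crossing_mul (hb n) (hb' n), integral_div,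
    integral_sub s1 s2, integral_add i1.abs i2.abs]
  ring

/-- A product of expectations is an expectation over two independent walks, so the variance is
w(t+s) and Γ₂ alone appears. -/
lemma tendsto_sum_integral_mul_integral_crossing (hp : p.support.Finite) {N : ℕ → ℕ}
    {b b' : ℝ≥0 × ℝ} (hb : ∀ n, ∀ᵐ ξ ∂stepSeqLaw p, |backPosition p n b ξ| ≤ N n)
    (hb' : ∀ n, ∀ᵐ ξ ∂stepSeqLaw p, |backPosition p n b' ξ| ≤ N n) :
    Tendsto (fun n : ℕ => (∑ x ∈ Finset.Icc (-(N n : ℤ)) (N n),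
        (∫ ξ, crossing (backPosition p n b ξ) x ∂stepSeqLaw p)
          * ∫ ξ, crossing (backPosition p n b' ξ) x ∂stepSeqLaw p)
        / √n) atTop (𝓝 (covInit (stepVar p) b b')) := by
  have h := (((tendsto_integral_abs_backPosition hp b).add
    (tendsto_integral_abs_backPosition hp b')).sub
    (tendsto_integral_abs_backPosition_indep hp b b')).div_const 2
  have e : covInit (stepVar p) b b'
      = (gaussAbs b.2 (stepVar p * b.1) + gaussAbs b'.2 (stepVar p * b'.1)
        - gaussAbs (b'.2 - b.2) (stepVar p * (b'.1 + b.1))) / 2 := by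
    rw [covInit, gaussPsi_eq, gaussPsi_eq, gaussPsi_eq, gaussAbs_neg]
    ring
  rw [e]
  refine h.congr fun n => ?_
  have i1 := (integrable_backPosition hp n b)
  have i2 := (integrable_backPosition hp n b')
  have j1 := i1.comp_fst (stepSeqLaw p)
  have j2 := i2.comp_snd (stepSeqLaw p)
  have s1 : Integrable (fun ξ : (ℕ → ℤ) × (ℕ → ℤ) => |(backPosition p n b ξ.1 : ℝ)|
    + |(backPosition p n b' ξ.2 : ℝ)|) ((stepSeqLaw p).prod (stepSeqLaw p)) := j1.abs.add j2.abs
  have s2 : Integrable (fun ξ : (ℕ → ℤ) × (ℕ → ℤ) => |(backPosition p n b ξ.1 : ℝ)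
    - backPosition p n b' ξ.2|) ((stepSeqLaw p).prod (stepSeqLaw p)) := (j1.sub j2).abs
  rw [sum_integral_mul_integral_crossing (hb n) (hb' n), integral_div,
    integral_sub s1 s2, integral_add j1.abs j2.abs,
    integral_fun_fst (fun ξ => |(backPosition p n b ξ : ℝ)|),
    integral_fun_snd (fun ξ => |(backPosition p n b' ξ : ℝ)|)]
  simp only [probReal_univ, one_smul]
  ring

end Weight

lemma rpow_neg_quarter_sq (n : ℕ) : ((n : ℝ) ^ (-(1 / 4) : ℝ)) ^ 2 = 1 / √(n : ℝ) := by
  rw [← Real.rpow_natCast, ← Real.rpow_mul n.cast_nonneg, Real.sqrt_eq_rpow, one_div, one_div,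
    ← Real.rpow_neg n.cast_nonneg]
  norm_num

lemma tendsto_rpow_neg_quarter : Tendsto (fun n : ℕ => (n : ℝ) ^ (-(1 / 4) : ℝ)) atTop (𝓝 0) :=
  (tendsto_rpow_neg_atTop (by norm_num)).comp tendsto_natCast_atTop_atTop

/-! ### Limit of the product of characteristic functions. -/

section CharFunLimit

variable {p : PMF ℤ} {k : ℕ} (a : Fin k → ℝ≥0 × ℝ) (θ : Fin k → ℝ)

/-- The variance contributed by the particles that start at `x` to a linear combination of
currents. -/
noncomputable def siteVariance (p : PMF ℤ) (m σ : ℝ) (n : ℕ) (x : ℤ) : ℝ :=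
  m * ((∫ ξ, crossWeight p a θ n x ξ ^ 2 ∂stepSeqLaw p)
    - (∫ ξ, crossWeight p a θ n x ξ ∂stepSeqLaw p) ^ 2)
    + σ ^ 2 * (∫ ξ, crossWeight p a θ n x ξ ∂stepSeqLaw p) ^ 2

lemma siteVariance_nonneg {m : ℝ} (hm : 0 ≤ m) (σ : ℝ) (n : ℕ) (x : ℤ) :
    0 ≤ siteVariance a θ p m σ n x := by
  have hL : MemLp (crossWeight p a θ n x) 2 (stepSeqLaw p) :=
    .of_bound (measurable_crossWeight p a θ n x).aestronglyMeasurable (∑ i, |θ i|)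
      (ae_of_all _ fun ξ => abs_crossWeight_le p a θ n x ξ)
  have := variance_nonneg (crossWeight p a θ n x) (stepSeqLaw p)
  rw [variance_eq_sub hL] at this
  exact add_nonneg (mul_nonneg hm this) (by positivity)

/-- Regroup the site variance as m E[h²] + (σ² - m)(E h)². The limit is then m(Γ₁ + Γ₂) + (σ² -
m)Γ₂. -/
lemma tendsto_sum_siteVariance (hp : p.support.Finite) (m σ : ℝ) {N : ℕ → ℕ}
    (hN : ∀ n, ∀ᵐ ξ ∂stepSeqLaw p, ∀ i, |backPosition p n (a i) ξ| ≤ N n) :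
    Tendsto (fun n : ℕ => (∑ x ∈ Finset.Icc (-(N n : ℤ)) (N n), siteVariance a θ p m σ n x) / √n)
      atTop (𝓝 (∑ i, ∑ j, θ i * θ j
        * (m * covDyn (stepVar p) (a i) (a j) + σ ^ 2 * covInit (stepVar p) (a i) (a j)))) := by
  have hNi : ∀ i, ∀ n, ∀ᵐ ξ ∂stepSeqLaw p, |backPosition p n (a i) ξ| ≤ N n := fun i n =>
    (hN n).mono fun ξ h => h i
  have h1 := tendsto_finsetSum Finset.univ fun i (_ : i ∈ Finset.univ) =>
    tendsto_finsetSum Finset.univ fun j (_ : j ∈ Finset.univ) =>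
      (((tendsto_sum_integral_crossing_mul hp (hNi i) (hNi j)).const_mul m).add
        ((tendsto_sum_integral_mul_integral_crossing hp (hNi i) (hNi j)).const_mul
          (σ ^ 2 - m))).const_mul (θ i * θ j)
  convert h1 using 1
  · ext n
    have e : ∑ x ∈ Finset.Icc (-(N n : ℤ)) (N n), siteVariance a θ p m σ n x
        = m * ∑ x ∈ Finset.Icc (-(N n : ℤ)) (N n), ∫ ξ, crossWeight p a θ n x ξ ^ 2 ∂stepSeqLaw p
          + (σ ^ 2 - m) * ∑ x ∈ Finset.Icc (-(N n : ℤ)) (N n),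
            (∫ ξ, crossWeight p a θ n x ξ ∂stepSeqLaw p) ^ 2 := by
      rw [Finset.mul_sum, Finset.mul_sum, ← Finset.sum_add_distrib]
      exact Finset.sum_congr rfl fun x _ => by rw [siteVariance]; ring
    rw [e, sum_integral_crossWeight_sq, sum_sq_integral_crossWeight]
    simp_rw [mul_add, Finset.sum_add_distrib, add_div, Finset.mul_sum, Finset.sum_div,
      Finset.mul_sum]
    congr 1 <;>
    exact Finset.sum_congr rfl fun i _ => Finset.sum_congr rfl fun j _ =>
      Finset.sum_congr rfl fun x _ => by ring
  · congr 1
    exact Finset.sum_congr rfl fun i _ => Finset.sum_congr rfl fun j _ => by ring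

/-- The factors are compared one by one with Gaussian ones. With d = n^{-1/4} the errors add up to ε
d² times O(√n), while the Gaussian product converges with the sum of the site variances. -/
theorem tendsto_prod_integral_exp_crossWeight (hp : p.support.Finite) {m σ : ℝ} (hm : 0 ≤ m)
    {G : ℂ → ℂ} (hG1 : ∀ z, ‖z‖ ≤ 1 → ‖G z‖ ≤ 1)
    (hG : HasQuadraticExpansion G m (σ ^ 2 + m ^ 2 - m)) {N : ℕ → ℕ}
    (hN : ∀ n, ∀ᵐ ξ ∂stepSeqLaw p, ∀ i, |backPosition p n (a i) ξ| ≤ N n) :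
    Tendsto (fun n : ℕ => (∏ x ∈ Finset.Icc (-(N n : ℤ)) (N n),
        G (∫ ξ, Complex.exp (((n : ℝ) ^ (-(1 / 4) : ℝ) * crossWeight p a θ n x ξ : ℝ) * Complex.I)
          ∂stepSeqLaw p))
        * Complex.exp ((-((n : ℝ) ^ (-(1 / 4) : ℝ) * (m * ∑ x ∈ Finset.Icc (-(N n : ℤ)) (N n),
          ∫ ξ, crossWeight p a θ n x ξ ∂stepSeqLaw p)) : ℝ) * Complex.I)) atTop
      (𝓝 (Complex.exp (-((∑ i, ∑ j, θ i * θ j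
        * (m * covDyn (stepVar p) (a i) (a j) + σ ^ 2 * covInit (stepVar p) (a i) (a j))) / 2
          : ℝ)))) := by
  set d : ℕ → ℝ := fun n => (n : ℝ) ^ (-(1 / 4) : ℝ) with hd
  have hd0 : Tendsto d atTop (𝓝 0) := tendsto_rpow_neg_quarter
  let e : ℕ → ℤ → ℝ := fun n x => ∫ ξ, crossWeight p a θ n x ξ ∂stepSeqLaw p
  let V : ℕ → ℤ → ℝ := siteVariance a θ p m σ
  let ψ : ℕ → ℤ → ℂ := fun n x =>
    ∫ ξ, Complex.exp ((d n * crossWeight p a θ n x ξ : ℝ) * Complex.I) ∂stepSeqLaw p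
  let I : ℕ → Finset ℤ := fun n => Finset.Icc (-(N n : ℤ)) (N n)
  have hψ : ∀ n x, ‖ψ n x‖ ≤ 1 := fun n x =>
    (norm_integral_le_of_norm_le_const (C := 1)
      (ae_of_all _ fun ξ => (Complex.norm_exp_ofReal_mul_I _).le)).trans (by simp)
  have hlim : Tendsto (fun n => ∏ x ∈ I n, Complex.exp (-(d n ^ 2 / 2 * V n x : ℝ))) atTop
      (𝓝 (Complex.exp (-((∑ i, ∑ j, θ i * θ j
        * (m * covDyn (stepVar p) (a i) (a j) + σ ^ 2 * covInit (stepVar p) (a i) (a j))) / 2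
          : ℝ)))) := by
    have h := ((Complex.continuous_exp.comp Complex.continuous_ofReal.neg).tendsto _).comp
      ((tendsto_sum_siteVariance a θ hp m σ hN).div_const 2)
    refine h.congr fun n => ?_
    rw [← Complex.exp_sum]
    simp only [Function.comp_apply]
    congr 1
    rw [Finset.sum_neg_distrib, ← Complex.ofReal_sum]
    congr 2
    rw [← Finset.mul_sum, hd, rpow_neg_quarter_sq n]
    ring
  have hS : Tendsto (fun n : ℕ => (∑ i, |θ i| * ∫ ξ, |(backPosition p n (a i) ξ : ℝ)| ∂stepSeqLaw p)
      / √n) atTop (𝓝 (∑ i, |θ i| * gaussAbs (a i).2 (stepVar p * (a i).1))) := by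
    have h := tendsto_finsetSum Finset.univ fun i (_ : i ∈ Finset.univ) =>
      (tendsto_integral_abs_backPosition hp (a i)).const_mul |θ i|
    refine h.congr fun n => ?_
    rw [Finset.sum_div]
    exact Finset.sum_congr rfl fun i _ => by ring
  set L := ∑ i, |θ i| * gaussAbs (a i).2 (stepVar p * (a i).1) with hL
  have hL0 : 0 ≤ L := ge_of_tendsto' hS fun n => div_nonneg
    (Finset.sum_nonneg fun i _ => mul_nonneg (abs_nonneg _) (integral_nonneg fun _ => abs_nonneg _))
    (Real.sqrt_nonneg _)
  have hdiff : Tendsto (fun n => (∏ x ∈ I n,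
        G (ψ n x) * Complex.exp (-(d n * m * e n x : ℝ) * Complex.I))
      - ∏ x ∈ I n, Complex.exp (-(d n ^ 2 / 2 * V n x : ℝ))) atTop (𝓝 0) := by
    rw [Metric.tendsto_nhds]
    intro ε hε
    have hε' : 0 < ε / (L + 2) := by positivity
    obtain ⟨δ₀, hδ₀, hest⟩ := exists_norm_sub_exp_le (Ω := ℕ → ℤ) hm hG
      (Finset.sum_nonneg fun i (_ : i ∈ Finset.univ) => abs_nonneg (θ i)) hε'
    filter_upwards [hd0.eventually (ge_mem_nhds hδ₀), eventually_ne_atTop 0,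
      hS.eventually (gt_mem_nhds (lt_add_one L))] with n h1 hn h2
    have hdn : 0 < d n := Real.rpow_pos_of_pos (by positivity) _
    rw [dist_zero_right]
    have hterm : ∀ x ∈ I n, ‖G (ψ n x) * Complex.exp (-(d n * m * e n x : ℝ) * Complex.I)
        - Complex.exp (-(d n ^ 2 / 2 * V n x : ℝ))‖
        ≤ ε / (L + 2) * d n ^ 2 * ∫ ξ, |crossWeight p a θ n x ξ| ∂stepSeqLaw p := by
      intro x _
      have h := hest (d n) hdn h1 (stepSeqLaw p) (crossWeight p a θ n x)
        (measurable_crossWeight p a θ n x) (abs_crossWeight_le p a θ n x)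
      refine le_trans (le_of_eq ?_) h
      -- Centring multiplies by a unimodular phase, so it can be moved inside the norm without
      -- changing the bound.
      have hu : ‖Complex.exp ((-(d n * m * e n x) : ℝ) * Complex.I)‖ = 1 :=
        Complex.norm_exp_ofReal_mul_I _
      rw [← mul_one ‖G _ - _‖, ← hu, ← norm_mul, sub_mul, ← Complex.exp_add]
      congr 3
      · simp
      · simp only [V, siteVariance, e]
        push_cast
        ring
    have hexp : ∀ u : ℝ, ‖Complex.exp (-(u : ℂ) * Complex.I)‖ = 1 := fun u => by
      rw [← Complex.ofReal_neg, Complex.norm_exp_ofReal_mul_I]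
    calc _ ≤ ∑ x ∈ I n, ‖G (ψ n x) * Complex.exp (-(d n * m * e n x : ℝ) * Complex.I)
        - Complex.exp (-(d n ^ 2 / 2 * V n x : ℝ))‖ := by
          refine norm_prod_sub_prod_le _ (fun x _ => ?_) fun x _ => ?_
          · rw [norm_mul, hexp, mul_one]
            exact hG1 _ (hψ n x)
          · rw [← Complex.ofReal_neg, Complex.norm_exp_ofReal, Real.exp_le_one_iff]
            have := siteVariance_nonneg (p := p) a θ hm σ n x
            simp only [V]
            have : 0 ≤ d n ^ 2 / 2 * siteVariance a θ p m σ n x := by positivity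
            linarith
      _ ≤ ∑ x ∈ I n, ε / (L + 2) * d n ^ 2 * ∫ ξ, |crossWeight p a θ n x ξ| ∂stepSeqLaw p :=
          Finset.sum_le_sum hterm
      _ ≤ ε / (L + 2) * d n ^ 2
          * ∑ i, |θ i| * ∫ ξ, |(backPosition p n (a i) ξ : ℝ)| ∂stepSeqLaw p := by
          rw [← Finset.mul_sum]
          exact mul_le_mul_of_nonneg_left (sum_integral_abs_crossWeight_le a θ hp (hN n))
            (by positivity)
      _ = ε / (L + 2) * ((∑ i, |θ i| * ∫ ξ, |(backPosition p n (a i) ξ : ℝ)| ∂stepSeqLaw p)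
          / √n) := by
          rw [hd, rpow_neg_quarter_sq n]; ring
      _ ≤ ε / (L + 2) * (L + 1) := mul_le_mul_of_nonneg_left h2.le hε'.le
      _ < ε := by
          rw [div_mul_eq_mul_div, div_lt_iff₀ (by positivity)]
          nlinarith
  have h := hdiff.add hlim
  rw [zero_add] at h
  refine h.congr fun n => ?_
  rw [sub_add_cancel, Finset.prod_mul_distrib, ← Complex.exp_sum]
  congr 2
  simp only [e]
  rw [← Finset.sum_mul, Finset.sum_neg_distrib, ← Complex.ofReal_sum, ← Finset.mul_sum]
  push_cast
  ring

end CharFunLimit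

/-! ### Sums over the particles of the system. -/

lemma IndepFun.integrable_comp_prodMk {Ω α β E : Type*} [MeasurableSpace Ω] [MeasurableSpace α]
    [MeasurableSpace β] [NormedAddCommGroup E] {P : Measure Ω}
    [IsProbabilityMeasure P] {f : Ω → α} {g : Ω → β} (hf : Measurable f) (hg : Measurable g)
    (h : IndepFun f g P) {F : α × β → E} (hF : StronglyMeasurable F)
    (hi : Integrable (fun ω => F (f ω, g ω)) P) :
    Integrable F ((P.map f).prod (P.map g)) := by
  rw [← h.map_prod_eq_prod_map_map hf.aemeasurable hg.aemeasurable]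
  exact (integrable_map_measure hF.aestronglyMeasurable (hf.prodMk hg).aemeasurable).2 hi

/-- Independent random variables can be integrated one after the other. -/
lemma IndepFun.integral_comp_prodMk {Ω α β E : Type*} [MeasurableSpace Ω] [MeasurableSpace α]
    [MeasurableSpace β] [NormedAddCommGroup E] [NormedSpace ℝ E] {P : Measure Ω}
    [IsProbabilityMeasure P] {f : Ω → α} {g : Ω → β} (hf : Measurable f) (hg : Measurable g)
    (h : IndepFun f g P) {F : α × β → E} (hF : StronglyMeasurable F)
    (hi : Integrable (fun ω => F (f ω, g ω)) P) :
    ∫ ω, F (f ω, g ω) ∂P = ∫ ω, (∫ ω', F (f ω, g ω') ∂P) ∂P := by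
  have := Measure.isProbabilityMeasure_map (μ := P) hf.aemeasurable
  have := Measure.isProbabilityMeasure_map (μ := P) hg.aemeasurable
  rw [← integral_map (φ := fun ω => (f ω, g ω)) (hf.prodMk hg).aemeasurable
    hF.aestronglyMeasurable, h.map_prod_eq_prod_map_map hf.aemeasurable hg.aemeasurable,
    integral_prod _ (IndepFun.integrable_comp_prodMk hf hg h hF hi),
    integral_map hf.aemeasurable hF.integral_prod_right'.aestronglyMeasurable]
  congr 1; ext ω
  exact integral_map hg.aemeasurable (hF.comp_measurable measurable_prodMk_left).aestronglyMeasurable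

section Particles

variable {Ω : Type*} [MeasurableSpace Ω] {P : Measure Ω}
  {p : PMF ℤ} {m σ₀ : ℝ} {η : ℤ → Ω → ℕ} {X : ℤ → ℕ → ℕ → Ω → ℤ}

/-- The steps of the walk of a particle. -/
def walkSteps (X : ℤ → ℕ → ℕ → Ω → ℤ) (i : ℤ × ℕ) (ω : Ω) (s : ℕ) : ℤ :=
  X i.1 i.2 (s + 1) ω - X i.1 i.2 s ω

/-- Sum of `g x` over the steps of all particles that start in `I`. -/
def particleSum (η : ℤ → Ω → ℕ) (X : ℤ → ℕ → ℕ → Ω → ℤ) (I : Finset ℤ)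
    (g : ℤ → (ℕ → ℤ) → ℝ) (ω : Ω) : ℝ :=
  ∑ x ∈ I, ∑ k ∈ Finset.range (η x ω), g x (walkSteps X (x, k) ω)

lemma IsWalkSystem.measurable_walkSteps (h : IsWalkSystem P p m σ₀ η X) (i : ℤ × ℕ) :
    Measurable (walkSteps X i) :=
  measurable_pi_lambda _ fun s => ((h.walk i.1 i.2).measurable (s + 1)).sub
    ((h.walk i.1 i.2).measurable s)

lemma IsWalkSystem.measurable_walkSteps_family (h : IsWalkSystem P p m σ₀ η X) :
    Measurable fun ω i => walkSteps X i ω :=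
  measurable_pi_lambda _ fun i => h.measurable_walkSteps i

lemma IsWalkSystem.measurable_occ_family (h : IsWalkSystem P p m σ₀ η X) :
    Measurable fun ω x => η x ω :=
  measurable_pi_lambda _ fun x => h.measurable_occ x

lemma measurable_path_steps : Measurable fun (S : ℕ → ℤ) (s : ℕ) => S (s + 1) - S s :=
  measurable_pi_lambda _ fun s => (measurable_pi_apply (s + 1)).sub (measurable_pi_apply s)

lemma IsWalkSystem.iIndepFun_walkSteps (h : IsWalkSystem P p m σ₀ η X) :
    iIndepFun (walkSteps X) P :=
  h.indep_walks.comp (fun _ S s => S (s + 1) - S s) fun _ => measurable_path_steps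

lemma IsWalkSystem.indepFun_occ_walkSteps (h : IsWalkSystem P p m σ₀ η X) :
    IndepFun (fun ω x => η x ω) (fun ω i => walkSteps X i ω) P :=
  IndepFun.comp (φ := id) (ψ := fun (S : ℤ × ℕ → ℕ → ℤ) (i : ℤ × ℕ) (s : ℕ) =>
    S i (s + 1) - S i s) h.indep_occ_walks
    measurable_id (measurable_pi_lambda _ fun i => measurable_path_steps.comp (measurable_pi_apply i))

lemma IsWalkSystem.hasLaw_walkSteps (h : IsWalkSystem P p m σ₀ η X) (i : ℤ × ℕ) :
    HasLaw (walkSteps X i) (stepSeqLaw p) P :=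
  (h.walk i.1 i.2).indep_steps.hasLaw_infinitePi (h.walk i.1 i.2).law_steps
    (h.measurable_walkSteps i).aemeasurable

lemma IsWalkSystem.ae_walk_eq (h : IsWalkSystem P p m σ₀ η X) :
    ∀ᵐ ω ∂P, ∀ x k s, X x k s ω = x + ∑ j ∈ Finset.range s, walkSteps X (x, k) ω j := by
  rw [ae_all_iff]; intro x
  rw [ae_all_iff]; intro k
  filter_upwards [(h.walk x k).start] with ω h0 s
  unfold walkSteps
  rw [Finset.sum_range_sub (fun s => X x k s ω), h0]
  ring

lemma IsWalkSystem.ae_walkSteps (h : IsWalkSystem P p m σ₀ η X) {q : (ℕ → ℤ) → Prop}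
    (hq : ∀ᵐ ξ ∂stepSeqLaw p, q ξ) : ∀ᵐ ω ∂P, ∀ i, q (walkSteps X i ω) := by
  rw [ae_all_iff]
  intro i
  rw [← (h.hasLaw_walkSteps i).map_eq] at hq
  exact ae_of_ae_map (h.measurable_walkSteps i).aemeasurable hq

lemma IsWalkSystem.mean_nonneg (h : IsWalkSystem P p m σ₀ η X) : 0 ≤ m := by
  rw [← h.mean_occ]
  exact integral_nonneg fun _ => Nat.cast_nonneg _

lemma IsWalkSystem.integrable_occ [IsProbabilityMeasure P]
    (h : IsWalkSystem P p m σ₀ η X) (x : ℤ) :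
    Integrable (fun ω => (η x ω : ℝ)) P := by
  have h0 : Integrable (fun ω => (η 0 ω : ℝ)) P := h.memLp_occ.integrable (by norm_num)
  exact ((h.ident_occ x).comp (u := fun j : ℕ => (j : ℝ)) measurable_from_top).integrable_iff.2 h0

lemma IsWalkSystem.integral_occ (h : IsWalkSystem P p m σ₀ η X) (x : ℤ) :
    ∫ ω, (η x ω : ℝ) ∂P = m :=
  (((h.ident_occ x).comp (u := fun j : ℕ => (j : ℝ)) measurable_from_top).integral_eq).trans
    h.mean_occ

/-- The number of summands is random but takes countably many values; for each fixed value the sum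
is measurable. -/
lemma measurable_sum_range_occ {g : ℤ → (ℕ → ℤ) → ℝ} (hg : ∀ x, Measurable (g x)) (x : ℤ) :
    Measurable fun q : (ℤ → ℕ) × (ℤ × ℕ → ℕ → ℤ) =>
      ∑ k ∈ Finset.range (q.1 x), g x (q.2 (x, k)) := by
  have h : Measurable fun q : ℕ × (ℤ × ℕ → ℕ → ℤ) =>
      ∑ k ∈ Finset.range q.1, g x (q.2 (x, k)) :=
    measurable_from_prod_countable_right fun j =>
      Finset.measurable_fun_sum (Finset.range j) fun k _ =>
        (hg x).comp (measurable_pi_apply (x, k))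
  have h1 : Measurable fun q : (ℤ → ℕ) × (ℤ × ℕ → ℕ → ℤ) => q.1 x :=
    (measurable_pi_apply x).comp measurable_fst
  exact h.comp (h1.prodMk measurable_snd)

lemma measurable_sum_sum_range_occ {g : ℤ → (ℕ → ℤ) → ℝ} (hg : ∀ x, Measurable (g x))
    (I : Finset ℤ) :
    Measurable fun q : (ℤ → ℕ) × (ℤ × ℕ → ℕ → ℤ) =>
      ∑ x ∈ I, ∑ k ∈ Finset.range (q.1 x), g x (q.2 (x, k)) :=
  Finset.measurable_fun_sum _ fun x _ => measurable_sum_range_occ hg x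

lemma IsWalkSystem.measurable_particleSum (h : IsWalkSystem P p m σ₀ η X) (I : Finset ℤ)
    {g : ℤ → (ℕ → ℤ) → ℝ} (hg : ∀ x, Measurable (g x)) : Measurable (particleSum η X I g) :=
  (measurable_sum_sum_range_occ hg I).comp
    (h.measurable_occ_family.prodMk h.measurable_walkSteps_family)

lemma IsWalkSystem.integrable_sum_range_occ [IsProbabilityMeasure P]
    (h : IsWalkSystem P p m σ₀ η X)
    {g : ℤ → (ℕ → ℤ) → ℝ} (hg : ∀ x, Measurable (g x)) {C : ℝ} (hC : ∀ x ξ, |g x ξ| ≤ C) (x : ℤ) :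
    Integrable (fun ω => ∑ k ∈ Finset.range (η x ω), g x (walkSteps X (x, k) ω)) P := by
  refine ((h.integrable_occ x).mul_const C).mono' ((measurable_sum_range_occ hg x).comp
    (h.measurable_occ_family.prodMk h.measurable_walkSteps_family)).aestronglyMeasurable
    (ae_of_all _ fun ω => ?_)
  refine (Finset.abs_sum_le_sum_abs _ _).trans ((Finset.sum_le_sum fun k _ => hC x _).trans ?_)
  simp

lemma IsWalkSystem.integrable_particleSum [IsProbabilityMeasure P]
    (h : IsWalkSystem P p m σ₀ η X) (I : Finset ℤ)
    {g : ℤ → (ℕ → ℤ) → ℝ} (hg : ∀ x, Measurable (g x)) {C : ℝ} (hC : ∀ x ξ, |g x ξ| ≤ C) :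
    Integrable (particleSum η X I g) P :=
  integrable_finsetSum _ fun x _ => h.integrable_sum_range_occ hg hC x

/-- Wald's identity: integrate over the walks with the occupation numbers fixed, then over these. -/
lemma IsWalkSystem.integral_particleSum [IsProbabilityMeasure P]
    (h : IsWalkSystem P p m σ₀ η X) (I : Finset ℤ)
    {g : ℤ → (ℕ → ℤ) → ℝ} (hg : ∀ x, Measurable (g x)) {C : ℝ} (hC : ∀ x ξ, |g x ξ| ≤ C) :
    ∫ ω, particleSum η X I g ω ∂P = m * ∑ x ∈ I, ∫ ξ, g x ξ ∂stepSeqLaw p := by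
  unfold particleSum
  rw [integral_finsetSum _ fun x _ => h.integrable_sum_range_occ hg hC x, Finset.mul_sum]
  refine Finset.sum_congr rfl fun x _ => ?_
  have hi : ∀ i, ∫ ω, g x (walkSteps X i ω) ∂P = ∫ ξ, g x ξ ∂stepSeqLaw p := fun i =>
    (h.hasLaw_walkSteps i).integral_comp (hg x).aestronglyMeasurable
  have hint : ∀ i, Integrable (fun ω => g x (walkSteps X i ω)) P := fun i =>
    .of_bound ((hg x).comp (h.measurable_walkSteps i)).aestronglyMeasurable C
      (ae_of_all _ fun ω => hC x _)
  refine (IndepFun.integral_comp_prodMk h.measurable_occ_family h.measurable_walkSteps_family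
    h.indepFun_occ_walkSteps (measurable_sum_range_occ hg x).stronglyMeasurable
    (h.integrable_sum_range_occ hg hC x)).trans ?_
  simp_rw [integral_finsetSum _ fun k _ => hint (x, k), hi]
  simp only [Finset.sum_const, Finset.card_range, nsmul_eq_mul]
  rw [integral_mul_const, h.integral_occ]

lemma IsWalkSystem.integral_prod_exp_walkSteps (h : IsWalkSystem P p m σ₀ η X) (I : Finset ℤ)
    (e : ℤ → ℕ) {f : ℤ → (ℕ → ℤ) → ℂ} (hf : ∀ x, Measurable (f x)) :
    ∫ ω, ∏ x ∈ I, ∏ k ∈ Finset.range (e x), f x (walkSteps X (x, k) ω) ∂P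
      = ∏ x ∈ I, (∫ ξ, f x ξ ∂stepSeqLaw p) ^ e x := by
  let J : Finset (Σ _ : ℤ, ℕ) := I.sigma fun x => Finset.range (e x)
  let j : J → ℤ × ℕ := fun q => (q.1.1, q.1.2)
  have hj : j.Injective := by
    rintro ⟨⟨x, k⟩, _⟩ ⟨⟨x', k'⟩, _⟩ hq
    simp only [j, Prod.mk.injEq] at hq
    obtain ⟨rfl, rfl⟩ := hq
    rfl
  have hI := (h.iIndepFun_walkSteps.precomp hj).integral_fun_prod_comp
    (f := fun q => f q.1.1) (fun q => (h.measurable_walkSteps (j q)).aemeasurable)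
    (fun q => (hf q.1.1).aestronglyMeasurable)
  have e1 : ∀ F : ℤ → ℕ → ℂ, ∏ q : J, F q.1.1 q.1.2 = ∏ x ∈ I, ∏ k ∈ Finset.range (e x), F x k := by
    intro F
    rw [Finset.prod_sigma']
    exact Finset.prod_coe_sort J fun q => F q.1 q.2
  have e2 := fun ω => e1 fun x k => f x (walkSteps X (x, k) ω)
  simp_rw [← e2]
  refine hI.trans ((e1 fun x k => ∫ ω, f x (walkSteps X (x, k) ω) ∂P).trans ?_)
  refine Finset.prod_congr rfl fun x _ => ?_
  refine (Finset.prod_congr rfl fun k _ => ?_).trans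
    ((Finset.prod_const _).trans (by rw [Finset.card_range]))
  exact (h.hasLaw_walkSteps (x, k)).integral_comp (hf x).aestronglyMeasurable

lemma IsWalkSystem.integral_prod_pow_occ (h : IsWalkSystem P p m σ₀ η X) (I : Finset ℤ)
    (z : ℤ → ℂ) :
    ∫ ω, ∏ x ∈ I, z x ^ η x ω ∂P = ∏ x ∈ I, ∫ ω, z x ^ η 0 ω ∂P := by
  have hI := iIndepFun.integral_fun_prod_comp (X := fun x : I => η x)
    (h.indep_occ.precomp (g := ((↑) : I → ℤ)) Subtype.val_injective)
    (f := fun x j => z x ^ j) (fun x => (h.measurable_occ x).aemeasurable)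
    (fun x => (measurable_from_top (f := fun j : ℕ => z x ^ j)).aestronglyMeasurable)
  have e1 : ∀ F : ℤ → ℂ, ∏ x : I, F x = ∏ x ∈ I, F x := fun F => Finset.prod_coe_sort I F
  have e2 := fun ω => e1 fun x => z x ^ η x ω
  simp_rw [← e2]
  refine hI.trans ((e1 fun x => ∫ ω, z x ^ η x ω ∂P).trans (Finset.prod_congr rfl fun x _ => ?_))
  exact ((h.ident_occ x).comp (u := fun j : ℕ => z x ^ j) measurable_from_top).integral_eq

/-- With the occupation numbers fixed, the walks give a product of powers ψ_x^{η_x}; averaging over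
the independent η_x turns each power into the generating function at ψ_x. -/
lemma IsWalkSystem.integral_exp_particleSum [IsProbabilityMeasure P]
    (h : IsWalkSystem P p m σ₀ η X) (I : Finset ℤ)
    {g : ℤ → (ℕ → ℤ) → ℝ} (hg : ∀ x, Measurable (g x)) :
    ∫ ω, Complex.exp ((particleSum η X I g ω : ℝ) * Complex.I) ∂P
      = ∏ x ∈ I, ∫ ω, (∫ ξ, Complex.exp ((g x ξ : ℝ) * Complex.I) ∂stepSeqLaw p) ^ η 0 ω ∂P := by
  have hF : Measurable fun q : (ℤ → ℕ) × (ℤ × ℕ → ℕ → ℤ) => Complex.exp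
      ((∑ x ∈ I, ∑ k ∈ Finset.range (q.1 x), g x (q.2 (x, k)) : ℝ) * Complex.I) := by
    have := measurable_sum_sum_range_occ hg I
    fun_prop
  have hm := h.measurable_particleSum I hg
  have hi : Integrable (fun ω => Complex.exp ((particleSum η X I g ω : ℝ) * Complex.I)) P :=
    .of_bound (by fun_prop) 1 (ae_of_all _ fun ω => (Complex.norm_exp_ofReal_mul_I _).le)
  rw [← h.integral_prod_pow_occ]
  refine (IndepFun.integral_comp_prodMk h.measurable_occ_family h.measurable_walkSteps_family
    h.indepFun_occ_walkSteps hF.stronglyMeasurable hi).trans ?_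
  congr 1; ext ω
  rw [← h.integral_prod_exp_walkSteps I (fun x => η x ω)
    (f := fun x ξ => Complex.exp ((g x ξ : ℝ) * Complex.I)) fun x => by have := hg x; fun_prop]
  congr 1; ext ω'
  simp_rw [← Complex.exp_sum]
  congr 1
  push_cast
  simp_rw [Finset.sum_mul]

/-- The signed number of particles that start at `x` and are counted in the current. -/
noncomputable def siteCurrent (p : PMF ℤ) (η : ℤ → Ω → ℕ) (X : ℤ → ℕ → ℕ → Ω → ℤ) (n : ℕ) (b : ℝ≥0 × ℝ)
    (ω : Ω) (x : ℤ) : ℝ :=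
  ∑ k ∈ Finset.range (η x ω), crossing (backPosition p n b (walkSteps X (x, k) ω)) x

/-- A single signed weight covers both sums in the current: `crossing α x` is 1{α < x} for x ≤ 0 and
-1{x ≤ α} for x > 0. -/
lemma IsWalkSystem.ae_num_eq (h : IsWalkSystem P p m σ₀ η X) (n : ℕ) (t : ℝ≥0) (r : ℝ) :
    ∀ᵐ ω ∂P, (∀ x ≤ 0, numRight (stepMean p) η X n t r ω x = siteCurrent p η X n (t, r) ω x) ∧
      ∀ x > 0, numLeft (stepMean p) η X n t r ω x = -siteCurrent p η X n (t, r) ω x := by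
  filter_upwards [h.ae_walk_eq] with ω hω
  have key : ∀ x k, backPosition p n (t, r) (walkSteps X (x, k) ω) < x
      ↔ observer (stepMean p) n t r < (X x k ⌊(n : ℝ≥0) * t⌋₊ ω : ℝ) := by
    intro x k
    rw [backPosition_lt_iff, hω x k]
    rfl
  refine ⟨fun x hx => Finset.sum_congr rfl fun k _ => ?_, fun x hx => ?_⟩
  · simp only [crossing, key, not_lt.2 hx, if_false, sub_zero]
  · rw [siteCurrent, ← Finset.sum_neg_distrib]
    refine Finset.sum_congr rfl fun k _ => ?_
    simp only [crossing, key, hx, if_true, ← not_lt]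
    split_ifs <;> simp

lemma IsWalkSystem.ae_siteCurrent_eq_zero (h : IsWalkSystem P p m σ₀ η X) {n N : ℕ} {b : ℝ≥0 × ℝ}
    (hN : ∀ᵐ ξ ∂stepSeqLaw p, |backPosition p n b ξ| ≤ N) :
    ∀ᵐ ω ∂P, ∀ x ∉ Finset.Icc (-(N : ℤ)) N, siteCurrent p η X n b ω x = 0 := by
  filter_upwards [h.ae_walkSteps hN] with ω hω x hx
  exact Finset.sum_eq_zero fun k _ => crossing_eq_zero (hω (x, k)) hx

lemma IsWalkSystem.ae_summable (h : IsWalkSystem P p m σ₀ η X) (hp : p.support.Finite) (n : ℕ)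
    (t : ℝ≥0) (r : ℝ) : ∀ᵐ ω ∂P,
      Summable (fun x : Set.Iic (0 : ℤ) => numRight (stepMean p) η X n t r ω x) ∧
      Summable (fun x : Set.Ioi (0 : ℤ) => numLeft (stepMean p) η X n t r ω x) := by
  obtain ⟨N, hN⟩ := exists_ae_abs_backPosition_le hp (fun _ : Fin 1 => (t, r)) n
  filter_upwards [h.ae_num_eq n t r, h.ae_siteCurrent_eq_zero (hN.mono fun ξ hξ => hξ 0)]
    with ω h1 h2
  have hs : Summable (siteCurrent p η X n (t, r) ω) := summable_of_ne_finset_zero h2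
  exact ⟨(hs.subtype _).congr fun x => (h1.1 x x.2).symm,
    (hs.neg.subtype _).congr fun x => (h1.2 x x.2).symm⟩

lemma IsWalkSystem.current_ae_eq (h : IsWalkSystem P p m σ₀ η X) {n N : ℕ} {b : ℝ≥0 × ℝ}
    (hN : ∀ᵐ ξ ∂stepSeqLaw p, |backPosition p n b ξ| ≤ N) :
    current (stepMean p) η X n b.1 b.2 =ᵐ[P] particleSum η X (Finset.Icc (-(N : ℤ)) N)
      fun x ξ => crossing (backPosition p n b ξ) x := by
  filter_upwards [h.ae_num_eq n b.1 b.2, h.ae_siteCurrent_eq_zero hN] with ω h1 h2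
  have hs : Summable (siteCurrent p η X n b ω) := summable_of_ne_finset_zero h2
  have e1 : ∑' x : Set.Iic (0 : ℤ), numRight (stepMean p) η X n b.1 b.2 ω x
      = ∑' x : Set.Iic (0 : ℤ), siteCurrent p η X n b ω x := tsum_congr fun x => h1.1 x x.2
  have e2 : ∑' x : Set.Ioi (0 : ℤ), numLeft (stepMean p) η X n b.1 b.2 ω x
      = -∑' x : ((Set.Iic (0 : ℤ))ᶜ : Set ℤ), siteCurrent p η X n b ω x := by
    rw [← tsum_neg, Set.compl_Iic]
    exact tsum_congr fun x => h1.2 x x.2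
  rw [current, e1, e2, sub_neg_eq_add, hs.tsum_subtype_add_tsum_subtype_compl,
    tsum_eq_sum h2]
  rfl

lemma IsWalkSystem.integrable_current [IsProbabilityMeasure P]
    (h : IsWalkSystem P p m σ₀ η X) (hp : p.support.Finite)
    (n : ℕ) (t : ℝ≥0) (r : ℝ) : Integrable (current (stepMean p) η X n t r) P := by
  obtain ⟨N, hN⟩ := exists_ae_abs_backPosition_le hp (fun _ : Fin 1 => (t, r)) n
  exact (h.integrable_particleSum _ (fun x => measurable_crossing_backPosition p n (t, r) x)
    fun x ξ => abs_crossing_le _ _).congr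
    (h.current_ae_eq (b := (t, r)) (hN.mono fun ξ hξ => hξ 0)).symm

end Particles

/-! ### Convergence in distribution. -/

/-- Cramér–Wold form of Lévy's theorem: convergence in distribution of random vectors follows from
convergence of the characteristic functions of their linear combinations. -/
lemma tendstoInDistribution_pi_of_tendsto_integral_exp {ι Ω Ω' : Type*} [Fintype ι]
    [MeasurableSpace Ω] [MeasurableSpace Ω'] {P : Measure Ω} [IsProbabilityMeasure P]
    {P' : Measure Ω'} [IsProbabilityMeasure P'] {Y : ℕ → Ω → ι → ℝ} {Z : Ω' → ι → ℝ}
    (hY : ∀ n, AEMeasurable (Y n) P) (hZ : AEMeasurable Z P')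
    (h : ∀ θ : ι → ℝ, Tendsto
      (fun n => ∫ ω, Complex.exp ((∑ i, θ i * Y n ω i : ℝ) * Complex.I) ∂P) atTop
      (𝓝 (∫ ω, Complex.exp ((∑ i, θ i * Z ω i : ℝ) * Complex.I) ∂P'))) :
    TendstoInDistribution Y atTop Z (fun _ => P) P' := by
  -- Characteristic functions need an inner product, so the vectors pass to Euclidean space and
  -- return along the continuous identity.
  have hc : Continuous (WithLp.toLp 2 : (ι → ℝ) → EuclideanSpace ℝ ι) :=
    PiLp.continuous_toLp 2 _
  have hY' : ∀ n, AEMeasurable (fun ω => (WithLp.toLp 2 (Y n ω) : EuclideanSpace ℝ ι)) P := fun n =>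
    hc.measurable.comp_aemeasurable (hY n)
  have hZ' : AEMeasurable (fun ω => (WithLp.toLp 2 (Z ω) : EuclideanSpace ℝ ι)) P' :=
    hc.measurable.comp_aemeasurable hZ
  have key : TendstoInDistribution (fun n ω => (WithLp.toLp 2 (Y n ω) : EuclideanSpace ℝ ι)) atTop
      (fun ω => WithLp.toLp 2 (Z ω)) (fun _ => P) P' := by
    refine ⟨hY', hZ', ProbabilityMeasure.tendsto_iff_tendsto_charFun.2 fun t => ?_⟩
    have e1 : ∀ n, charFun (P.map fun ω => (WithLp.toLp 2 (Y n ω) : EuclideanSpace ℝ ι)) t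
        = ∫ ω, Complex.exp ((∑ i, t i * Y n ω i : ℝ) * Complex.I) ∂P := by
      intro n
      rw [charFun_apply, integral_map (hY' n) (by fun_prop)]
      simp [PiLp.inner_apply]
    have e2 : charFun (P'.map fun ω => (WithLp.toLp 2 (Z ω) : EuclideanSpace ℝ ι)) t
        = ∫ ω, Complex.exp ((∑ i, t i * Z ω i : ℝ) * Complex.I) ∂P' := by
      rw [charFun_apply, integral_map hZ' (by fun_prop)]
      simp [PiLp.inner_apply]
    have h' := h t
    simp_rw [← e1, ← e2] at h'
    exact h'
  exact key.continuous_comp (PiLp.continuous_ofLp 2 fun _ : ι => ℝ)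

section Limit

variable {Ω : Type*} [MeasurableSpace Ω] {P : Measure Ω} [IsProbabilityMeasure P]
  {W : ℝ≥0 × ℝ → Ω → ℝ} {B : ℝ → Ω → ℝ}

/-- A linear combination of values of Z stays in the Gaussian subspace, so its squared norm, the
covariance form, determines its characteristic function. -/
lemma integral_exp_sum_limitLp (hW : IsBrownianSheet P W) (hB : IsTwoSidedBrownian P B)
    (hWB : IndepFun (fun ω z => W z ω) (fun ω x => B x ω) P) {w : ℝ≥0} {a m : ℝ} (σ₀ : ℝ)
    (ha : a ^ 2 = w * m) {Z : ℝ≥0 × ℝ → Ω → ℝ} (hZ : ∀ z, limitLp hW hB w a σ₀ z =ᵐ[P] Z z)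
    {k : ℕ} (b : Fin k → ℝ≥0 × ℝ) (θ : Fin k → ℝ) :
    ∫ ω, Complex.exp ((∑ i, θ i * Z (b i) ω : ℝ) * Complex.I) ∂P
      = Complex.exp (-((∑ i, ∑ j, θ i * θ j
        * (m * covDyn w (b i) (b j) + σ₀ ^ 2 * covInit w (b i) (b j))) / 2 : ℝ)) := by
  set X : Lp ℝ 2 P := ∑ i, θ i • limitLp hW hB w a σ₀ (b i) with hX
  have hmem : X ∈ noiseSpan hW hB :=
    Submodule.sum_mem _ fun i _ => Submodule.smul_mem _ _ (limitLp_mem hW hB w a σ₀ (b i))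
  have hXZ : ∀ᵐ ω ∂P, X ω = ∑ i, θ i * Z (b i) ω := by
    have h1 : ⇑X =ᵐ[P] ∑ i, ⇑(θ i • limitLp hW hB w a σ₀ (b i)) := Lp.coeFn_finsetSum _ _
    have h2 : ∀ᵐ ω ∂P, ∀ i, (θ i • limitLp hW hB w a σ₀ (b i)) ω = θ i * Z (b i) ω := by
      rw [ae_all_iff]
      intro i
      filter_upwards [Lp.coeFn_smul (θ i) (limitLp hW hB w a σ₀ (b i)), hZ (b i)] with ω h3 h4
      rw [h3, Pi.smul_apply, h4, smul_eq_mul]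
    filter_upwards [h1, h2] with ω h3 h4
    rw [h3, Finset.sum_apply]
    exact Finset.sum_congr rfl fun i _ => h4 i
  have hn : ‖X‖ ^ 2 = ∑ i, ∑ j, θ i * θ j
      * (m * covDyn w (b i) (b j) + σ₀ ^ 2 * covInit w (b i) (b j)) := by
    rw [← real_inner_self_eq_norm_sq, hX, sum_inner]
    refine Finset.sum_congr rfl fun i _ => ?_
    rw [inner_sum]
    refine Finset.sum_congr rfl fun j _ => ?_
    rw [real_inner_smul_left, real_inner_smul_right, inner_limitLp hW hB hWB σ₀ ha]
    ring
  have h := isCenteredGaussianLp_of_mem_noiseSpan hW hB hWB hmem 1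
  rw [hn] at h
  simp only [one_mul, one_pow] at h
  rw [← h]
  refine integral_congr_ae ?_
  filter_upwards [hXZ] with ω hω
  rw [hω]

end Limit

section Particles

variable {Ω : Type*} [MeasurableSpace Ω] {P : Measure Ω} [IsProbabilityMeasure P]
  {p : PMF ℤ} {m σ₀ : ℝ} {η : ℤ → Ω → ℕ} {X : ℤ → ℕ → ℕ → Ω → ℤ}

lemma IsWalkSystem.tendsto_integral_exp_scaledCurrent (h : IsWalkSystem P p m σ₀ η X)
    (hp : p.support.Finite) {k : ℕ} (a : Fin k → ℝ≥0 × ℝ) (θ : Fin k → ℝ) :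
    Tendsto (fun n => ∫ ω, Complex.exp ((∑ i, θ i *
        scaledCurrent P (stepMean p) η X n (a i).1 (a i).2 ω : ℝ) * Complex.I) ∂P) atTop
      (𝓝 (Complex.exp (-((∑ i, ∑ j, θ i * θ j
        * (m * covDyn (stepVar p) (a i) (a j) + σ₀ ^ 2 * covInit (stepVar p) (a i) (a j))) / 2
          : ℝ)))) := by
  choose N hN using exists_ae_abs_backPosition_le hp a
  -- The factorial moment E[η(η-1)] equals σ₀² + m² - m.
  have hG : HasQuadraticExpansion (fun z => ∫ ω, z ^ η 0 ω ∂P) m (σ₀ ^ 2 + m ^ 2 - m) := by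
    have := hasQuadraticExpansion_integral_pow (h.measurable_occ 0) h.memLp_occ
    rwa [h.mean_occ, h.var_occ] at this
  have hG1 : ∀ z : ℂ, ‖z‖ ≤ 1 → ‖∫ ω, z ^ η 0 ω ∂P‖ ≤ 1 := fun z hz =>
    (norm_integral_le_of_norm_le_const (C := 1) (ae_of_all _ fun ω => by
      rw [norm_pow]; exact pow_le_one₀ (norm_nonneg _) hz)).trans (by simp)
  refine (tendsto_prod_integral_exp_crossWeight a θ hp h.mean_nonneg hG1 hG hN).congr fun n => ?_
  set d : ℝ := (n : ℝ) ^ (-(1 / 4) : ℝ)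
  set I := Finset.Icc (-(N n : ℤ)) (N n)
  have hg : ∀ x, Measurable (crossWeight p a θ n x) := fun x => measurable_crossWeight p a θ n x
  have hcur : ∀ᵐ ω ∂P, ∑ i, θ i * current (stepMean p) η X n (a i).1 (a i).2 ω
      = particleSum η X I (crossWeight p a θ n) ω := by
    have h1 : ∀ᵐ ω ∂P, ∀ i, current (stepMean p) η X n (a i).1 (a i).2 ω
        = particleSum η X I (fun x ξ => crossing (backPosition p n (a i) ξ) x) ω :=
      ae_all_iff.2 fun i => h.current_ae_eq ((hN n).mono fun ξ hξ => hξ i)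
    filter_upwards [h1] with ω hω
    simp_rw [hω, particleSum, crossWeight, Finset.mul_sum]
    rw [Finset.sum_comm]
    refine Finset.sum_congr rfl fun x _ => ?_
    rw [Finset.sum_comm]
  have hmean : ∑ i, θ i * ∫ ω, current (stepMean p) η X n (a i).1 (a i).2 ω ∂P
      = m * ∑ x ∈ I, ∫ ξ, crossWeight p a θ n x ξ ∂stepSeqLaw p := by
    rw [← h.integral_particleSum I hg (abs_crossWeight_le p a θ n), ← integral_congr_ae hcur,
      integral_finsetSum _ fun i _ => (h.integrable_current hp n _ _).const_mul _]
    simp_rw [integral_const_mul]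
  have hsum : ∀ᵐ ω ∂P, ∑ i, θ i * scaledCurrent P (stepMean p) η X n (a i).1 (a i).2 ω
      = particleSum η X I (fun x ξ => d * crossWeight p a θ n x ξ) ω
        + -(d * (m * ∑ x ∈ I, ∫ ξ, crossWeight p a θ n x ξ ∂stepSeqLaw p)) := by
    filter_upwards [hcur] with ω hω
    have e : particleSum η X I (fun x ξ => d * crossWeight p a θ n x ξ) ω
        = d * particleSum η X I (crossWeight p a θ n) ω := by
      simp only [particleSum, Finset.mul_sum]
    rw [e, ← hω, ← hmean, ← sub_eq_add_neg, ← mul_sub, ← Finset.sum_sub_distrib, Finset.mul_sum]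
    refine Finset.sum_congr rfl fun i _ => ?_
    rw [scaledCurrent]
    ring
  rw [← h.integral_exp_particleSum I (g := fun x ξ => d * crossWeight p a θ n x ξ)
    fun x => (hg x).const_mul d, ← integral_mul_const]
  refine integral_congr_ae ?_
  filter_upwards [hsum] with ω hω
  rw [hω, ← Complex.exp_add, Complex.ofReal_add, add_mul]

end Particles

/-! ### The main theorem. -/

theorem theorem2p1 {Ω Ω' : Type*} [MeasurableSpace Ω] [MeasurableSpace Ω']
    (P : Measure Ω) [IsProbabilityMeasure P] (P' : Measure Ω') [IsProbabilityMeasure P']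
    -- the particle system
    (p : PMF ℤ) (hp : p.support.Finite) (m σ₀ : ℝ) (hσ₀ : 0 ≤ σ₀)
    (η : ℤ → Ω → ℕ) (X : ℤ → ℕ → ℕ → Ω → ℤ) (hsys : IsWalkSystem P p m σ₀ η X)
    -- the independent Brownian motions that drive the limit process
    (W : ℝ≥0 × ℝ → Ω' → ℝ) (B : ℝ → Ω' → ℝ)
    (hW : IsBrownianSheet P' W) (hB : IsTwoSidedBrownian P' B)
    (hWB : IndepFun (fun ω z => W z ω) (fun ω x => B x ω) P') :
    -- the current is well defined and has a mean
    (∀ (n : ℕ) (t : ℝ≥0) (r : ℝ),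
      (∀ᵐ ω ∂P,
        Summable (fun x : Set.Iic (0 : ℤ) => numRight (stepMean p) η X n t r ω x) ∧
        Summable (fun x : Set.Ioi (0 : ℤ) => numLeft (stepMean p) η X n t r ω x)) ∧
      Integrable (current (stepMean p) η X n t r) P) ∧
    -- the limit process exists, with a jointly measurable version
    (∃ Z : ℝ≥0 × ℝ → Ω' → ℝ,
      IsLimitProcess P' (stepVar p) (√(stepVar p : ℝ) * √m) σ₀ W B Z ∧
      Measurable fun q : (ℝ≥0 × ℝ) × Ω' => Z q.1 q.2) ∧
    ∀ Z : ℝ≥0 × ℝ → Ω' → ℝ,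
      IsLimitProcess P' (stepVar p) (√(stepVar p : ℝ) * √m) σ₀ W B Z →
      -- it is a mean zero Gaussian process with the stated covariance
      IsGaussianProcess Z P' ∧
      (∀ a, ∫ ω, Z a ω ∂P' = 0) ∧
      (∀ a b, ∫ ω, Z a ω * Z b ω ∂P'
        = m * covDyn (stepVar p) a b + σ₀ ^ 2 * covInit (stepVar p) a b) ∧
      -- every jointly measurable version solves the stochastic heat equation
      ((Measurable fun q : (ℝ≥0 × ℝ) × Ω' => Z q.1 q.2) →
        IsWeakSolutionSHE P' (stepVar p) (√(stepVar p : ℝ) * √m) σ₀ W B Z) ∧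
      -- convergence of the finite-dimensional distributions
      ∀ (k : ℕ) (a : Fin k → ℝ≥0 × ℝ),
        TendstoInDistribution
          (fun (n : ℕ) (ω : Ω) (i : Fin k) =>
            scaledCurrent P (stepMean p) η X n (a i).1 (a i).2 ω)
          atTop (fun (ω : Ω') (i : Fin k) => Z (a i) ω) (fun _ => P) P' := by
  -- This uses m ≥ 0, which holds because m is the mean of a count. It is the only fact about the
  -- noise coefficient that is needed.
  have ha : (√(stepVar p : ℝ) * √m) ^ 2 = stepVar p * m := by
    rw [mul_pow, Real.sq_sqrt (stepVar p).coe_nonneg, Real.sq_sqrt hsys.mean_nonneg]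
  refine ⟨fun n t r => ⟨hsys.ae_summable hp n t r, hsys.integrable_current hp n t r⟩, ?_, ?_⟩
  · obtain ⟨Z, hZm, hZ⟩ :=
      exists_measurable_version_of_continuous (continuous_limitLp hW hB hWB σ₀ ha)
    exact ⟨Z, (isLimitProcess_iff hW hB _ _ _ _).2 hZ, hZm⟩
  · intro Z hlim
    have hZ := (isLimitProcess_iff hW hB _ _ _ _).1 hlim
    have hgauss : ∀ Y ∈ noiseSpan hW hB, IsCenteredGaussianLp Y := fun Y hY =>
      isCenteredGaussianLp_of_mem_noiseSpan hW hB hWB hY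
    have hmem := limitLp_mem hW hB (stepVar p) (√(stepVar p : ℝ) * √m) σ₀
    refine ⟨isGaussianProcess_of_mem (noiseSpan hW hB) hgauss _ hZ hmem, fun b => ?_,
      fun b c => ?_, hW.isWeakSolutionSHE hB hWB ha hZ, fun k b => ?_⟩
    · rw [← integral_congr_ae (hZ b)]
      exact (hgauss _ (hmem b)).integral_eq_zero
    · rw [← inner_limitLp hW hB hWB σ₀ ha, L2.inner_def]
      refine integral_congr_ae ?_
      filter_upwards [hZ b, hZ c] with ω h1 h2
      rw [h1, h2]
      simp [mul_comm]
    · refine tendstoInDistribution_pi_of_tendsto_integral_exp (fun n => ?_) ?_ fun θ => ?_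
      · exact aemeasurable_pi_lambda _ fun i =>
          ((hsys.integrable_current hp n _ _).aestronglyMeasurable.aemeasurable.sub_const
            _).const_mul _
      · exact aemeasurable_pi_lambda _ fun i =>
          (Lp.aestronglyMeasurable _).aemeasurable.congr (hZ (b i))
      · rw [integral_exp_sum_limitLp hW hB hWB σ₀ ha hZ b θ]
        exact hsys.tendsto_integral_exp_scaledCurrent hp b θ
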